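/- Let $(G,H,\alpha,\tau)$ be a Lie crossed module: Lie groups $G,H$, smooth homomorphism $\tau:H\to G$, and an action $\alpha:G\to\mathrm{Aut}(H)$ with $(g,h)\mapsto\alpha(g)h$ smooth, $\tau(\alpha(g)h)=g\tau(h)g^{-1}$ and $\alpha(\tau(h))h'=hh'h^{-1}$. Its categorical group $\mathbf K$ has object group $G$ and morphism group $H\rtimes_\alpha G$, where $(h,a)$ has source $a$ and target $\tau(h)a$, and $(h_2,b)\circ(h_1,a)=(h_2h_1,a)$. Let $\pi:P\to M$ be a smooth principal $G$-bundle with connection form $\overline A$, and let $C$ be a $C^\infty$ $L(H)$-valued $1$-form on $P$ with $C_{pg}(vg)=\alpha(g^{-1})C_p(v)$ for all $p\in P$, $g\in G$, $v\in T_pP$. A backtrack-erased path is a piecewise $C^1$ path (defined on an interval $[t_0,t_1]$, $t_0\le t_1$) modulo strictly increasing piecewise $C^1$ reparametrization and modulo the relation $a\,d\,d^{-1}\,b\sim a\,b$. Let $\mathbb P^{\rm bt}(M)$ be the category with objects the points of $M$ and morphisms the backtrack-erased paths on $M$. Let $\mathbb P^{\rm bt}(P)^{\rm dec}_{\overline A}$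 be the category with objects the points of $P$ and with morphisms the pairs $(\tilde\gamma,h)$, where $\tilde\gamma$ is an $\overline A$-horizontal backtrack-erased path on $P$ and $h\in H$; the source of $(\tilde\gamma,h)$ is $s(\tilde\gamma)$, its target is $t(\tilde\gamma)\tau(h^{-1})$, and $$(\tilde\gamma_2,h_2)\circ(\tilde\gamma_1,h_1)=\bigl(\tilde\gamma_2\tau(h_1)\circ\tilde\gamma_1,\;h_2h_1\bigr).$$ Projection is $p\mapsto\pi(p)$, $(\tilde\gamma,h)\mapsto\pi\circ\tilde\gamma$, and $\mathbf K$ acts on the right by $(p,g)\mapsto pg$ and $(\tilde\gamma,h)\cdot(h_1,g_1)=\bigl(\tilde\gamma g_1,\alpha(g_1^{-1})(h_1^{-1}h)\bigr)$. This is a principal categorical bundle: the projection is surjective, and the action is free and is transitive on the fibres of the projection, both for objects and for morphisms. For every piecewise $C^1$ path $\gamma:[t_0,t_1]\to M$ and every $u\in P$ with $\pi(u)=\gamma(t_0)$, there are a unique $\overline A$-horizontal lift $\tilde\gamma_u:[t_0,t_1]\to P$ of $\gamma$ starting at $u$ and a unique continuous $h:[t_0,t_1]\to H$ with $h(t_0)=e$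 and $$h(t)^{-1}h'(t)=-C\bigl(\tilde\gamma_u'(t)\bigr)$$ at all $t$ at which $\tilde\gamma_u'(t)$ exists. Put $h_u(\gamma)=h(t_1)$ and $$\gamma^{\rm hor}_u=\bigl(\tilde\gamma_u,\,h_u(\gamma)\bigr).$$ **Theorem.** This lifting process is well defined on backtrack-erased paths, and it defines a categorical connection on the principal categorical bundle $\pi:\mathbb P^{\rm bt}(P)^{\rm dec}_{\overline A}\to\mathbb P^{\rm bt}(M)$. That is: $\gamma^{\rm hor}_u$ is a morphism with source $u$ that projects to $\gamma$; if $\zeta$ is a morphism whose source is the target of $\gamma$, and $q$ is the target of $\gamma^{\rm hor}_u$, then $(\zeta\circ\gamma)^{\rm hor}_u=\zeta^{\rm hor}_q\circ\gamma^{\rm hor}_u$; and $\gamma^{\rm hor}_{ug}=\gamma^{\rm hor}_u\cdot(e,g)$ for all $g\in G$. -/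

import Mathlib

open CategoryTheory Set
open scoped Manifold ContDiff RightActions

/-! ### Piecewise `C¹` paths and backtrack equivalence -/

section Paths

variable {E : Type*} [NormedAddCommGroup E] [NormedSpace ℝ E] {K : Type*} [TopologicalSpace K]
  {I : ModelWithCorners ℝ E K} {X : Type*} [TopologicalSpace X] [ChartedSpace K X]
  {E' : Type*} [NormedAddCommGroup E'] [NormedSpace ℝ E'] {K' : Type*} [TopologicalSpace K']
  {I' : ModelWithCorners ℝ E' K'} {Y : Type*} [TopologicalSpace Y] [ChartedSpace K' Y]

variable (I) in
/-- `γ` is piecewise `C¹` on `[a, b]`: it is continuous and, for some finite set `S` of break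
points, it is `C¹` on every closed subinterval `[x, y]` whose interior contains no point of `S`. -/
def PiecewiseC1On (γ : ℝ → X) (a b : ℝ) : Prop :=
  ContinuousOn γ (Icc a b) ∧
    ∃ S : Set ℝ, S.Finite ∧ ∀ x y, a ≤ x → x < y → y ≤ b → Disjoint S (Ioo x y) →
      ContMDiffOn 𝓘(ℝ, ℝ) I 1 γ (Icc x y)

theorem PiecewiseC1On.of_contMDiff {γ : ℝ → X} (h : ContMDiff 𝓘(ℝ, ℝ) I 1 γ) (a b : ℝ) :
    PiecewiseC1On I γ a b :=
  ⟨h.continuous.continuousOn, ∅, finite_empty, fun _ _ _ _ _ _ => h.contMDiffOn⟩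

theorem PiecewiseC1On.postcomp {γ : ℝ → X} {a b : ℝ} (h : PiecewiseC1On I γ a b) {f : X → Y}
    (hf : ContMDiff I I' 1 f) : PiecewiseC1On I' (fun t => f (γ t)) a b := by
  obtain ⟨hc, S, hS, h⟩ := h
  exact ⟨hf.continuous.comp_continuousOn hc, S, hS, fun x y h1 h2 h3 h4 =>
    hf.comp_contMDiffOn (h x y h1 h2 h3 h4)⟩

theorem contMDiff_shift (c : ℝ) : ContMDiff 𝓘(ℝ, ℝ) 𝓘(ℝ, ℝ) 1 (fun t : ℝ => t + c) :=
  (contDiff_id.add contDiff_const).contMDiff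

theorem contMDiff_reflect (c : ℝ) : ContMDiff 𝓘(ℝ, ℝ) 𝓘(ℝ, ℝ) 1 (fun t : ℝ => c - t) :=
  (contDiff_const.sub contDiff_id).contMDiff

theorem PiecewiseC1On.reflect {γ : ℝ → X} {a b : ℝ} (h : PiecewiseC1On I γ a b) :
    PiecewiseC1On I (fun t => γ (a + b - t)) a b := by
  obtain ⟨hc, S, hS, h⟩ := h
  refine ⟨hc.comp (contMDiff_reflect (a + b)).continuous.continuousOn ?_,
    (fun t => a + b - t) '' S, hS.image _, fun x y h1 h2 h3 h4 => ?_⟩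
  · intro t ht
    exact ⟨by linarith [ht.2], by linarith [ht.1]⟩
  · refine (h (a + b - y) (a + b - x) (by linarith) (by linarith) (by linarith) ?_).comp
      (contMDiff_reflect (a + b)).contMDiffOn ?_
    · rw [Set.disjoint_left] at h4 ⊢
      intro t ht ht'
      exact h4 (mem_image_of_mem _ ht) ⟨by linarith [ht'.2], by linarith [ht'.1]⟩
    · intro t ht
      exact ⟨by linarith [ht.2], by linarith [ht.1]⟩

theorem PiecewiseC1On.glue {f g : ℝ → X} {a b c d : ℝ} (hab : a ≤ b) (hcd : c ≤ d)
    (hf : PiecewiseC1On I f a b) (hg : PiecewiseC1On I g c d) (hfg : f b = g c) :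
    PiecewiseC1On I (fun t => if t ≤ b then f t else g (t - b + c)) a (b + (d - c)) := by
  obtain ⟨hfc, S, hS, hf⟩ := hf
  obtain ⟨hgc, T, hT, hg⟩ := hg
  have e1 : ∀ t, t ≤ b → (if t ≤ b then f t else g (t - b + c)) = f t := fun t ht => if_pos ht
  have e2 : ∀ t, b ≤ t → (if t ≤ b then f t else g (t - b + c)) = g (t - b + c) := by
    intro t ht
    rcases ht.eq_or_lt with rfl | ht
    · simp [hfg]
    · exact if_neg (not_le.2 ht)
  have hsh : ContMDiff 𝓘(ℝ, ℝ) 𝓘(ℝ, ℝ) 1 (fun t : ℝ => t - b + c) := by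
    have : (fun t : ℝ => t - b + c) = fun t => t + (c - b) := by ext; ring
    rw [this]; exact contMDiff_shift _
  refine ⟨?_, S ∪ {b} ∪ (fun t => t - c + b) '' T,
    (hS.union (finite_singleton b)).union (hT.image _), ?_⟩
  · have : Icc a (b + (d - c)) = Icc a b ∪ Icc b (b + (d - c)) :=
      (Icc_union_Icc_eq_Icc hab (by linarith)).symm
    rw [this]
    refine ContinuousOn.union_of_isClosed (hfc.congr fun t ht => e1 t ht.2) ?_ isClosed_Icc
      isClosed_Icc
    refine ContinuousOn.congr (f := fun t => g (t - b + c)) ?_ fun t ht => e2 t ht.1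
    exact hgc.comp hsh.continuous.continuousOn fun t ht =>
      ⟨by linarith [ht.1], by linarith [ht.2]⟩
  · intro x y hx hxy hy hd
    rw [Set.disjoint_left] at hd
    have hb : y ≤ b ∨ b ≤ x := by
      by_contra! hcon
      exact hd (Or.inl (Or.inr rfl)) ⟨hcon.2, hcon.1⟩
    rcases hb with hb | hb
    · refine (hf x y hx hxy hb ?_).congr fun t ht => e1 t (ht.2.trans hb)
      rw [Set.disjoint_left]
      exact fun t ht => hd (Or.inl (Or.inl ht))
    · refine ContMDiffOn.congr (f := fun t => g (t - b + c)) ?_ fun t ht => e2 t (hb.trans ht.1)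
      refine (hg (x - b + c) (y - b + c) (by linarith) (by linarith) (by linarith) ?_).comp
        hsh.contMDiffOn fun t ht => ⟨by linarith [ht.1], by linarith [ht.2]⟩
      rw [Set.disjoint_left]
      intro t ht ht'
      exact hd (Or.inr (mem_image_of_mem _ ht)) ⟨by linarith [ht'.1], by linarith [ht'.2]⟩

variable (I X) in
/-- A parametrized piecewise `C¹` path `[a, b] → X`. Only the values of `toFun` on `[a, b]` matter
(paths are always considered up to reparametrization, see below). A one-point domain `a = b` is
allowed, so that there are trivial paths. -/
structure ParamPath where
  /-- initial time -/
  a : ℝ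
  /-- final time -/
  b : ℝ
  le : a ≤ b
  /-- the path -/
  toFun : ℝ → X
  piecewiseC1 : PiecewiseC1On I toFun a b

namespace ParamPath

/-- The initial point. -/
def source (γ : ParamPath I X) : X := γ.toFun γ.a

/-- The final point. -/
def target (γ : ParamPath I X) : X := γ.toFun γ.b

variable (I) in
/-- The trivial path at a point. -/
def point (x : X) : ParamPath I X where
  a := 0
  b := 0
  le := le_rfl
  toFun := fun _ => x
  piecewiseC1 := .of_contMDiff contMDiff_const _ _

/-- The composite of two paths: first `γ`, then `δ`. -/
noncomputable def trans (γ δ : ParamPath I X) (h : γ.target = δ.source) : ParamPath I X where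
  a := γ.a
  b := γ.b + (δ.b - δ.a)
  le := by linarith [γ.le, δ.le]
  toFun := fun t => if t ≤ γ.b then γ.toFun t else δ.toFun (t - γ.b + δ.a)
  piecewiseC1 := .glue γ.le δ.le γ.piecewiseC1 δ.piecewiseC1 h

/-- The reverse of a path. -/
def reverse (γ : ParamPath I X) : ParamPath I X where
  a := γ.a
  b := γ.b
  le := γ.le
  toFun := fun t => γ.toFun (γ.a + γ.b - t)
  piecewiseC1 := γ.piecewiseC1.reflect

/-- The image of a path under a `C¹` map. -/
def map (f : X → Y) (hf : ContMDiff I I' 1 f) (γ : ParamPath I X) : ParamPath I' Y where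
  a := γ.a
  b := γ.b
  le := γ.le
  toFun := fun t => f (γ.toFun t)
  piecewiseC1 := γ.piecewiseC1.postcomp hf

@[simp] theorem source_point (x : X) : (point I x).source = x := rfl
@[simp] theorem target_point (x : X) : (point I x).target = x := rfl
@[simp] theorem source_map (f : X → Y) (hf : ContMDiff I I' 1 f) (γ : ParamPath I X) :
    (γ.map f hf).source = f γ.source := rfl
@[simp] theorem target_map (f : X → Y) (hf : ContMDiff I I' 1 f) (γ : ParamPath I X) :
    (γ.map f hf).target = f γ.target := rfl
@[simp] theorem source_reverse (γ : ParamPath I X) : γ.reverse.source = γ.target := by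
  simp [source, target, reverse]
@[simp] theorem target_reverse (γ : ParamPath I X) : γ.reverse.target = γ.source := by
  simp [source, target, reverse]
@[simp] theorem source_trans (γ δ : ParamPath I X) (h) : (γ.trans δ h).source = γ.source :=
  if_pos γ.le
theorem trans_of_le (γ δ : ParamPath I X) (h) {t : ℝ} (ht : t ≤ γ.b) :
    (γ.trans δ h).toFun t = γ.toFun t := if_pos ht
theorem trans_of_ge (γ δ : ParamPath I X) (h : γ.target = δ.source) {t : ℝ} (ht : γ.b ≤ t) :
    (γ.trans δ h).toFun t = δ.toFun (t - γ.b + δ.a) := by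
  rcases ht.eq_or_lt with rfl | ht
  · rw [trans_of_le _ _ _ le_rfl]; simpa [source, target] using h
  · exact if_neg (not_le.2 ht)
@[simp] theorem target_trans (γ δ : ParamPath I X) (h) : (γ.trans δ h).target = δ.target := by
  have := trans_of_ge γ δ h (t := γ.b + (δ.b - δ.a)) (by linarith [δ.le])
  refine this.trans ?_
  simp [target]

/-- `c'` is a reparametrization `c ∘ φ` of `c`, with `φ` a strictly increasing piecewise `C¹`
function from the domain of `c'` onto the domain of `c`. -/
def IsReparam (c' c : ParamPath I X) : Prop :=
  ∃ φ : ℝ → ℝ, PiecewiseC1On 𝓘(ℝ, ℝ) φ c'.a c'.b ∧ StrictMonoOn φ (Icc c'.a c'.b) ∧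
    φ c'.a = c.a ∧ φ c'.b = c.b ∧ ∀ t ∈ Icc c'.a c'.b, c'.toFun t = c.toFun (φ t)

/-- The path `a d d⁻¹ b` (first `a`, then `d`, then back along `d`, then `b`). -/
noncomputable def withSpur (a d b : ParamPath I X) (hd : a.target = d.source) (hb : a.target = b.source) :
    ParamPath I X :=
  ((a.trans d hd).trans d.reverse (by simp)).trans b (by simp [← hd, hb])

/-- Elementary backtrack equivalence: up to reparametrization, one of the two paths is
`a d d⁻¹ b` and the other one is `a b`. -/
def ElemBacktrack (c₁ c₂ : ParamPath I X) : Prop :=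
  ∃ (a d b : ParamPath I X) (hd : a.target = d.source) (hb : a.target = b.source),
    (IsReparam (withSpur a d b hd hb) c₁ ∧ IsReparam (a.trans b hb) c₂) ∨
    (IsReparam (a.trans b hb) c₁ ∧ IsReparam (withSpur a d b hd hb) c₂)

/-- Backtrack equivalence: a finite chain of elementary backtrack equivalences. -/
def BacktrackEquiv : ParamPath I X → ParamPath I X → Prop :=
  Relation.ReflTransGen ElemBacktrack

theorem ElemBacktrack.symm {c₁ c₂ : ParamPath I X} (h : ElemBacktrack c₁ c₂) :
    ElemBacktrack c₂ c₁ := by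
  obtain ⟨a, d, b, hd, hb, h | h⟩ := h
  · exact ⟨a, d, b, hd, hb, Or.inr h.symm⟩
  · exact ⟨a, d, b, hd, hb, Or.inl h.symm⟩

theorem BacktrackEquiv.symm {c₁ c₂ : ParamPath I X} (h : BacktrackEquiv c₁ c₂) :
    BacktrackEquiv c₂ c₁ := by
  induction h with
  | refl => exact .refl
  | tail _ h ih => exact .head h.symm ih

theorem BacktrackEquiv.trans {c₁ c₂ c₃ : ParamPath I X} (h : BacktrackEquiv c₁ c₂)
    (h' : BacktrackEquiv c₂ c₃) : BacktrackEquiv c₁ c₃ :=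
  Relation.ReflTransGen.trans h h'

variable (I X) in
/-- Backtrack equivalence as a setoid. -/
instance backtrackSetoid : Setoid (ParamPath I X) where
  r := BacktrackEquiv
  iseqv := ⟨fun _ => .refl, .symm, .trans⟩

theorem IsReparam.source_eq {c' c : ParamPath I X} (h : IsReparam c' c) :
    c'.source = c.source := by
  obtain ⟨φ, -, -, h1, -, h2⟩ := h
  rw [source, h2 _ (left_mem_Icc.2 c'.le), h1, source]

theorem IsReparam.target_eq {c' c : ParamPath I X} (h : IsReparam c' c) :
    c'.target = c.target := by
  obtain ⟨φ, -, -, -, h1, h2⟩ := h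
  rw [target, h2 _ (right_mem_Icc.2 c'.le), h1, target]

theorem ElemBacktrack.source_eq {c₁ c₂ : ParamPath I X} (h : ElemBacktrack c₁ c₂) :
    c₁.source = c₂.source := by
  obtain ⟨a, d, b, hd, hb, h | h⟩ := h <;>
    rw [← h.1.source_eq, ← h.2.source_eq] <;> simp [withSpur]

theorem ElemBacktrack.target_eq {c₁ c₂ : ParamPath I X} (h : ElemBacktrack c₁ c₂) :
    c₁.target = c₂.target := by
  obtain ⟨a, d, b, hd, hb, h | h⟩ := h <;>
    rw [← h.1.target_eq, ← h.2.target_eq] <;> simp [withSpur]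

theorem BacktrackEquiv.source_eq {c₁ c₂ : ParamPath I X} (h : BacktrackEquiv c₁ c₂) :
    c₁.source = c₂.source := by
  induction h with
  | refl => rfl
  | tail _ h ih => exact ih.trans h.source_eq

theorem BacktrackEquiv.target_eq {c₁ c₂ : ParamPath I X} (h : BacktrackEquiv c₁ c₂) :
    c₁.target = c₂.target := by
  induction h with
  | refl => rfl
  | tail _ h ih => exact ih.trans h.target_eq

/-- Two paths with the same domain and the same values there. -/
def SameOn (c' c : ParamPath I X) : Prop :=
  c'.a = c.a ∧ c'.b = c.b ∧ ∀ t ∈ Icc c'.a c'.b, c'.toFun t = c.toFun t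

theorem SameOn.isReparam {c' c : ParamPath I X} (h : SameOn c' c) : IsReparam c' c :=
  ⟨id, .of_contMDiff contMDiff_id _ _, strictMono_id.strictMonoOn _, h.1, h.2.1, h.2.2⟩

theorem SameOn.refl (c : ParamPath I X) : SameOn c c := ⟨rfl, rfl, fun _ _ => rfl⟩

theorem SameOn.symm {c' c : ParamPath I X} (h : SameOn c' c) : SameOn c c' :=
  ⟨h.1.symm, h.2.1.symm, fun t ht => (h.2.2 t (by rwa [h.1, h.2.1])).symm⟩

theorem SameOn.trans' {c₁ c₂ c₃ : ParamPath I X} (h : SameOn c₁ c₂) (h' : SameOn c₂ c₃) :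
    SameOn c₁ c₃ :=
  ⟨h.1.trans h'.1, h.2.1.trans h'.2.1, fun t ht =>
    (h.2.2 t ht).trans (h'.2.2 t (by rwa [← h.1, ← h.2.1]))⟩

theorem SameOn.congr {c c' d d' : ParamPath I X} (hc : SameOn c c') (hd : SameOn d d')
    (h : c.target = d.source) (h' : c'.target = d'.source) :
    SameOn (c.trans d h) (c'.trans d' h') := by
  refine ⟨hc.1, by simp [ParamPath.trans, hc.2.1, hd.1, hd.2.1], fun t ht => ?_⟩
  rcases le_total t c.b with htb | htb
  · rw [trans_of_le _ _ _ htb, trans_of_le _ _ _ (by rwa [← hc.2.1]), hc.2.2 t ⟨ht.1, htb⟩]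
  · have h2 : t ≤ c.b + (d.b - d.a) := ht.2
    rw [trans_of_ge _ _ _ htb, trans_of_ge _ _ _ (by rwa [← hc.2.1]), ← hc.2.1, ← hd.1,
      hd.2.2 _ ⟨by linarith, by linarith⟩]

theorem SameOn.assoc (c d e : ParamPath I X) (h : c.target = d.source) (h' : d.target = e.source) :
    SameOn ((c.trans d h).trans e (by simpa using h')) (c.trans (d.trans e h') (by simpa using h)) := by
  refine ⟨rfl, by simp [ParamPath.trans]; ring, fun t ht => ?_⟩
  have hcd : (c.trans d h).b = c.b + (d.b - d.a) := rfl
  rcases le_total t c.b with htb | htb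
  · rw [trans_of_le _ _ _ (by rw [hcd]; linarith [d.le]), trans_of_le _ _ _ htb,
      trans_of_le _ _ _ htb]
  · rw [trans_of_ge _ _ _ htb]
    have hda : (d.trans e h').a = d.a := rfl
    rcases le_total t (c.b + (d.b - d.a)) with ht2 | ht2
    · rw [trans_of_le _ _ _ (by rw [hcd]; linarith), trans_of_ge _ _ _ htb,
        trans_of_le _ _ _ (by rw [hda]; linarith), hda]
    · rw [trans_of_ge _ _ _ (by rw [hcd]; linarith), trans_of_ge _ _ _ (by rw [hda]; linarith),
        hda, hcd]
      congr 1; ring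

theorem SameOn.trans_point (c : ParamPath I X) {x : X} (h : c.target = x) :
    SameOn (c.trans (point I x) h) c := by
  refine ⟨rfl, by simp [ParamPath.trans, point], fun t ht => ?_⟩
  exact trans_of_le _ _ _ (by simpa [ParamPath.trans, point] using ht.2)

theorem IsReparam.congr {c c' d d' : ParamPath I X} (hc : IsReparam c c') (hd : IsReparam d d')
    (h : c.target = d.source) (h' : c'.target = d'.source) :
    IsReparam (c.trans d h) (c'.trans d' h') := by
  obtain ⟨φ, p1, m1, a1, b1, e1⟩ := hc
  obtain ⟨ψ, p2, m2, a2, b2, e2⟩ := hd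
  have p2' : PiecewiseC1On 𝓘(ℝ, ℝ) (fun t => ψ t + (c'.b - d'.a)) d.a d.b :=
    p2.postcomp (contMDiff_shift _)
  have hg := PiecewiseC1On.glue c.le d.le p1 p2' (by simp [b1, a2])
  set χ : ℝ → ℝ := fun t => if t ≤ c.b then φ t else ψ (t - c.b + d.a) + (c'.b - d'.a) with hχ
  have k1 : ∀ t, t ≤ c.b → χ t = φ t := fun t ht => if_pos ht
  have k2 : ∀ t, c.b ≤ t → χ t = ψ (t - c.b + d.a) + (c'.b - d'.a) := by
    intro t ht
    rcases ht.eq_or_lt with rfl | ht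
    · rw [k1 _ le_rfl]; simp [b1, a2]
    · exact if_neg (not_le.2 ht)
  have hcb : (c.trans d h).b = c.b + (d.b - d.a) := rfl
  refine ⟨χ, hg, ?_, (k1 _ c.le).trans a1, ?_, ?_⟩
  · have hu : Icc (c.trans d h).a (c.trans d h).b = Icc c.a c.b ∪ Icc c.b (c.trans d h).b :=
      (Icc_union_Icc_eq_Icc c.le (by rw [hcb]; linarith [d.le])).symm
    rw [hu]
    refine StrictMonoOn.union (c := c.b) (m1.congr fun t ht => (k1 t ht.2).symm) ?_
      (isGreatest_Icc c.le) (isLeast_Icc (by rw [hcb]; linarith [d.le]))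
    intro s hs t ht hst
    rw [hcb] at hs ht
    rw [k2 s hs.1, k2 t ht.1]
    have := m2 (a := s - c.b + d.a) (b := t - c.b + d.a) ⟨by linarith [hs.1], by linarith [hs.2]⟩
      ⟨by linarith [ht.1], by linarith [ht.2]⟩ (by linarith)
    linarith
  · rw [hcb, k2 _ (by linarith [d.le])]
    have : c.b + (d.b - d.a) - c.b + d.a = d.b := by ring
    rw [this, b2]
    simp only [ParamPath.trans]
    ring
  · intro t ht
    rcases le_total t c.b with htb | htb
    · rw [trans_of_le _ _ _ htb, k1 t htb, e1 t ⟨ht.1, htb⟩, trans_of_le]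
      rw [← b1]
      exact m1.monotoneOn ⟨ht.1, htb⟩ (right_mem_Icc.2 c.le) htb
    · have ht2 : t ≤ c.b + (d.b - d.a) := ht.2
      have hm : t - c.b + d.a ∈ Icc d.a d.b := ⟨by linarith, by linarith⟩
      have := m2.monotoneOn (left_mem_Icc.2 d.le) hm hm.1
      rw [trans_of_ge _ _ _ htb, k2 t htb, e2 _ hm, trans_of_ge _ _ _ (by linarith)]
      congr 1; ring

theorem IsReparam.equiv {c' c : ParamPath I X} (h : IsReparam c' c) : BacktrackEquiv c' c := by
  refine Relation.ReflTransGen.single ⟨c', point I c'.target, point I c'.target, rfl, rfl,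
    Or.inl ⟨SameOn.isReparam ?_, ?_⟩⟩
  · have h0 : c'.target = (point I c'.target).source := rfl
    refine SameOn.trans' (SameOn.trans_point _ (by simp)) ?_
    exact (SameOn.trans_point (c'.trans (point I c'.target) h0) (target_trans _ _ _)).trans'
      (SameOn.trans_point _ _)
  · have hs := SameOn.trans_point c' rfl
    obtain ⟨φ, p, m, ha, hb, e⟩ := h
    have hbb : (c'.trans (point I c'.target) rfl).b = c'.b := hs.2.1
    refine ⟨φ, by rw [hbb]; exact p, by rw [hbb]; exact m, ha, by rw [hbb]; exact hb, ?_⟩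
    intro t ht
    rw [hs.2.2 t ht]
    exact e t (by rwa [hbb] at ht)

theorem SameOn.equiv {c' c : ParamPath I X} (h : SameOn c' c) : BacktrackEquiv c' c :=
  h.isReparam.equiv

theorem BacktrackEquiv.erase (a d b : ParamPath I X) (hd : a.target = d.source)
    (hb : a.target = b.source) : BacktrackEquiv (withSpur a d b hd hb) (a.trans b hb) :=
  Relation.ReflTransGen.single ⟨a, d, b, hd, hb, Or.inl
    ⟨(SameOn.refl _).isReparam, (SameOn.refl _).isReparam⟩⟩

theorem spur_left (e a d b : ParamPath I X) (he : e.target = a.source) (hd : a.target = d.source)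
    (hb : a.target = b.source) :
    BacktrackEquiv (e.trans (withSpur a d b hd hb) (by simpa [withSpur] using he))
      (e.trans (a.trans b hb) (by simpa using he)) := by
  have h1 : SameOn (withSpur (e.trans a he) d b (by simpa using hd) (by simpa using hb))
      (e.trans (withSpur a d b hd hb) (by simpa [withSpur] using he)) := by
    refine SameOn.trans' (SameOn.congr (SameOn.trans' (SameOn.congr (SameOn.assoc e a d he hd)
      (SameOn.refl _) _ (by simp)) (SameOn.assoc e (a.trans d hd) d.reverse (by simpa using he)
        (by simp))) (SameOn.refl b) _ (by simp [← hd, hb])) ?_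
    exact SameOn.assoc e _ b (by simpa using he) _
  exact h1.symm.equiv.trans ((BacktrackEquiv.erase _ _ _ _ _).trans (SameOn.assoc e a b he hb).equiv)

theorem spur_right (e a d b : ParamPath I X) (he : b.target = e.source) (hd : a.target = d.source)
    (hb : a.target = b.source) :
    BacktrackEquiv ((withSpur a d b hd hb).trans e (by simpa [withSpur] using he))
      ((a.trans b hb).trans e (by simpa using he)) := by
  have h1 : SameOn ((withSpur a d b hd hb).trans e (by simpa [withSpur] using he))
      (withSpur a d (b.trans e he) hd (by simpa using hb)) :=
    SameOn.assoc _ b e _ he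
  exact h1.equiv.trans ((BacktrackEquiv.erase _ _ _ _ _).trans (SameOn.assoc a b e hb he).symm.equiv)

theorem ElemBacktrack.trans_left {c₁ c₂ : ParamPath I X} (hc : ElemBacktrack c₁ c₂)
    (e : ParamPath I X) (h₁ : e.target = c₁.source) (h₂ : e.target = c₂.source) :
    BacktrackEquiv (e.trans c₁ h₁) (e.trans c₂ h₂) := by
  obtain ⟨a, d, b, hd, hb, ⟨k₁, k₂⟩ | ⟨k₁, k₂⟩⟩ := hc
  · have ha : e.target = a.source := by simpa [h₂] using k₂.source_eq.symm
    exact ((SameOn.refl e).isReparam.congr k₁ _ h₁).equiv.symm.trans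
      ((spur_left e a d b ha hd hb).trans ((SameOn.refl e).isReparam.congr k₂ _ h₂).equiv)
  · have ha : e.target = a.source := by simpa [h₁] using k₁.source_eq.symm
    exact ((SameOn.refl e).isReparam.congr k₁ _ h₁).equiv.symm.trans
      ((spur_left e a d b ha hd hb).symm.trans ((SameOn.refl e).isReparam.congr k₂ _ h₂).equiv)

theorem ElemBacktrack.trans_right {c₁ c₂ : ParamPath I X} (hc : ElemBacktrack c₁ c₂)
    (e : ParamPath I X) (h₁ : c₁.target = e.source) (h₂ : c₂.target = e.source) :
    BacktrackEquiv (c₁.trans e h₁) (c₂.trans e h₂) := by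
  obtain ⟨a, d, b, hd, hb, ⟨k₁, k₂⟩ | ⟨k₁, k₂⟩⟩ := hc
  · have ha : b.target = e.source := by simpa [h₂] using k₂.target_eq
    exact (k₁.congr (SameOn.refl e).isReparam _ h₁).equiv.symm.trans
      ((spur_right e a d b ha hd hb).trans (k₂.congr (SameOn.refl e).isReparam _ h₂).equiv)
  · have ha : b.target = e.source := by simpa [h₁] using k₁.target_eq
    exact (k₁.congr (SameOn.refl e).isReparam _ h₁).equiv.symm.trans
      ((spur_right e a d b ha hd hb).symm.trans (k₂.congr (SameOn.refl e).isReparam _ h₂).equiv)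

theorem BacktrackEquiv.trans_left {c₁ c₂ : ParamPath I X} (hc : BacktrackEquiv c₁ c₂)
    (e : ParamPath I X) (h₁ : e.target = c₁.source) (h₂ : e.target = c₂.source) :
    BacktrackEquiv (e.trans c₁ h₁) (e.trans c₂ h₂) := by
  induction hc with
  | refl => exact .refl
  | tail _ h ih => exact (ih (h₂.trans h.source_eq.symm)).trans (h.trans_left e _ h₂)

theorem BacktrackEquiv.trans_right {c₁ c₂ : ParamPath I X} (hc : BacktrackEquiv c₁ c₂)
    (e : ParamPath I X) (h₁ : c₁.target = e.source) (h₂ : c₂.target = e.source) :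
    BacktrackEquiv (c₁.trans e h₁) (c₂.trans e h₂) := by
  induction hc with
  | refl => exact .refl
  | tail _ h ih => exact (ih (h.target_eq.trans h₂)).trans (h.trans_right e _ h₂)

theorem BacktrackEquiv.congr {c c' d d' : ParamPath I X} (hc : BacktrackEquiv c c')
    (hd : BacktrackEquiv d d') (h : c.target = d.source) (h' : c'.target = d'.source) :
    BacktrackEquiv (c.trans d h) (c'.trans d' h') :=
  (hc.trans_right d h (hc.target_eq ▸ h)).trans (hd.trans_left c' _ h')

theorem map_trans (f : X → Y) (hf : ContMDiff I I' 1 f) (c d : ParamPath I X)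
    (h : c.target = d.source) :
    (c.trans d h).map f hf = (c.map f hf).trans (d.map f hf) (congrArg f h) := by
  simp only [map, ParamPath.trans, apply_ite f]
  rfl

theorem IsReparam.map {c' c : ParamPath I X} (h : IsReparam c' c) (f : X → Y)
    (hf : ContMDiff I I' 1 f) : IsReparam (c'.map f hf) (c.map f hf) := by
  obtain ⟨φ, p, m, a, b, e⟩ := h
  exact ⟨φ, p, m, a, b, fun t ht => congrArg f (e t ht)⟩

theorem ElemBacktrack.map {c₁ c₂ : ParamPath I X} (h : ElemBacktrack c₁ c₂) (f : X → Y)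
    (hf : ContMDiff I I' 1 f) : ElemBacktrack (c₁.map f hf) (c₂.map f hf) := by
  obtain ⟨a, d, b, hd, hb, h⟩ := h
  refine ⟨a.map f hf, d.map f hf, b.map f hf, congrArg f hd, congrArg f hb, ?_⟩
  have e1 : (withSpur a d b hd hb).map f hf =
      withSpur (a.map f hf) (d.map f hf) (b.map f hf) (congrArg f hd) (congrArg f hb) := by
    simp only [withSpur, map_trans]; rfl
  rw [← e1, ← map_trans _ _ _ _ hb]
  exact h.imp (fun h => ⟨h.1.map f hf, h.2.map f hf⟩) fun h => ⟨h.1.map f hf, h.2.map f hf⟩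

theorem BacktrackEquiv.map {c₁ c₂ : ParamPath I X} (h : BacktrackEquiv c₁ c₂) (f : X → Y)
    (hf : ContMDiff I I' 1 f) : BacktrackEquiv (c₁.map f hf) (c₂.map f hf) := by
  induction h with
  | refl => exact .refl
  | tail _ h ih => exact ih.trans (Relation.ReflTransGen.single (h.map f hf))

end ParamPath

open ParamPath

variable (I X) in
/-- Backtrack-erased paths: backtrack equivalence classes of piecewise `C¹` paths. -/
def BtPath := Quotient (ParamPath.backtrackSetoid I X)

namespace BtPath

/-- The backtrack-erased path given by a parametrized path. -/
def mk (c : ParamPath I X) : BtPath I X := Quotient.mk _ c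

theorem sound {c d : ParamPath I X} (h : BacktrackEquiv c d) : mk c = mk d := Quotient.sound h

theorem ind {p : BtPath I X → Prop} (h : ∀ c, p (mk c)) (q) : p q := Quotient.ind h q

/-- Initial point. -/
def source : BtPath I X → X := Quotient.lift ParamPath.source fun _ _ h => h.source_eq

/-- Final point. -/
def target : BtPath I X → X := Quotient.lift ParamPath.target fun _ _ h => h.target_eq

open Classical in
/-- Composite of backtrack-erased paths, first `p`, then `q`. It is used only when
`p.target = q.source` (and has the irrelevant value `p` otherwise). -/
noncomputable def trans (p q : BtPath I X) : BtPath I X :=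
  Quotient.liftOn₂ p q
    (fun c d => if h : c.target = d.source then mk (c.trans d h) else mk c) <| by
      intro c d c' d' hc hd
      by_cases h : c.target = d.source
      · have h' : c'.target = d'.source := by rw [← hc.target_eq, ← hd.source_eq, h]
        simp only [dif_pos h, dif_pos h']
        exact sound (BacktrackEquiv.congr hc hd h h')
      · have h' : ¬ c'.target = d'.source := by rwa [← hc.target_eq, ← hd.source_eq]
        simp only [dif_neg h, dif_neg h']
        exact sound hc

/-- Image of a backtrack-erased path under a `C¹` map. -/
def map (f : X → Y) (hf : ContMDiff I I' 1 f) : BtPath I X → BtPath I' Y :=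
  Quotient.map (ParamPath.map f hf) fun _ _ h => BacktrackEquiv.map h f hf

@[simp] theorem source_mk (c : ParamPath I X) : (mk c).source = c.source := rfl
@[simp] theorem target_mk (c : ParamPath I X) : (mk c).target = c.target := rfl
@[simp] theorem map_mk (f : X → Y) (hf : ContMDiff I I' 1 f) (c : ParamPath I X) :
    (mk c).map f hf = mk (c.map f hf) := rfl
theorem trans_mk (c d : ParamPath I X) (h : c.target = d.source) :
    (mk c).trans (mk d) = mk (c.trans d h) := dif_pos h

@[simp] theorem source_map (f : X → Y) (hf : ContMDiff I I' 1 f) (p : BtPath I X) :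
    (p.map f hf).source = f p.source := by induction p using ind; rfl
@[simp] theorem target_map (f : X → Y) (hf : ContMDiff I I' 1 f) (p : BtPath I X) :
    (p.map f hf).target = f p.target := by induction p using ind; rfl

theorem source_trans (p q : BtPath I X) (h : p.target = q.source) :
    (p.trans q).source = p.source := by
  induction p using ind with | _ c
  induction q using ind with | _ d
  rw [trans_mk c d h]
  exact ParamPath.source_trans _ _ _

theorem target_trans (p q : BtPath I X) (h : p.target = q.source) :
    (p.trans q).target = q.target := by
  induction p using ind with | _ c
  induction q using ind with | _ d
  rw [trans_mk c d h]
  exact ParamPath.target_trans _ _ _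

theorem map_trans (f : X → Y) (hf : ContMDiff I I' 1 f) (p q : BtPath I X)
    (h : p.target = q.source) : (p.trans q).map f hf = (p.map f hf).trans (q.map f hf) := by
  induction p using ind with | _ c
  induction q using ind with | _ d
  have h' : (c.map f hf).target = (d.map f hf).source := congrArg f h
  rw [trans_mk c d h, map_mk, map_mk, map_mk, trans_mk _ _ h']
  exact congrArg mk (ParamPath.map_trans f hf c d h)

theorem map_map {E'' : Type*} [NormedAddCommGroup E''] [NormedSpace ℝ E''] {K'' : Type*}
    [TopologicalSpace K''] {I'' : ModelWithCorners ℝ E'' K''} {Z : Type*} [TopologicalSpace Z]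
    [ChartedSpace K'' Z] (f : X → Y) (hf : ContMDiff I I' 1 f) (g : Y → Z)
    (hg : ContMDiff I' I'' 1 g) (k : X → Z) (hk : ContMDiff I I'' 1 k) (e : ∀ x, g (f x) = k x)
    (p : BtPath I X) : (p.map f hf).map g hg = p.map k hk := by
  obtain rfl : (fun x => g (f x)) = k := funext e
  induction p using ind; rfl

theorem map_id (f : X → X) (hf : ContMDiff I I 1 f) (e : ∀ x, f x = x) (p : BtPath I X) :
    p.map f hf = p := by
  obtain rfl : f = fun x => x := funext e
  induction p using ind; rfl

theorem trans_assoc (p q r : BtPath I X) (h : p.target = q.source) (h' : q.target = r.source) :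
    (p.trans q).trans r = p.trans (q.trans r) := by
  induction p using ind with | _ c
  induction q using ind with | _ d
  induction r using ind with | _ e
  rw [trans_mk c d h, trans_mk d e h', trans_mk _ _ ((ParamPath.target_trans c d h).trans h'),
    trans_mk _ _ (Eq.trans h (ParamPath.source_trans d e h').symm)]
  exact sound (SameOn.assoc c d e h h').equiv

theorem trans_point (p : BtPath I X) {x : X} (h : p.target = x) :
    p.trans (mk (point I x)) = p := by
  induction p using ind with | _ c
  have h' : c.target = (point I x).source := h
  rw [trans_mk c _ h']
  exact sound (SameOn.trans_point c h).equiv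

theorem point_trans (p : BtPath I X) {x : X} (h : x = p.source) :
    (mk (point I x)).trans p = p := by
  induction p using ind with | _ c
  have h' : (point I x).target = c.source := h
  rw [trans_mk _ c h']
  refine sound (IsReparam.equiv ⟨fun t => t + c.a, .of_contMDiff (contMDiff_shift _) _ _,
    fun s _ t _ hst => by simpa using hst, by simp [ParamPath.trans, point],
    by simp [ParamPath.trans, point], fun t ht => ?_⟩)
  rw [trans_of_ge _ _ _ ht.1]
  simp [point]

end BtPath

/-- The category of backtrack-erased paths on `X`: its objects are the points of `X`. -/
def PathCat (_I : ModelWithCorners ℝ E K) (X : Type*) : Type _ := X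

/-- Morphisms `x ⟶ y` are the backtrack-erased piecewise `C¹` paths from `x` to `y`. -/
noncomputable instance PathCat.category : Category (PathCat I X) where
  Hom x y := {p : BtPath I X // p.source = x ∧ p.target = y}
  id x := ⟨BtPath.mk (point I x), rfl, rfl⟩
  comp p q := ⟨p.1.trans q.1, (BtPath.source_trans _ _ (p.2.2.trans q.2.1.symm)).trans p.2.1,
    (BtPath.target_trans _ _ (p.2.2.trans q.2.1.symm)).trans q.2.2⟩
  id_comp p := Subtype.ext (BtPath.point_trans _ p.2.1.symm)
  comp_id p := Subtype.ext (BtPath.trans_point _ p.2.2)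
  assoc p q r := Subtype.ext (BtPath.trans_assoc _ _ _ (p.2.2.trans q.2.1.symm)
    (q.2.2.trans r.2.1.symm))

/-- A parametrized path, regarded as a morphism of the category of backtrack-erased paths. -/
noncomputable def ParamPath.arrow (γ : ParamPath I X) : Arrow (PathCat I X) :=
  Arrow.mk (X := (γ.source : PathCat I X)) (Y := (γ.target : PathCat I X))
    ⟨BtPath.mk γ, rfl, rfl⟩

end Paths

/-! ### Categorical groups, principal categorical bundles, categorical connections -/

section Categorical

universe v₁ v₂ v₃ u₁ u₂ u₃

/-- The composite `g ∘ f` of two morphisms, as elements of the set of all morphisms of a category,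
when the target of `f` is the source of `g`. -/
def arrowComp {C : Type u₁} [Category.{v₁} C] (f g : Arrow C) (h : f.right = g.left) : Arrow C :=
  Arrow.mk (f.hom ≫ eqToHom h ≫ g.hom)

/-- A categorical group: a category `K` with a bifunctor `⊗ : K × K ⥤ K` which gives group
structures on the set of objects `K` and on the set of all morphisms `Arrow K`. -/
class CategoricalGroup (K : Type u₃) [Category.{v₃} K] [Group K] [Group (Arrow K)] where
  /-- the bifunctor -/
  tensor : K × K ⥤ K
  tensor_obj : ∀ a b : K, tensor.obj (a, b) = a * b
  tensor_map : ∀ f g : Arrow K, Arrow.mk (tensor.map (Prod.mkHom f.hom g.hom)) = f * g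

variable {P : Type u₁} [Category.{v₁} P] {B : Type u₂} [Category.{v₂} B]
  {K : Type u₃} [Category.{v₃} K] [Group K] [Group (Arrow K)] [CategoricalGroup K]

/-- The map on morphisms given by a functor `P × K ⥤ P`. -/
def actMor (ρ : P × K ⥤ P) (F : Arrow P) (φ : Arrow K) : Arrow P :=
  Arrow.mk (ρ.map (Prod.mkHom F.hom φ.hom))

/-- A functor `ρ : P × K ⥤ P` is a right action of the categorical group `K` on the category `P`
if it is a right action both on objects and on morphisms. -/
structure IsRightAction (ρ : P × K ⥤ P) : Prop where
  obj_one : ∀ p : P, ρ.obj (p, (1 : K)) = p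
  obj_mul : ∀ (p : P) (a b : K), ρ.obj (p, a * b) = ρ.obj (ρ.obj (p, a), b)
  mor_one : ∀ F : Arrow P, actMor ρ F 1 = F
  mor_mul : ∀ (F : Arrow P) (φ ψ : Arrow K), actMor ρ F (φ * ψ) = actMor ρ (actMor ρ F φ) ψ

/-- A principal categorical bundle with structure categorical group `K`: a functor `π : P ⥤ B`
together with a right action `ρ` of `K` on `P`, such that `π` is surjective, and the action is free
and is transitive on the fibres of `π`, both for objects and for morphisms. -/
structure IsPrincipalCategoricalBundle (π : P ⥤ B) (ρ : P × K ⥤ P) : Prop where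
  action : IsRightAction ρ
  obj_surjective : ∀ b : B, ∃ p : P, π.obj p = b
  mor_surjective : ∀ f : Arrow B, ∃ F : Arrow P, π.mapArrow.obj F = f
  obj_free : ∀ (p : P) (a : K), ρ.obj (p, a) = p → a = 1
  mor_free : ∀ (F : Arrow P) (φ : Arrow K), actMor ρ F φ = F → φ = 1
  obj_fibre : ∀ (p : P) (a : K), π.obj (ρ.obj (p, a)) = π.obj p
  mor_fibre : ∀ (F : Arrow P) (φ : Arrow K), π.mapArrow.obj (actMor ρ F φ) = π.mapArrow.obj F
  obj_transitive : ∀ p q : P, π.obj p = π.obj q → ∃ a : K, ρ.obj (p, a) = q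
  mor_transitive : ∀ F F' : Arrow P, π.mapArrow.obj F = π.mapArrow.obj F' →
    ∃ φ : Arrow K, actMor ρ F φ = F'

/-- A categorical connection on a principal categorical bundle `π : P ⥤ B` with structure
categorical group `K` acting by `ρ`: a prescription that lifts a morphism `γ` of `B` with source
`π p` to a morphism of `P` with source `p`, functorially in `γ` and equivariantly in `p`. -/
@[ext]
structure CategoricalConnection (π : P ⥤ B) (ρ : P × K ⥤ P) where
  /-- the horizontal lift of `γ` through `p` -/
  lift : ∀ (p : P) (γ : Arrow B), γ.left = π.obj p → Arrow P
  lift_source : ∀ p γ h, (lift p γ h).left = p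
  lift_proj : ∀ p γ h, π.mapArrow.obj (lift p γ h) = γ
  lift_comp : ∀ (p q : P) (γ ζ : Arrow B) (h : γ.left = π.obj p) (h' : γ.right = ζ.left)
    (hq : (lift p γ h).right = q) (hζ : ζ.left = π.obj q),
    lift p (arrowComp γ ζ h') h =
      arrowComp (lift p γ h) (lift q ζ hζ) (hq.trans (lift_source q ζ hζ).symm)
  lift_act : ∀ (p : P) (g : K) (γ : Arrow B) (h : γ.left = π.obj p)
    (h' : γ.left = π.obj (ρ.obj (p, g))),
    lift (ρ.obj (p, g)) γ h' = actMor ρ (lift p γ h) (Arrow.mk (𝟙 g))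

end Categorical

/-! ### Lie crossed modules and their categorical groups -/

section CrossedModule

variable {EG : Type*} [NormedAddCommGroup EG] [NormedSpace ℝ EG] {KG : Type*} [TopologicalSpace KG]
  {EH : Type*} [NormedAddCommGroup EH] [NormedSpace ℝ EH] {KH : Type*} [TopologicalSpace KH]

/-- A Lie crossed module `(G, H, α, τ)`. -/
structure LieCrossedModule (IG : ModelWithCorners ℝ EG KG) (IH : ModelWithCorners ℝ EH KH)
    (G : Type*) [Group G] [TopologicalSpace G] [ChartedSpace KG G]
    (H : Type*) [Group H] [TopologicalSpace H] [ChartedSpace KH H] where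
  /-- the action of `G` on `H` by automorphisms -/
  α : G →* MulAut H
  /-- the homomorphism `H → G` -/
  τ : H →* G
  τ_α : ∀ g h, τ (α g h) = g * τ h * g⁻¹
  α_τ : ∀ h h', α (τ h) h' = h * h' * h⁻¹
  smooth_τ : ContMDiff IH IG ∞ τ
  smooth_α : ContMDiff (IG.prod IH) IH ∞ (fun x : G × H => α x.1 x.2)

variable {IG : ModelWithCorners ℝ EG KG} {IH : ModelWithCorners ℝ EH KH}
  {G : Type*} [Group G] [TopologicalSpace G] [ChartedSpace KG G]
  {H : Type*} [Group H] [TopologicalSpace H] [ChartedSpace KH H]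

namespace LieCrossedModule

/-- The map on the Lie algebra of `H` induced by the automorphism `α g` of `H`. -/
noncomputable def lieα (𝔛 : LieCrossedModule IG IH G H) (g : G) :
    GroupLieAlgebra IH H → GroupLieAlgebra IH H :=
  fun Y => (mfderiv IH IH (fun h : H => 𝔛.α g h) (1 : H) Y : EH)

/-- The categorical group of a Lie crossed module: its objects are the elements of `G`. -/
def Cat (_𝔛 : LieCrossedModule IG IH G H) : Type _ := G

variable {𝔛 : LieCrossedModule IG IH G H}

instance : Group 𝔛.Cat := inferInstanceAs (Group G)

/-- Morphisms are the elements `(h, a)` of the semidirect product `H ⋊ G`; the source of `(h, a)`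
is `a`, its target is `τ(h) a`, and `(h₂, b) ∘ (h₁, a) = (h₂ h₁, a)`. -/
instance : Category 𝔛.Cat where
  Hom a b := {φ : H ⋊[𝔛.α] G // φ.right = a ∧ 𝔛.τ φ.left * φ.right = b}
  id a := ⟨⟨1, a⟩, rfl, (congrArg (· * (a : G)) (map_one 𝔛.τ)).trans (one_mul (a : G))⟩
  comp f g := ⟨⟨g.1.left * f.1.left, f.1.right⟩, f.2.1, by
    rw [map_mul, mul_assoc]
    exact (congrArg (𝔛.τ g.1.left * ·) (f.2.2.trans g.2.1.symm)).trans g.2.2⟩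
  id_comp f := by
    refine Subtype.ext (SemidirectProduct.ext (mul_one _) f.2.1.symm)
  comp_id f := Subtype.ext (SemidirectProduct.ext (one_mul _) rfl)
  assoc f g h := Subtype.ext (SemidirectProduct.ext (mul_assoc _ _ _).symm rfl)

/-- The morphism `(h, a)`. -/
def arrow (φ : H ⋊[𝔛.α] G) : Arrow 𝔛.Cat :=
  Arrow.mk (X := (φ.right : 𝔛.Cat)) (Y := (𝔛.τ φ.left * φ.right : G)) ⟨φ, rfl, rfl⟩

/-- The set of all morphisms is the semidirect product. -/
def arrowEquiv : Arrow 𝔛.Cat ≃ H ⋊[𝔛.α] G where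
  toFun f := f.hom.1
  invFun φ := arrow φ
  left_inv := by
    intro f
    obtain ⟨a, b, ⟨φ, rfl, rfl⟩, rfl⟩ := f.mk_surjective
    rfl
  right_inv _ := rfl

instance : Group (Arrow 𝔛.Cat) := arrowEquiv.group

theorem target_mul (φ ψ : H ⋊[𝔛.α] G) : 𝔛.τ (φ * ψ).left * (φ * ψ).right =
    (𝔛.τ φ.left * φ.right) * (𝔛.τ ψ.left * ψ.right) := by
  rw [SemidirectProduct.mul_left, SemidirectProduct.mul_right, map_mul, 𝔛.τ_α]
  group

/-- The product `(h, a)(k, c) = (h α(a)(k), a c)` makes `𝔛.Cat` a categorical group. -/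
instance : CategoricalGroup 𝔛.Cat where
  tensor :=
    { obj := fun x => x.1 * x.2
      map := fun {x y} f => ⟨f.1.1 * f.2.1, congrArg₂ (· * ·) f.1.2.1 f.2.2.1, (target_mul _ _).trans (congrArg₂ (· * ·) f.1.2.2 f.2.2.2)⟩
      map_id := fun x => Subtype.ext (SemidirectProduct.ext (by
        change (1 : H) * 𝔛.α x.1 1 = 1
        simp) rfl)
      map_comp := fun {x y z} f g => Subtype.ext (SemidirectProduct.ext (by
        change (g.1.1.left * f.1.1.left) * 𝔛.α f.1.1.right (g.2.1.left * f.2.1.left) =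
          (g.1.1.left * 𝔛.α g.1.1.right g.2.1.left) *
            (f.1.1.left * 𝔛.α f.1.1.right f.2.1.left)
        have h : g.1.1.right = 𝔛.τ f.1.1.left * f.1.1.right := g.1.2.1.trans f.1.2.2.symm
        rw [h, map_mul, map_mul, MulAut.mul_apply, 𝔛.α_τ]
        group) rfl) }
  tensor_obj _ _ := rfl
  tensor_map := by
    intro f g
    obtain ⟨a, b, ⟨φ, rfl, rfl⟩, rfl⟩ := f.mk_surjective
    obtain ⟨c, d, ⟨ψ, rfl, rfl⟩, rfl⟩ := g.mk_surjective
    exact (arrowEquiv (𝔛 := 𝔛)).injective rfl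

end LieCrossedModule

end CrossedModule

/-! ### Principal bundles, connection forms, decorated paths -/

section Bundles

set_option linter.unusedSectionVars false

/-- The velocity of a path: the path, on a nondegenerate interval `[a, b]`, has the derivative `v`
at `t ∈ [a, b]` (a one-sided derivative at the end points `a` and `b`). -/
def ParamPath.HasVelocity {E : Type*} [NormedAddCommGroup E] [NormedSpace ℝ E] {K : Type*}
    [TopologicalSpace K] {I : ModelWithCorners ℝ E K} {X : Type*} [TopologicalSpace X]
    [ChartedSpace K X] (γ : ParamPath I X) (t : ℝ) (v : TangentSpace I (γ.toFun t)) : Prop :=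
  γ.a < γ.b ∧ t ∈ Icc γ.a γ.b ∧
    HasMFDerivWithinAt 𝓘(ℝ, ℝ) I γ.toFun (Icc γ.a γ.b) t ((1 : ℝ →L[ℝ] ℝ).smulRight v)

variable {EG : Type*} [NormedAddCommGroup EG] [NormedSpace ℝ EG] {KG : Type*} [TopologicalSpace KG]
  {EH : Type*} [NormedAddCommGroup EH] [NormedSpace ℝ EH] {KH : Type*} [TopologicalSpace KH]
  {EP : Type*} [NormedAddCommGroup EP] [NormedSpace ℝ EP] {KP : Type*} [TopologicalSpace KP]
  {EM : Type*} [NormedAddCommGroup EM] [NormedSpace ℝ EM] {KM : Type*} [TopologicalSpace KM]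

/-- A smooth `1`-form `θ` on a manifold `P` with values in the vector space `F`: it is smooth as a
function on the tangent bundle. -/
def IsSmoothOneForm (IP : ModelWithCorners ℝ EP KP) {P : Type*} [TopologicalSpace P]
    [ChartedSpace KP P] [IsManifold IP ∞ P] {F : Type*} [NormedAddCommGroup F] [NormedSpace ℝ F]
    (θ : ∀ p : P, TangentSpace IP p →L[ℝ] F) : Prop :=
  ContMDiff IP.tangent 𝓘(ℝ, F) ∞ (fun v : TangentBundle IP P => θ v.proj v.2)

/-- A smooth principal `G`-bundle `P → M`, with right action `(p, g) ↦ p <• g`. -/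
structure PrincipalBundle (IP : ModelWithCorners ℝ EP KP) (IM : ModelWithCorners ℝ EM KM)
    (IG : ModelWithCorners ℝ EG KG)
    (P : Type*) [TopologicalSpace P] [ChartedSpace KP P]
    (M : Type*) [TopologicalSpace M] [ChartedSpace KM M]
    (G : Type*) [Group G] [TopologicalSpace G] [ChartedSpace KG G] [MulAction Gᵐᵒᵖ P] where
  /-- the projection -/
  proj : P → M
  proj_smooth : ContMDiff IP IM ∞ proj
  proj_surjective : Function.Surjective proj
  act_smooth : ContMDiff (IP.prod IG) IP ∞ (fun x : P × G => x.1 <• x.2)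
  act_free : ∀ (p : P) (g : G), p <• g = p → g = 1
  proj_act : ∀ (p : P) (g : G), proj (p <• g) = proj p
  locally_trivial : ∀ x : M, ∃ U : Set M, IsOpen U ∧ x ∈ U ∧
    ∃ φ : PartialDiffeomorph (IM.prod IG) IP (M × G) P ∞,
      φ.source = U ×ˢ univ ∧ φ.target = proj ⁻¹' U ∧
      ∀ u ∈ U, ∀ g h : G, φ (u, g) <• h = φ (u, g * h) ∧ proj (φ (u, g)) = u

variable {IG : ModelWithCorners ℝ EG KG} {IH : ModelWithCorners ℝ EH KH}
  {IP : ModelWithCorners ℝ EP KP} {IM : ModelWithCorners ℝ EM KM}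
  {G : Type*} [Group G] [TopologicalSpace G] [ChartedSpace KG G]
  {H : Type*} [Group H] [TopologicalSpace H] [ChartedSpace KH H]
  {P : Type*} [TopologicalSpace P] [ChartedSpace KP P]
  {M : Type*} [TopologicalSpace M] [ChartedSpace KM M]
  [MulAction Gᵐᵒᵖ P]

/-- The vector `v g = R_g'(p) v` obtained from a tangent vector `v` at `p` by right translation. -/
noncomputable def rightTranslate (IP : ModelWithCorners ℝ EP KP) (g : G) {p : P}
    (v : TangentSpace IP p) : TangentSpace IP (p <• g) :=
  mfderiv IP IP (fun q : P => q <• g) p v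

/-- The adjoint action `Ad g` on the Lie algebra. -/
noncomputable def lieAd (g : G) (Y : GroupLieAlgebra IG G) : GroupLieAlgebra IG G :=
  (mfderiv IG IG (fun x : G => g * x * g⁻¹) (1 : G) Y : EG)

/-- The value at `p` of the fundamental vertical vector field of `Y`, i.e. the derivative at `e` of
the orbit map `g ↦ p g` applied to `Y`. -/
noncomputable def fundamentalVector (IP : ModelWithCorners ℝ EP KP) (Y : GroupLieAlgebra IG G)
    (p : P) : TangentSpace IP p :=
  (mfderiv IG IP (fun g : G => p <• g) (1 : G) Y : EP)

namespace PrincipalBundle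

theorem translate_contMDiff (B : PrincipalBundle IP IM IG P M G) (g : G) :
    ContMDiff IP IP 1 (fun p : P => p <• g) :=
  (B.act_smooth.comp (contMDiff_id.prodMk (contMDiff_const (c := g)))).of_le (by simp)

theorem proj_contMDiff (B : PrincipalBundle IP IM IG P M G) : ContMDiff IP IM 1 B.proj :=
  B.proj_smooth.of_le (by simp)

theorem hasMFDerivAt_translate (B : PrincipalBundle IP IM IG P M G) (g : G) (p : P) :
    HasMFDerivAt IP IP (fun q : P => q <• g) p (mfderiv IP IP (fun q : P => q <• g) p) :=
  ((B.translate_contMDiff g).mdifferentiable one_ne_zero p).hasMFDerivAt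

theorem translate_translate (B : PrincipalBundle IP IM IG P M G) (g : G) (p : P) (v : EP) :
    (rightTranslate IP g (rightTranslate IP g⁻¹ (p := p) v) : EP) = v := by
  have h := (hasMFDerivAt_translate B g (p <• g⁻¹)).comp p (hasMFDerivAt_translate B g⁻¹ p)
  have e : (fun q : P => q <• g) ∘ (fun q : P => q <• g⁻¹) = id := by
    funext q
    change (q <• g⁻¹) <• g = q
    rw [op_smul_op_smul, inv_mul_cancel, MulOpposite.op_one, one_smul]
  rw [e] at h
  exact congrArg (fun L : EP →L[ℝ] EP => L v) (hasMFDerivAt_unique h (hasMFDerivAt_id p))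

end PrincipalBundle

variable [IsManifold IP ∞ P]

/-- A connection form on a principal `G`-bundle. -/
structure ConnectionForm (B : PrincipalBundle IP IM IG P M G) where
  /-- the form -/
  form : ∀ p : P, TangentSpace IP p →L[ℝ] GroupLieAlgebra IG G
  smooth : IsSmoothOneForm IP (F := EG) form
  equivariant : ∀ (p : P) (g : G) (v : TangentSpace IP p),
    form (p <• g) (rightTranslate IP g v) = lieAd g⁻¹ (form p v)
  vertical : ∀ (p : P) (Y : GroupLieAlgebra IG G), form p (fundamentalVector IP Y p) = Y

namespace ConnectionForm

variable {B : PrincipalBundle IP IM IG P M G}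

/-- A path is horizontal if the connection form vanishes on its velocities. -/
def IsHorizontal (A : ConnectionForm B) (γ : ParamPath IP P) : Prop :=
  ∀ t v, γ.HasVelocity t v → A.form (γ.toFun t) v = 0

/-- A backtrack-erased path is horizontal if it is given by a horizontal path. -/
def IsHorizontalBt (A : ConnectionForm B) (q : BtPath IP P) : Prop :=
  ∃ γ : ParamPath IP P, A.IsHorizontal γ ∧ BtPath.mk γ = q

theorem isHorizontal_point (A : ConnectionForm B) (p : P) :
    A.IsHorizontal (ParamPath.point IP p) :=
  fun _ _ h => absurd h.1 (lt_irrefl (0 : ℝ))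

theorem form_congr (A : ConnectionForm B) {x y : P} (h : x = y) (v : EP) :
    A.form x (v : TangentSpace IP x) = A.form y (v : TangentSpace IP y) := by
  subst h; rfl

theorem IsHorizontal.translate {A : ConnectionForm B} {γ : ParamPath IP P} (h : A.IsHorizontal γ)
    (g : G) : A.IsHorizontal (γ.map _ (B.translate_contMDiff g)) := by
  intro t v hv
  obtain ⟨h1, h2, h3⟩ := hv
  have h4 := (B.hasMFDerivAt_translate g⁻¹ (γ.toFun t <• g)).comp_hasMFDerivWithinAt t h3
  have e0 : ∀ p : P, (p <• g) <• g⁻¹ = p := fun p => by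
    rw [op_smul_op_smul, mul_inv_cancel, MulOpposite.op_one, one_smul]
  have e1 : ∀ p : P, (p <• g⁻¹) <• g = p := fun p => by
    rw [op_smul_op_smul, inv_mul_cancel, MulOpposite.op_one, one_smul]
  have e : ((fun q : P => q <• g⁻¹) ∘ (γ.map _ (B.translate_contMDiff g)).toFun) = γ.toFun :=
    funext fun s => e0 _
  rw [e] at h4
  have h5 : γ.HasVelocity t (rightTranslate IP g⁻¹ (p := γ.toFun t <• g) v : EP) := by
    refine ⟨h1, h2, h4.congr_mfderiv ?_⟩
    refine ContinuousLinearMap.ext fun r => ?_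
    exact map_smul (mfderiv IP IP (fun q : P => q <• g⁻¹) (γ.toFun t <• g)) (show ℝ from r) v
  have h6 := h t _ h5
  have h7 := A.equivariant ((γ.toFun t <• g) <• g⁻¹) g (rightTranslate IP g⁻¹ v)
  have h8 : A.form ((γ.toFun t <• g) <• g⁻¹) (rightTranslate IP g⁻¹ (p := γ.toFun t <• g) v) = 0 :=
    (A.form_congr (e0 _) _).trans h6
  rw [h8] at h7
  have h9 : lieAd (IG := IG) g⁻¹ 0 = 0 := by
    exact map_zero (mfderiv IG IG (fun x : G => g⁻¹ * x * g⁻¹⁻¹) (1 : G))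
  rw [h9] at h7
  rw [← h7]
  refine (A.form_congr (e1 _).symm v).trans ?_
  exact congrArg (fun w : EP => A.form (((γ.toFun t <• g) <• g⁻¹) <• g) w)
    (B.translate_translate g (γ.toFun t <• g) v).symm

theorem IsHorizontal.trans {A : ConnectionForm B} {γ δ : ParamPath IP P} (hγ : A.IsHorizontal γ)
    (hδ : A.IsHorizontal δ) (h : γ.target = δ.source) : A.IsHorizontal (γ.trans δ h) := by
  rintro t v ⟨h1, h2, h3⟩
  have hb : (γ.trans δ h).b = γ.b + (δ.b - δ.a) := rfl
  have ha : (γ.trans δ h).a = γ.a := rfl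
  by_cases hc : γ.a < γ.b ∧ t ≤ γ.b
  · have e : (γ.trans δ h).toFun t = γ.toFun t := γ.trans_of_le δ h hc.2
    rw [A.form_congr e v]
    have ht : t ∈ Icc γ.a γ.b := ⟨h2.1, hc.2⟩
    refine hγ t v ⟨hc.1, ht, ?_⟩
    exact h3.congr_mono (fun s hs => (γ.trans_of_le δ h hs.2).symm) e.symm
      (Icc_subset_Icc le_rfl (by rw [hb]; linarith [δ.le]))
  · have htb : γ.b ≤ t := by
      by_contra! hcon
      exact hc ⟨h2.1.trans_lt hcon, hcon.le⟩
    have hd : δ.a < δ.b := by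
      by_contra! hcon
      refine hc ⟨?_, ?_⟩
      · rw [ha, hb] at h1; linarith
      · have := h2.2; rw [hb] at this; linarith
    obtain ⟨r, rfl⟩ : ∃ r, t = r + (γ.b - δ.a) := ⟨t - (γ.b - δ.a), by ring⟩
    have key : ∀ s, δ.a ≤ s → δ.toFun s = (γ.trans δ h).toFun (s + (γ.b - δ.a)) := by
      intro s hs
      rw [γ.trans_of_ge δ h (by linarith)]
      congr 1; ring
    have hr : r ∈ Icc δ.a δ.b := ⟨by linarith, by have := h2.2; rw [hb] at this; linarith⟩
    rw [A.form_congr (key r hr.1).symm v]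
    refine hδ r v ⟨hd, hr, ?_⟩
    have hs : HasMFDerivWithinAt 𝓘(ℝ, ℝ) 𝓘(ℝ, ℝ) (fun s : ℝ => s + (γ.b - δ.a)) (Icc δ.a δ.b) r
        (ContinuousLinearMap.id ℝ ℝ) :=
      ((hasFDerivWithinAt_id r (Icc δ.a δ.b)).add_const (γ.b - δ.a)).hasMFDerivWithinAt
    have hsub : Icc δ.a δ.b ⊆ (fun s : ℝ => s + (γ.b - δ.a)) ⁻¹'
        Icc (γ.trans δ h).a (γ.trans δ h).b := fun s hs =>
      ⟨by rw [ha]; linarith [hs.1, γ.le], by rw [hb]; linarith [hs.2]⟩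
    have h4 := HasMFDerivWithinAt.comp r h3 hs hsub
    exact h4.congr_mono (fun s hs => key s hs.1) (key r hr.1) le_rfl

theorem IsHorizontalBt.translate {A : ConnectionForm B} {q : BtPath IP P} (h : A.IsHorizontalBt q)
    (g : G) : A.IsHorizontalBt (q.map _ (B.translate_contMDiff g)) := by
  obtain ⟨γ, hγ, rfl⟩ := h
  exact ⟨_, hγ.translate g, rfl⟩

theorem IsHorizontalBt.trans {A : ConnectionForm B} {q r : BtPath IP P} (hq : A.IsHorizontalBt q)
    (hr : A.IsHorizontalBt r) (h : q.target = r.source) : A.IsHorizontalBt (q.trans r) := by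
  obtain ⟨γ, hγ, rfl⟩ := hq
  obtain ⟨δ, hδ, rfl⟩ := hr
  exact ⟨γ.trans δ h, hγ.trans hδ h, (BtPath.trans_mk γ δ h).symm⟩

end ConnectionForm

/-- The category of decorated horizontal paths; its objects are the points of the bundle space. -/
def DecoratedCat {B : PrincipalBundle IP IM IG P M G} (_A : ConnectionForm B)
    (_𝔛 : LieCrossedModule IG IH G H) : Type _ := P

namespace DecoratedCat

variable {B : PrincipalBundle IP IM IG P M G} {A : ConnectionForm B}
  {𝔛 : LieCrossedModule IG IH G H}

/-- The composite of decorated paths, first `(γ₁, h₁)`, then `(γ₂, h₂)`: the underlying path is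
`γ₁` followed by the right translate `γ₂ τ(h₁)`, and the decoration is `h₂ h₁`. -/
noncomputable def decTrans (B : PrincipalBundle IP IM IG P M G) (𝔛 : LieCrossedModule IG IH G H)
    (m n : BtPath IP P × H) : BtPath IP P × H :=
  (m.1.trans (n.1.map _ (B.translate_contMDiff (𝔛.τ m.2))), n.2 * m.2)

/-- The action `(γ, h) · (h₁, g₁) = (γ g₁, α(g₁⁻¹)(h₁⁻¹ h))` on decorated paths. -/
noncomputable def decAct (B : PrincipalBundle IP IM IG P M G) (𝔛 : LieCrossedModule IG IH G H)
    (m : BtPath IP P × H) (φ : H ⋊[𝔛.α] G) : BtPath IP P × H :=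
  (m.1.map _ (B.translate_contMDiff φ.right), 𝔛.α φ.right⁻¹ (φ.left⁻¹ * m.2))

theorem source_eq_act {p q : P} {h : H} (e : p <• 𝔛.τ h⁻¹ = q) : p = q <• 𝔛.τ h := by
  rw [← e, op_smul_op_smul, ← map_mul, inv_mul_cancel, map_one, MulOpposite.op_one, one_smul]

theorem act_one_inv (𝔛 : LieCrossedModule IG IH G H) (p : P) : p <• 𝔛.τ (1 : H)⁻¹ = p := by
  rw [inv_one, map_one, MulOpposite.op_one, one_smul]

theorem composable (B : PrincipalBundle IP IM IG P M G) {m n : BtPath IP P × H}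
    (h : m.1.target <• 𝔛.τ m.2⁻¹ = n.1.source) :
    m.1.target = (n.1.map _ (B.translate_contMDiff (𝔛.τ m.2))).source := by
  rw [BtPath.source_map, ← source_eq_act h]

theorem target_decTrans {m n : BtPath IP P × H} (h : m.1.target <• 𝔛.τ m.2⁻¹ = n.1.source) :
    (decTrans B 𝔛 m n).1.target <• 𝔛.τ (decTrans B 𝔛 m n).2⁻¹ = n.1.target <• 𝔛.τ n.2⁻¹ := by
  simp only [decTrans]
  rw [BtPath.target_trans _ _ (composable B h), BtPath.target_map, op_smul_op_smul, ← map_mul,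
    mul_inv_rev, mul_inv_cancel_left]

theorem point_decTrans {m : BtPath IP P × H} {u : P} (h : m.1.source = u) :
    decTrans B 𝔛 (BtPath.mk (ParamPath.point IP u), 1) m = m := by
  refine Prod.ext ?_ (mul_one _)
  refine (congrArg _ (BtPath.map_id _ _ (fun x => ?_) _)).trans (BtPath.point_trans _ h.symm)
  rw [map_one, MulOpposite.op_one, one_smul]

theorem decTrans_point {m : BtPath IP P × H} {v : P} (h : m.1.target <• 𝔛.τ m.2⁻¹ = v) :
    decTrans B 𝔛 m (BtPath.mk (ParamPath.point IP v), 1) = m :=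
  Prod.ext (BtPath.trans_point m.1 (source_eq_act h)) (one_mul _)

theorem decTrans_assoc {l m n : BtPath IP P × H} (h : l.1.target <• 𝔛.τ l.2⁻¹ = m.1.source)
    (h' : m.1.target <• 𝔛.τ m.2⁻¹ = n.1.source) :
    decTrans B 𝔛 (decTrans B 𝔛 l m) n = decTrans B 𝔛 l (decTrans B 𝔛 m n) := by
  refine Prod.ext ?_ (mul_assoc _ _ _).symm
  simp only [decTrans]
  rw [BtPath.map_trans _ _ _ _ (composable B h'), BtPath.map_map _ _ _ _ _
    (B.translate_contMDiff (𝔛.τ (m.2 * l.2))) (fun x => by rw [op_smul_op_smul, map_mul])]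
  refine BtPath.trans_assoc _ _ _ (composable B h) ?_
  rw [BtPath.target_map, BtPath.source_map, source_eq_act h', op_smul_op_smul, map_mul]

theorem target_decAct (m : BtPath IP P × H) (φ : H ⋊[𝔛.α] G) :
    (decAct B 𝔛 m φ).1.target <• 𝔛.τ (decAct B 𝔛 m φ).2⁻¹ =
      (m.1.target <• 𝔛.τ m.2⁻¹) <• (𝔛.τ φ.left * φ.right) := by
  simp only [decAct]
  rw [BtPath.target_map, op_smul_op_smul, op_smul_op_smul, ← map_inv (𝔛.α _), 𝔛.τ_α]
  congr 2
  simp [mul_assoc]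

theorem decAct_one (m : BtPath IP P) (a : G) :
    decAct B 𝔛 (m, 1) ⟨1, a⟩ = (m.map _ (B.translate_contMDiff a), 1) :=
  Prod.ext rfl (by simp [decAct])

theorem decAct_decTrans {m n : BtPath IP P × H} (h : m.1.target <• 𝔛.τ m.2⁻¹ = n.1.source)
    {φ ψ : H ⋊[𝔛.α] G} (hφ : ψ.right = 𝔛.τ φ.left * φ.right) :
    decAct B 𝔛 (decTrans B 𝔛 m n) ⟨ψ.left * φ.left, φ.right⟩ =
      decTrans B 𝔛 (decAct B 𝔛 m φ) (decAct B 𝔛 n ψ) := by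
  refine Prod.ext ?_ ?_
  · refine (BtPath.map_trans _ _ _ _ (composable B h)).trans (congrArg (BtPath.trans _) ?_)
    refine (BtPath.map_map _ _ _ _ _ (B.translate_contMDiff (𝔛.τ m.2 * φ.right))
      (fun x => by rw [op_smul_op_smul]) _).trans (BtPath.map_map _ _ _ _ _ _ (fun x => ?_) _).symm
    rw [op_smul_op_smul]
    congr 2
    simp only [decAct]
    rw [hφ, 𝔛.τ_α]
    simp [mul_assoc]
  · simp only [decAct, decTrans]
    have e : 𝔛.α (𝔛.τ φ.left * φ.right)⁻¹ = 𝔛.α φ.right⁻¹ * 𝔛.α (𝔛.τ φ.left⁻¹) := by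
      rw [mul_inv_rev, map_mul, map_inv 𝔛.τ]
    rw [hφ, e, MulAut.mul_apply, 𝔛.α_τ, ← map_mul]
    congr 1
    group

/-- Morphisms `u ⟶ v` are the pairs `(γ, h)` of a horizontal backtrack-erased path `γ` and an
element `h` of `H`, such that `γ` starts at `u` and `t(γ) τ(h⁻¹) = v`. -/
noncomputable instance : Category (DecoratedCat A 𝔛) where
  Hom u v := {m : BtPath IP P × H //
    A.IsHorizontalBt m.1 ∧ m.1.source = u ∧ m.1.target <• 𝔛.τ m.2⁻¹ = v}
  id u := ⟨(BtPath.mk (ParamPath.point IP u), 1), ⟨_, A.isHorizontal_point u, rfl⟩, rfl,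
    act_one_inv (P := P) 𝔛 u⟩
  comp f g := ⟨decTrans B 𝔛 f.1 g.1,
    f.2.1.trans (g.2.1.translate _) (composable B (f.2.2.2.trans g.2.2.1.symm)),
    (BtPath.source_trans _ _ (composable B (f.2.2.2.trans g.2.2.1.symm))).trans f.2.2.1,
    (target_decTrans (B := B) (f.2.2.2.trans g.2.2.1.symm)).trans g.2.2.2⟩
  id_comp f := Subtype.ext (point_decTrans (B := B) (𝔛 := 𝔛) f.2.2.1)
  comp_id f := Subtype.ext (decTrans_point (B := B) (𝔛 := 𝔛) f.2.2.2)
  assoc f g h := Subtype.ext (decTrans_assoc (B := B) (𝔛 := 𝔛) (f.2.2.2.trans g.2.2.1.symm)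
    (g.2.2.2.trans h.2.2.1.symm))

/-- The projection of the category of decorated horizontal paths to the category of backtrack-erased
paths on `M`: it is `p ↦ π(p)` on objects, and `(γ, h) ↦ π ∘ γ` on morphisms. -/
noncomputable def proj (A : ConnectionForm B) (𝔛 : LieCrossedModule IG IH G H) :
    DecoratedCat A 𝔛 ⥤ PathCat IM M where
  obj u := B.proj u
  map f := ⟨f.1.1.map _ B.proj_contMDiff,
    (BtPath.source_map _ _ _).trans (congrArg B.proj f.2.2.1),
    (BtPath.target_map _ _ _).trans ((B.proj_act _ _).symm.trans (congrArg B.proj f.2.2.2))⟩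
  map_id _ := rfl
  map_comp f g := by
    have hc := composable (𝔛 := 𝔛) B (f.2.2.2.trans g.2.2.1.symm)
    refine Subtype.ext ((BtPath.map_trans _ B.proj_contMDiff _ _ hc).trans ?_)
    exact congrArg (BtPath.trans _) (BtPath.map_map _ _ _ _ _ _ (fun x => B.proj_act x _) _)

/-- The right action of the categorical group of the crossed module on the category of decorated
horizontal paths: it is `(p, g) ↦ p g` on objects, and
`(γ, h) · (h₁, g₁) = (γ g₁, α(g₁⁻¹)(h₁⁻¹ h))` on morphisms. -/
noncomputable def act (A : ConnectionForm B) (𝔛 : LieCrossedModule IG IH G H) :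
    DecoratedCat A 𝔛 × 𝔛.Cat ⥤ DecoratedCat A 𝔛 where
  obj x := (fun (p : P) (g : G) => p <• g) x.1 x.2
  map f := ⟨decAct B 𝔛 f.1.1 f.2.1, f.1.2.1.translate _,
    (BtPath.source_map _ _ _).trans
      (congrArg₂ (fun (p : P) (g : G) => p <• g) f.1.2.2.1 f.2.2.1),
    (target_decAct _ _).trans
      (congrArg₂ (fun (p : P) (g : G) => p <• g) f.1.2.2.2 f.2.2.2)⟩
  map_id _ := Subtype.ext (decAct_one (B := B) (𝔛 := 𝔛) _ _)
  map_comp f g := Subtype.ext (decAct_decTrans (B := B) (𝔛 := 𝔛) (f.1.2.2.2.trans g.1.2.2.1.symm)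
    (g.2.2.1.trans f.2.2.2.symm))

/-- The morphism of decorated paths given by a horizontal path `γ` and `h ∈ H`. -/
noncomputable def arrow (A : ConnectionForm B) (𝔛 : LieCrossedModule IG IH G H)
    (γ : ParamPath IP P) (hγ : A.IsHorizontal γ) (h : H) : Arrow (DecoratedCat A 𝔛) :=
  Arrow.mk (X := (γ.source : DecoratedCat A 𝔛)) (Y := (γ.target <• 𝔛.τ h⁻¹ : P))
    ⟨(BtPath.mk γ, h), ⟨γ, hγ, rfl⟩, rfl, rfl⟩

end DecoratedCat

/-- `γ'` is the horizontal lift of `γ` through `u`. -/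
structure IsHorizontalLift {B : PrincipalBundle IP IM IG P M G} (A : ConnectionForm B)
    (γ : ParamPath IM M) (u : P) (γ' : ParamPath IP P) : Prop where
  left_eq : γ'.a = γ.a
  right_eq : γ'.b = γ.b
  source_eq : γ'.source = u
  proj_eq : ∀ t ∈ Icc γ.a γ.b, B.proj (γ'.toFun t) = γ.toFun t
  horizontal : A.IsHorizontal γ'

/-- `h : [a, b] → H` is the solution of `h(t)⁻¹ h'(t) = -C(γ'(t))`, `h(a) = e`: it is continuous,
and the equation `h'(t) = -(L_{h(t)})_* C(γ'(t))` holds at all `t ∈ [a, b]` at which the velocity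
of the path `γ` exists. -/
structure IsDecorationSolution {IH : ModelWithCorners ℝ EH KH}
    (C : ∀ p : P, TangentSpace IP p →L[ℝ] GroupLieAlgebra IH H) (γ : ParamPath IP P)
    (h : ℝ → H) : Prop where
  continuousOn : ContinuousOn h (Icc γ.a γ.b)
  initial : h γ.a = 1
  equation : ∀ t v, γ.HasVelocity t v →
    HasMFDerivWithinAt 𝓘(ℝ, ℝ) IH h (Icc γ.a γ.b) t
      ((1 : ℝ →L[ℝ] ℝ).smulRight (mulInvariantVectorField (-C (γ.toFun t) v) (h t)))

end Bundles

/-!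
The proof has an analytic half, about a single path, and a formal half, about backtrack-erased paths.

*Existence.* On a Lie group, the equation `h' = h Y` with continuous `Y` is solved near the identity
by the Picard-Lindelöf theorem in a chart; the length of the interval depends only on a bound for
`Y`. As the equation is invariant under left translations, such solutions can be continued. This
yields the solution `h` of `h⁻¹ h' = -C(γ')` (called the *decoration* of `γ` below,
`exists_isDecorationSolution`), and also the horizontal lifts
(`ConnectionForm.exists_isHorizontalLift`): over the domain of a local section `σ` the curve
`σ(γ(t)) k(t)⁻¹` is horizontal if `k' = k Y`, with `Y` the value of the connection form on the
velocity of `σ ∘ γ`. In both cases local solutions are glued by a connectedness argument,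
`rel_of_locally`.

*Uniqueness.* A continuous curve whose velocity vanishes off a finite set is constant
(`eq_of_hasVelWithin_zero`). Applied to the quotient of two solutions it proves that solutions are
determined by their initial values, even if the equations hold only off a finite set of times
(`eqOn_of_decoratesAt`).

*Formal properties.* Conditions that are imposed only off a finite set survive cutting, pasting,
reversal and strictly increasing piecewise `C¹` reparametrization of paths. Hence the lift of a
composite is the composite of the lifts, the decoration being multiplicative, and the decoration of a
reversed path is the inverse. So the lift of `a d d⁻¹ b` is, up to reparametrization, `a' d' d'⁻¹ b'`
and its decoration agrees with that of the lift `a' b'` of `a b`: lifting is well defined on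
backtrack-erased paths (`IsDecoratedLift.backtrackEquiv`). By the equivariance of the connection form
and of `C`, right translation by `g` maps decorated lifts to decorated lifts and changes the
decoration by `α(g⁻¹)`. For `g = τ(k)` this is conjugation by `k⁻¹`, which is what turns
multiplicativity into the composition law of the decorated category
(`backtrackErasedLift_trans`).

*Transitivity.* The principal bundle property is algebraic except for the transitivity of the action
on the fibres of the projection on morphisms: two horizontal paths with backtrack equivalent
projections are, after a right translation that matches their initial points, lifts of backtrack
equivalent paths through the same point, and therefore backtrack equivalent.
-/

/-! ### Velocities of curves in manifolds -/

section Curves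

variable {E : Type*} [NormedAddCommGroup E] [NormedSpace ℝ E] {K : Type*} [TopologicalSpace K]
  {I : ModelWithCorners ℝ E K} {X : Type*} [TopologicalSpace X] [ChartedSpace K X]
  {E' : Type*} [NormedAddCommGroup E'] [NormedSpace ℝ E'] {K' : Type*} [TopologicalSpace K']
  {I' : ModelWithCorners ℝ E' K'} {Y : Type*} [TopologicalSpace Y] [ChartedSpace K' Y]
  {E'' : Type*} [NormedAddCommGroup E''] [NormedSpace ℝ E''] {K'' : Type*} [TopologicalSpace K'']
  {I'' : ModelWithCorners ℝ E'' K''} {Z : Type*} [TopologicalSpace Z] [ChartedSpace K'' Z]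

variable (I I') in
/-- The derivative of `F : X → Y` at `x` as a linear map between the model spaces, to which the
tangent spaces of `X` and `Y` are definitionally equal. -/
noncomputable def tangentAt (F : X → Y) (x : X) : E →L[ℝ] E' := mfderiv I I' F x

variable (I) in
/-- The curve `f` has the velocity `v` at `t` within `s`. The velocity is regarded as an element of
the model space, to which all tangent spaces are definitionally equal. -/
def HasVelWithin (f : ℝ → X) (s : Set ℝ) (t : ℝ) (v : E) : Prop :=
  HasMFDerivWithinAt 𝓘(ℝ, ℝ) I f s t ((1 : ℝ →L[ℝ] ℝ).smulRight v : ℝ →L[ℝ] E)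

theorem MDifferentiableWithinAt.exists_hasVelWithin {f : ℝ → X} {s : Set ℝ} {t : ℝ}
    (h : MDifferentiableWithinAt 𝓘(ℝ, ℝ) I f s t) : ∃ v : E, HasVelWithin I f s t v := by
  have h1 := h.hasMFDerivWithinAt
  set L : ℝ →L[ℝ] E := mfderivWithin 𝓘(ℝ, ℝ) I f s t with hL
  refine ⟨L 1, ?_⟩
  have : (1 : ℝ →L[ℝ] ℝ).smulRight (L 1) = L := by ext; simp
  unfold HasVelWithin
  rw [this]
  exact h1

namespace HasVelWithin

variable {f g : ℝ → X} {s s' : Set ℝ} {t : ℝ} {v w : E}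

theorem mono (h : HasVelWithin I f s t v) (hs : s' ⊆ s) : HasVelWithin I f s' t v :=
  HasMFDerivWithinAt.mono h hs

theorem congr (h : HasVelWithin I f s t v) (hg : EqOn g f s) (ht : t ∈ s) :
    HasVelWithin I g s t v := by
  have h1 := HasMFDerivWithinAt.congr_of_eventuallyEq (f₁ := g) h
    (Filter.eventuallyEq_of_mem self_mem_nhdsWithin hg) (hg ht)
  exact h1

theorem union (h : HasVelWithin I f s t v) (h' : HasVelWithin I f s' t v) :
    HasVelWithin I f (s ∪ s') t v := HasMFDerivWithinAt.union h h'

theorem mono_of_mem (h : HasVelWithin I f s t v) (hs : s ∈ nhdsWithin t s') :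
    HasVelWithin I f s' t v := HasMFDerivWithinAt.mono_of_mem_nhdsWithin h hs

theorem unique (h : HasVelWithin I f s t v) (h' : HasVelWithin I f s t w)
    (hs : UniqueDiffWithinAt ℝ s t) : v = w := by
  have h1 := UniqueMDiffWithinAt.eq hs.uniqueMDiffWithinAt h h'
  have h2 := congrArg (fun L : ℝ →L[ℝ] E => L 1) h1
  simpa using h2

theorem const (x : X) (s : Set ℝ) (t : ℝ) : HasVelWithin I (fun _ => x) s t 0 := by
  have h1 := hasMFDerivWithinAt_const (I := 𝓘(ℝ, ℝ)) (I' := I) x s t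
  refine HasMFDerivWithinAt.congr_mfderiv h1 ?_
  exact ContinuousLinearMap.ext fun r => (smul_zero (show ℝ from r)).symm

theorem comp_map {F : X → Y} (h : HasVelWithin I f s t v)
    (hF : MDifferentiableAt I I' F (f t)) :
    HasVelWithin I' (fun r => F (f r)) s t (tangentAt I I' F (f t) v) := by
  have h1 := hF.hasMFDerivAt.comp_hasMFDerivWithinAt t h
  refine HasMFDerivWithinAt.congr_mfderiv h1 ?_
  exact ContinuousLinearMap.ext fun r => map_smul (tangentAt I I' F (f t)) (show ℝ from r) v

theorem comp_param {φ : ℝ → ℝ} {r : ℝ} (h : HasVelWithin I f s' (φ t) v)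
    (hφ : HasDerivWithinAt φ r s t) (hs : MapsTo φ s s') :
    HasVelWithin I (fun x => f (φ x)) s t (r • v) := by
  have h1 := HasMFDerivWithinAt.comp t h hφ.hasFDerivWithinAt.hasMFDerivWithinAt hs
  refine HasMFDerivWithinAt.congr_mfderiv h1 ?_
  refine ContinuousLinearMap.ext fun x => ?_
  exact mul_smul (show ℝ from x) r v

theorem prodMk {g : ℝ → Y} {w : E'} (h : HasVelWithin I f s t v) (h' : HasVelWithin I' g s t w) :
    HasVelWithin (I.prod I') (fun r => (f r, g r)) s t ((v, w) : E × E') := by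
  have h1 := HasMFDerivWithinAt.prodMk h h'
  refine HasMFDerivWithinAt.congr_mfderiv h1 ?_
  exact ContinuousLinearMap.ext fun r => rfl

/-- The product rule for a differentiable function of two variables along two curves. -/
theorem comp_map₂ {g : ℝ → Y} {w : E'} {F : X × Y → Z} (h : HasVelWithin I f s t v)
    (h' : HasVelWithin I' g s t w) (hF : MDifferentiableAt (I.prod I') I'' F (f t, g t)) :
    HasVelWithin I'' (fun r => F (f r, g r)) s t
      (tangentAt I I'' (fun x => F (x, g t)) (f t) v +
        tangentAt I' I'' (fun y => F (f t, y)) (g t) w) := by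
  have h1 := (h.prodMk h').comp_map hF
  have h2 : tangentAt (I.prod I') I'' F (f t, g t) ((v, w) : E × E') =
      tangentAt I I'' (fun x => F (x, g t)) (f t) v +
        tangentAt I' I'' (fun y => F (f t, y)) (g t) w :=
    mfderiv_prod_eq_add_apply (v := ((v, w) : E × E')) hF
  rw [← h2]
  exact h1

theorem hasDerivWithinAt {f : ℝ → E} (h : HasVelWithin 𝓘(ℝ, E) f s t v) :
    HasDerivWithinAt f v s t := by
  have h1 := HasMFDerivWithinAt.hasFDerivWithinAt h
  have e : ((1 : ℝ →L[ℝ] ℝ).smulRight v : ℝ →L[ℝ] E) = ContinuousLinearMap.toSpanSingleton ℝ v := by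
    ext
    simp
  rw [e] at h1
  exact h1

end HasVelWithin

theorem HasDerivWithinAt.hasVelWithin {f : ℝ → E} {s : Set ℝ} {t : ℝ} {v : E}
    (h : HasDerivWithinAt f v s t) : HasVelWithin 𝓘(ℝ, E) f s t v :=
  h.hasFDerivWithinAt.hasMFDerivWithinAt

theorem tangentAt_comp {F : X → Y} {G : Y → Z} {x : X} (hG : MDifferentiableAt I' I'' G (F x))
    (hF : MDifferentiableAt I I' F x) (v : E) :
    tangentAt I I'' (fun y => G (F y)) x v = tangentAt I' I'' G (F x) (tangentAt I I' F x v) :=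
  congrArg (fun L : E →L[ℝ] E'' => L v) (mfderiv_comp x hG hF)

theorem tangentAt_id (x : X) (v : E) : tangentAt I I (fun y : X => y) x v = v :=
  congrArg (fun L : E →L[ℝ] E => L v) (mfderiv_id (I := I) (x := x))

/-- A `C¹` curve has a continuous velocity: every continuous one-form takes continuous values
on it. -/
theorem exists_velocity_of_contMDiffOn [IsManifold I 1 X] {f : ℝ → X} {a b : ℝ} (hab : a < b)
    (hf : ContMDiffOn 𝓘(ℝ, ℝ) I 1 f (Icc a b)) :
    ∃ v : ℝ → E, (∀ t ∈ Icc a b, HasVelWithin I f (Icc a b) t (v t)) ∧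
      ContinuousOn (fun t => (⟨f t, v t⟩ : TangentBundle I X)) (Icc a b) := by
  set L : ℝ → (ℝ →L[ℝ] E) := fun t => mfderivWithin 𝓘(ℝ, ℝ) I f (Icc a b) t with hL
  refine ⟨fun t => L t 1, fun t ht => ?_, ?_⟩
  · obtain ⟨v, hv⟩ := (hf.mdifferentiableOn one_ne_zero t ht).exists_hasVelWithin
    have h1 : L t =
        ((1 : ℝ →L[ℝ] ℝ).smulRight v : ℝ →L[ℝ] E) :=
      HasMFDerivWithinAt.mfderivWithin hv (uniqueDiffOn_Icc hab t ht).uniqueMDiffWithinAt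
    have h2 : L t 1 = v := by rw [h1]; simp
    change HasVelWithin I f (Icc a b) t (L t 1)
    rw [h2]
    exact hv
  · have h1 := hf.continuousOn_tangentMapWithin le_rfl (uniqueDiffOn_Icc hab).uniqueMDiffOn
    have h2 : Continuous (fun t : ℝ => (⟨t, (1 : ℝ)⟩ : TangentBundle 𝓘(ℝ, ℝ) ℝ)) := by
      have := (tangentBundleModelSpaceHomeomorph 𝓘(ℝ, ℝ)).symm.continuous.comp
        (continuous_id.prodMk (continuous_const (y := (1 : ℝ))))
      exact this
    exact h1.comp h2.continuousOn fun t ht => ht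

end Curves

/-- A transitive relation between points of `[a, b]` that holds for small intervals on either
side of any point holds between `a` and `b`. -/
theorem rel_of_locally {R : ℝ → ℝ → Prop} {a b : ℝ} (hab : a ≤ b)
    (htrans : ∀ x y z, a ≤ x → x ≤ y → y ≤ z → z ≤ b → R x y → R y z → R x z)
    (hloc : ∀ t ∈ Icc a b, ∃ ε > 0, ∀ x y, a ≤ x → x ≤ y → y ≤ b → t - ε < x → y < t + ε →
      (y ≤ t ∨ t ≤ x) → R x y) : R a b := by
  set T : Set ℝ := {t | t ∈ Icc a b ∧ R a t} with hT
  have haT : a ∈ T := by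
    obtain ⟨ε, hε, h⟩ := hloc a ⟨le_rfl, hab⟩
    exact ⟨⟨le_rfl, hab⟩, h a a le_rfl le_rfl hab (by linarith) (by linarith) (Or.inl le_rfl)⟩
  have hbdd : BddAbove T := ⟨b, fun t ht => ht.1.2⟩
  set c := sSup T with hc
  have hac : a ≤ c := le_csSup hbdd haT
  have hcb : c ≤ b := csSup_le ⟨a, haT⟩ fun t ht => ht.1.2
  obtain ⟨ε, hε, h⟩ := hloc c ⟨hac, hcb⟩
  obtain ⟨x, hx, hxc⟩ := exists_lt_of_lt_csSup ⟨a, haT⟩ (show c - ε < sSup T by linarith)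
  have hxle : x ≤ c := le_csSup hbdd hx
  have hRc : R a c := htrans a x c le_rfl hx.1.1 hxle hcb hx.2
    (h x c hx.1.1 hxle hcb hxc (by linarith) (Or.inl le_rfl))
  rcases hcb.eq_or_lt with e | hlt
  · rwa [← e]
  · exfalso
    set y := min b (c + ε / 2) with hy
    have hcy : c < y := lt_min hlt (by linarith)
    have hyT : y ∈ T := ⟨⟨hac.trans hcy.le, min_le_left _ _⟩,
      htrans a c y le_rfl hac hcy.le (min_le_left _ _) hRc
        (h c y hac hcy.le (min_le_left _ _) (by linarith)
          ((min_le_right _ _).trans_lt (by linarith)) (Or.inr le_rfl))⟩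
    exact absurd (le_csSup hbdd hyT) (not_le.2 hcy)

/-- Off a finite set, both sides of every point contain an interval without points of the set. -/
theorem exists_gap {S : Set ℝ} (hS : S.Finite) (t : ℝ) :
    ∃ ε > 0, ∀ x y, t - ε ≤ x → y ≤ t + ε → (y ≤ t ∨ t ≤ x) → Disjoint S (Ioo x y) := by
  have h1 : (S \ {t})ᶜ ∈ nhds t := (hS.subset sdiff_subset).isClosed.isOpen_compl.mem_nhds (by simp)
  obtain ⟨ε, hε, h⟩ := Metric.mem_nhds_iff.1 h1
  refine ⟨ε, hε, fun x y hx hy hxy => Set.disjoint_left.2 fun r hr hr' => ?_⟩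
  refine h (a := r) ?_ ⟨hr, ?_⟩
  · rw [Metric.mem_ball, Real.dist_eq, abs_lt]
    exact ⟨by linarith [hr'.1], by linarith [hr'.2]⟩
  · rintro rfl
    rcases hxy with hxy | hxy <;> linarith [hr'.1, hr'.2]

/-! ### Constancy criterion and the Picard-Lindelöf theorem -/

section Constancy

variable {E : Type*} [NormedAddCommGroup E] [NormedSpace ℝ E] [CompleteSpace E]
  {K : Type*} [TopologicalSpace K]
  {I : ModelWithCorners ℝ E K} {X : Type*} [TopologicalSpace X] [ChartedSpace K X]

/-- A continuous curve on `[a, b]` with values in a neighbourhood of every one of its points stays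
there for a short time. -/
theorem exists_mapsTo_of_continuousOn {Y : Type*} [TopologicalSpace Y] {f : ℝ → Y} {a b t : ℝ}
    (hf : ContinuousOn f (Icc a b)) (ht : t ∈ Icc a b) {U : Set Y} (hU : U ∈ nhds (f t)) :
    ∃ ε > 0, ∀ r ∈ Icc a b, t - ε < r → r < t + ε → f r ∈ U := by
  obtain ⟨ε, hε, h⟩ := Metric.mem_nhdsWithin_iff.1 (hf t ht hU)
  refine ⟨ε, hε, fun r hr h1 h2 => h ⟨?_, hr⟩⟩
  rw [Metric.mem_ball, Real.dist_eq, abs_lt]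
  exact ⟨by linarith, by linarith⟩

/-- A continuous curve whose velocity is zero off a finite set is constant. -/
theorem eq_of_hasVelWithin_zero [IsManifold I 1 X] {f : ℝ → X} {a b : ℝ} (hab : a ≤ b)
    (hf : ContinuousOn f (Icc a b)) {S : Set ℝ} (hS : S.Finite)
    (h : ∀ t ∈ Ioo a b, t ∉ S → HasVelWithin I f univ t 0) : f a = f b := by
  refine rel_of_locally (R := fun x y => f x = f y) hab (fun x y z _ _ _ _ h h' => h.trans h')
    fun t ht => ?_
  obtain ⟨ε, hε, hU⟩ := exists_mapsTo_of_continuousOn hf ht (extChartAt_source_mem_nhds (I := I) (f t))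
  refine ⟨ε, hε, fun x y hax hxy hyb h1 h2 _ => ?_⟩
  have hsrc : ∀ r ∈ Icc x y, f r ∈ (extChartAt I (f t)).source := fun r hr =>
    hU r ⟨hax.trans hr.1, hr.2.trans hyb⟩ (h1.trans_le hr.1) (hr.2.trans_lt h2)
  refine (extChartAt I (f t)).injOn (hsrc x ⟨le_rfl, hxy⟩) (hsrc y ⟨hxy, le_rfl⟩) ?_
  have h3 := MeasureTheory.integral_eq_of_hasDerivAt_off_countable_of_le
    (fun r => extChartAt I (f t) (f r)) (fun _ => 0) hxy hS.countable
    ((continuousOn_extChartAt (f t)).comp (hf.mono (Icc_subset_Icc hax hyb)) hsrc) ?_ (by simp)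
  · rw [intervalIntegral.integral_zero] at h3
    exact (sub_eq_zero.1 h3.symm).symm
  · rintro r ⟨hr, hrS⟩
    have h4 := h r ⟨hax.trans_lt hr.1, hr.2.trans_le hyb⟩ hrS
    have h5 := h4.comp_map (mdifferentiableAt_extChartAt (by
      simpa using hsrc r (Ioo_subset_Icc_self hr)))
    rw [map_zero] at h5
    exact h5.hasDerivWithinAt.hasDerivAt Filter.univ_mem

end Constancy

open Metric in
/-- The Picard-Lindelöf theorem, recording that the solution stays in the given ball. -/
theorem IsPicardLindelof.exists_mem_closedBall_hasDerivWithinAt {E : Type*} [NormedAddCommGroup E]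
    [NormedSpace ℝ E] [CompleteSpace E] {f : ℝ → E → E} {tmin tmax : ℝ} {t₀ : Icc tmin tmax}
    {x₀ : E} {a L K : NNReal} (hf : IsPicardLindelof f t₀ x₀ a 0 L K) :
    ∃ α : ℝ → E, α t₀ = x₀ ∧ (∀ t, α t ∈ closedBall x₀ a) ∧
      ∀ t ∈ Icc tmin tmax, HasDerivWithinAt α (f t (α t)) (Icc tmin tmax) t := by
  have hx : x₀ ∈ closedBall x₀ ((0 : NNReal) : ℝ) := mem_closedBall_self le_rfl
  obtain ⟨α, hα⟩ := ODE.FunSpace.exists_isFixedPt_next hf hx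
  rw [ODE.FunSpace.isFixedPt_next_iff] at hα
  have hmem : ∀ t, α.compProj t ∈ closedBall x₀ a := fun t =>
    ODE.FunSpace.compProj_mem_closedBall α hf.mul_max_le
  refine ⟨α.compProj, ?_, hmem, fun t ht => ?_⟩
  · rw [ODE.FunSpace.compProj_val, hα]
    simp
  · refine (ODE.hasDerivWithinAt_picard_Icc t₀.2 hf.continuousOn_uncurry
      α.continuous_compProj.continuousOn (fun t' _ => hmem t') x₀ ht).congr_of_mem
      (fun t' ht' => ?_) ht
    rw [ODE.FunSpace.compProj_of_mem ht', hα]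

/-! ### Differential equations on Lie groups -/

section LieGroups

variable {E : Type*} [NormedAddCommGroup E] [NormedSpace ℝ E]
  {K : Type*} [TopologicalSpace K] {I : ModelWithCorners ℝ E K}
  {H : Type*} [Group H] [TopologicalSpace H] [ChartedSpace K H]

variable (I) in
/-- The value at `h` of the left-invariant vector field given by a vector of the Lie algebra, as a
linear map on the model space. -/
noncomputable def leftInv (h : H) : E →L[ℝ] E := tangentAt I I (fun x : H => h * x) 1

variable [LieGroup I ∞ H]

theorem mdifferentiable_leftMul (h : H) : MDifferentiable I I (fun x : H => h * x) :=
  (contMDiff_mul_left (I := I) (n := ∞) (a := h)).mdifferentiable (by simp)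

theorem mdifferentiable_rightMul (h : H) : MDifferentiable I I (fun x : H => x * h) :=
  (contMDiff_mul_right (I := I) (n := ∞) (a := h)).mdifferentiable (by simp)

theorem mdifferentiable_mul : MDifferentiable (I.prod I) I (fun x : H × H => x.1 * x.2) :=
  (contMDiff_mul I ∞).mdifferentiable (by simp)

theorem tangentAt_mul_left_leftInv (k h : H) (Y : E) :
    tangentAt I I (fun x : H => k * x) h (leftInv I h Y) = leftInv I (k * h) Y := by
  have h1 := tangentAt_comp (I := I) (F := fun x : H => h * x) (G := fun x : H => k * x) (x := 1)
    (mdifferentiable_leftMul k _) (mdifferentiable_leftMul h _) Y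
  simp only [mul_one] at h1
  rw [leftInv, ← h1, leftInv]
  simp only [mul_assoc]

theorem tangentAt_mul_left_injective {h x : H} {v : E}
    (hv : tangentAt I I (fun y : H => h * y) x v = 0) : v = 0 := by
  have h2 := tangentAt_comp (I := I) (F := fun x : H => h * x) (G := fun x : H => h⁻¹ * x) (x := x)
    (mdifferentiable_leftMul h⁻¹ _) (mdifferentiable_leftMul h _) v
  simp only [inv_mul_cancel_left] at h2
  rw [tangentAt_id, hv, map_zero] at h2
  exact h2

theorem tangentAt_mul_right_injective {h x : H} {v : E}
    (hv : tangentAt I I (fun y : H => y * h) x v = 0) : v = 0 := by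
  have h2 := tangentAt_comp (I := I) (F := fun x : H => x * h) (G := fun x : H => x * h⁻¹) (x := x)
    (mdifferentiable_rightMul h⁻¹ _) (mdifferentiable_rightMul h _) v
  simp only [mul_inv_cancel_right] at h2
  rw [tangentAt_id, hv, map_zero] at h2
  exact h2

theorem tangentAt_mul_right_leftInv (k : H) (Y : E) :
    tangentAt I I (fun x : H => x * k⁻¹) k (leftInv I k Y) =
      tangentAt I I (fun x : H => k * x * k⁻¹) 1 Y := by
  have h1 := tangentAt_comp (I := I) (F := fun x : H => k * x) (G := fun x : H => x * k⁻¹) (x := 1)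
    (mdifferentiable_rightMul k⁻¹ _) (mdifferentiable_leftMul k _) Y
  simp only [mul_one] at h1
  rw [h1, leftInv]

theorem HasVelWithin.mul_left {f : ℝ → H} {s : Set ℝ} {t : ℝ} {Y : E}
    (hf : HasVelWithin I f s t (leftInv I (f t) Y)) (k : H) :
    HasVelWithin I (fun r => k * f r) s t (leftInv I (k * f t) Y) := by
  rw [← tangentAt_mul_left_leftInv]
  exact hf.comp_map (mdifferentiable_leftMul k _)

/-- If `k' = k Y` and `g = k⁻¹` then `g⁻¹ g' = -Ad(g⁻¹) Y`. -/
theorem HasVelWithin.exists_inv {k : ℝ → H} {s : Set ℝ} {t : ℝ} {Y : E} (ht : t ∈ s)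
    (hs : UniqueDiffWithinAt ℝ s t)
    (hk : HasVelWithin I k s t (leftInv I (k t) Y)) :
    ∃ w : E, HasVelWithin I (fun r => (k r)⁻¹) s t w ∧
      tangentAt I I (fun x : H => k t * x) (k t)⁻¹ w =
        -tangentAt I I (fun x : H => k t * x * (k t)⁻¹) 1 Y := by
  have hinv : MDifferentiable I I (fun x : H => x⁻¹) :=
    (contMDiff_inv I ∞).mdifferentiable (by simp)
  have h1 := hk.comp_map (hinv (k t))
  refine ⟨_, h1, ?_⟩
  have h2 := HasVelWithin.comp_map₂ (F := fun x : H × H => x.1 * x.2) hk h1 (mdifferentiable_mul _)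
  have h3 : HasVelWithin I (fun r => k r * (k r)⁻¹) s t 0 :=
    (HasVelWithin.const (1 : H) s t).congr (fun r _ => mul_inv_cancel _) ht
  have h4 := h2.unique h3 hs
  rw [tangentAt_mul_right_leftInv] at h4
  exact eq_neg_of_add_eq_zero_right h4

/-- Solutions of `h' = h Y` are unique, even if the equation holds only off a finite set. -/
theorem leftInv_solution_unique [CompleteSpace E] {h k : ℝ → H} {a b : ℝ} (hab : a ≤ b)
    (hh : ContinuousOn h (Icc a b)) (hk : ContinuousOn k (Icc a b)) (h0 : h a = k a)
    {S : Set ℝ} (hS : S.Finite)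
    (hd : ∀ t ∈ Ioo a b, t ∉ S → ∃ Y : E, HasVelWithin I h univ t (leftInv I (h t) Y) ∧
      HasVelWithin I k univ t (leftInv I (k t) Y)) : h b = k b := by
  have : IsTopologicalGroup H := topologicalGroup_of_lieGroup I ∞
  have h1 : h a * (k a)⁻¹ = h b * (k b)⁻¹ := by
    refine eq_of_hasVelWithin_zero (I := I) (f := fun t => h t * (k t)⁻¹) hab (hh.mul hk.inv) hS
      fun t ht htS => ?_
    obtain ⟨Y, hY, hY'⟩ := hd t ht htS
    have hinv : MDifferentiable I I (fun x : H => x⁻¹) :=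
      (contMDiff_inv I ∞).mdifferentiable (by simp)
    have h2 := HasVelWithin.comp_map₂ (F := fun x : H × H => x.1 * x.2) hY (hY'.comp_map (hinv (k t)))
      (mdifferentiable_mul _)
    -- The quotient `q = h k⁻¹` satisfies `q k = h`, which determines its velocity.
    set w : E := _ with hw
    change HasVelWithin I (fun t => h t * (k t)⁻¹) univ t w at h2
    have h3 := HasVelWithin.comp_map₂ (F := fun x : H × H => x.1 * x.2) h2 hY' (mdifferentiable_mul _)
    simp only [inv_mul_cancel_right] at h3
    have h4 := h3.unique hY uniqueDiffWithinAt_univ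
    rw [tangentAt_mul_left_leftInv, inv_mul_cancel_right] at h4
    have h5 : w = 0 := tangentAt_mul_right_injective (add_eq_right.1 h4)
    rwa [h5] at h2
  rw [h0, mul_inv_cancel] at h1
  exact (mul_inv_eq_one.1 h1.symm)

end LieGroups

/-! ### Local solutions on Lie groups -/

section LieGroupODE

variable {E : Type*} [NormedAddCommGroup E] [NormedSpace ℝ E]
  {K : Type*} [TopologicalSpace K] {I : ModelWithCorners ℝ E K} [I.Boundaryless]
  {H : Type*} [Group H] [TopologicalSpace H] [ChartedSpace K H] [LieGroup I ∞ H]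

theorem contMDiffAt_extChartAt_symm (x₀ : H) {x : E} (hx : x ∈ (extChartAt I x₀).target) :
    ContMDiffAt 𝓘(ℝ, E) I ∞ (extChartAt I x₀).symm x :=
  (contMDiffOn_extChartAt_symm x₀).contMDiffAt ((isOpen_extChartAt_target x₀).mem_nhds hx)

theorem tangentAt_extChartAt_symm (x₀ : H) (Y : E) :
    tangentAt 𝓘(ℝ, E) I (extChartAt I x₀).symm (extChartAt I x₀ x₀) Y = Y := by
  have h1 := mfderivWithin_range_extChartAt_symm (I := I) (x := x₀)
  rw [I.range_eq_univ, mfderivWithin_univ] at h1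
  exact congrArg (fun L : E →L[ℝ] E => L Y) h1

/-- In the chart at the identity, left-invariant vector fields depend differentiably on the base
point. -/
theorem exists_leftInv_chart :
    ∃ Φ : E → E →L[ℝ] E, ContDiffAt ℝ 1 Φ (extChartAt I (1 : H) 1) ∧
      ∀ x ∈ (extChartAt I (1 : H)).target, ∀ Y : E,
        tangentAt 𝓘(ℝ, E) I (extChartAt I (1 : H)).symm x (Φ x Y) =
          leftInv I ((extChartAt I (1 : H)).symm x) Y := by
  set ψ := extChartAt I (1 : H) with hψ
  set x₀ := ψ 1 with hx₀
  have hx₀t : x₀ ∈ ψ.target := mem_extChartAt_target (I := I) (1 : H)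
  have hψ1 : ψ.symm x₀ = 1 := extChartAt_to_inv (I := I) (1 : H)
  -- `m` is the multiplication in the chart; `Φ x` is the derivative of `m x` at the identity.
  set m : E → E → E := fun x y => ψ (ψ.symm x * ψ.symm y) with hm
  have hmul : ∀ x ∈ ψ.target, ContMDiffAt (𝓘(ℝ, E).prod 𝓘(ℝ, E)) 𝓘(ℝ, E) ∞
      (fun p : E × E => m p.1 p.2) (x, x₀) := by
    intro x hx
    have h1 : ContMDiffAt (𝓘(ℝ, E).prod 𝓘(ℝ, E)) I ∞ (fun p : E × E => ψ.symm p.1 * ψ.symm p.2)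
        (x, x₀) := by
      have h2 : ContMDiffAt (𝓘(ℝ, E).prod 𝓘(ℝ, E)) I ∞ (fun p : E × E => ψ.symm p.1) (x, x₀) :=
        ContMDiffAt.comp (x, x₀) (contMDiffAt_extChartAt_symm (I := I) (1 : H) hx) contMDiffAt_fst
      have h3 : ContMDiffAt (𝓘(ℝ, E).prod 𝓘(ℝ, E)) I ∞ (fun p : E × E => ψ.symm p.2) (x, x₀) :=
        ContMDiffAt.comp (x, x₀) (contMDiffAt_extChartAt_symm (I := I) (1 : H) hx₀t) contMDiffAt_snd
      exact h2.mul h3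
    have h4 : ContMDiffAt I 𝓘(ℝ, E) ∞ ψ (ψ.symm x * ψ.symm x₀) := by
      rw [hψ1, mul_one]
      refine contMDiffAt_extChartAt' ?_
      rw [← extChartAt_source I]
      exact ψ.map_target hx
    exact ContMDiffAt.comp (x, x₀) h4 h1
  have hmd : ∀ x ∈ ψ.target, ContDiffAt ℝ ∞ (Function.uncurry m) (x, x₀) := by
    intro x hx
    have := hmul x hx
    rw [← modelWithCornersSelf_prod, chartedSpaceSelf_prod] at this
    exact this.contDiffAt
  refine ⟨fun x => fderiv ℝ (m x) x₀, ?_, fun x hx Y => ?_⟩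
  · exact ContDiffAt.fderiv (n := ∞) (g := fun _ => x₀) (hmd x₀ hx₀t) contDiffAt_const
      (WithTop.coe_le_coe.2 (le_top (a := (1 + 1 : ℕ∞))))
  · have hmx : m x x₀ = x := by
      simp only [hm, hψ1, mul_one]
      exact ψ.right_inv hx
    have hdm : DifferentiableAt ℝ (m x) x₀ := by
      have h1 : ContDiffAt ℝ ∞ (m x) x₀ := (hmd x hx).comp x₀ (contDiffAt_const.prodMk contDiffAt_id)
      exact h1.differentiableAt (by simp)
    have hs : MDifferentiableAt 𝓘(ℝ, E) I ψ.symm x₀ :=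
      (contMDiffAt_extChartAt_symm (I := I) (1 : H) hx₀t).mdifferentiableAt (by simp)
    have hsx : MDifferentiableAt 𝓘(ℝ, E) I ψ.symm (m x x₀) := by
      rw [hmx]
      exact (contMDiffAt_extChartAt_symm (I := I) (1 : H) hx).mdifferentiableAt (by simp)
    have e : (fun y => ψ.symm (m x y)) =ᶠ[nhds x₀] fun y => ψ.symm x * ψ.symm y := by
      have hc : ContinuousAt (fun y => ψ.symm x * ψ.symm y) x₀ :=
        (mdifferentiable_leftMul (I := I) (ψ.symm x) (ψ.symm x₀)).continuousAt.comp hs.continuousAt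
      have hn : ψ.source ∈ nhds (ψ.symm x * ψ.symm x₀) := by
        rw [hψ1, mul_one]
        exact (isOpen_extChartAt_source (I := I) (1 : H)).mem_nhds (ψ.map_target hx)
      filter_upwards [hc hn] with y hy
      exact ψ.left_inv hy
    have h1 := tangentAt_comp hsx hdm.mdifferentiableAt Y
    have h2 := tangentAt_comp (I := 𝓘(ℝ, E)) (F := ψ.symm)
      (mdifferentiable_leftMul (I := I) (ψ.symm x) (ψ.symm x₀)) hs Y
    have h3 : tangentAt 𝓘(ℝ, E) I (fun y => ψ.symm (m x y)) x₀ Y =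
        tangentAt 𝓘(ℝ, E) I (fun y => ψ.symm x * ψ.symm y) x₀ Y :=
      congrArg (fun L : E →L[ℝ] E => L Y) e.mfderiv_eq
    rw [h1, h2, hmx, tangentAt_extChartAt_symm, hψ1] at h3
    rw [leftInv, ← h3]
    congr 1
    exact congrArg (fun L : E →L[ℝ] E => L Y) mfderiv_eq_fderiv.symm

/-- Local existence for `h' = h Y` on a Lie group, on intervals of uniform length. -/
theorem exists_local_leftInv_solution [CompleteSpace E] {Y : ℝ → E} {a b : ℝ}
    (hY : ContinuousOn Y (Icc a b)) :
    ∃ ε > 0, ∀ x y, a ≤ x → x ≤ y → y ≤ b → y - x < ε → ∃ h : ℝ → H, h x = 1 ∧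
      ContMDiffOn 𝓘(ℝ, ℝ) I 1 h (Icc x y) ∧
      ∀ t ∈ Icc x y, HasVelWithin I h (Icc x y) t (leftInv I (h t) (Y t)) := by
  obtain ⟨Φ, hΦ, hΦL⟩ := exists_leftInv_chart (I := I) (H := H)
  set ψ := extChartAt I (1 : H) with hψ
  set x₀ := ψ 1 with hx₀
  have hx₀t : x₀ ∈ ψ.target := mem_extChartAt_target (I := I) (1 : H)
  obtain ⟨κ, s, hs, hlip⟩ := hΦ.exists_lipschitzOnWith
  have h1 : s ∩ ψ.target ∩ Φ ⁻¹' Metric.ball (Φ x₀) 1 ∈ nhds x₀ :=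
    Filter.inter_mem (Filter.inter_mem hs ((isOpen_extChartAt_target (I := I) (1 : H)).mem_nhds hx₀t))
      (hΦ.continuousAt (Metric.ball_mem_nhds _ one_pos))
  obtain ⟨r, hr, hball⟩ := Metric.nhds_basis_closedBall.mem_iff.1 h1
  obtain ⟨B₀, hB₀⟩ := isCompact_Icc.exists_bound_of_continuousOn hY
  set B : NNReal := ⟨max B₀ 0, le_max_right _ _⟩ with hB
  have hYB : ∀ t ∈ Icc a b, ‖Y t‖ ≤ B := fun t ht => (hB₀ t ht).trans (le_max_left _ _)
  set D : NNReal := ‖Φ x₀‖₊ + 1 with hD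
  have hΦD : ∀ x ∈ Metric.closedBall x₀ r, ‖Φ x‖ ≤ D := by
    intro x hx
    have h2 := (hball hx).2
    rw [mem_preimage, Metric.mem_ball, dist_eq_norm] at h2
    have h3 := norm_le_norm_add_norm_sub' (Φ x) (Φ x₀)
    have h4 : (D : ℝ) = ‖Φ x₀‖ + 1 := by simp [hD]
    linarith
  set r' : NNReal := ⟨r, hr.le⟩ with hr'
  -- On the ball of radius `r` the vector field is bounded by `D B`, so the solution stays in the
  -- ball for a time of at least `r / (D B + 1)`; adding one avoids a division by zero.
  have hDB : (0 : ℝ) < (D * B : NNReal) + 1 := by positivity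
  refine ⟨r / ((D * B : NNReal) + 1), by positivity, fun x y hax hxy hyb hlen => ?_⟩
  have hsub : Icc x y ⊆ Icc a b := Icc_subset_Icc hax hyb
  have hPL : IsPicardLindelof (fun t z => Φ z (Y t)) (tmin := x) (tmax := y) ⟨x, le_rfl, hxy⟩ x₀
      r' 0 (D * B) (κ * B) := by
    refine ⟨fun t ht => ?_, fun z _ => ?_, fun t ht z hz => ?_, ?_⟩
    · refine LipschitzOnWith.of_dist_le_mul fun z hz z' hz' => ?_
      have h2 := hlip.dist_le_mul z (hball hz).1.1 z' (hball hz').1.1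
      rw [dist_eq_norm] at h2 ⊢
      calc ‖Φ z (Y t) - Φ z' (Y t)‖ = ‖(Φ z - Φ z') (Y t)‖ := rfl
        _ ≤ ‖Φ z - Φ z'‖ * ‖Y t‖ := ContinuousLinearMap.le_opNorm _ _
        _ ≤ (κ * dist z z') * B := by
          gcongr
          exact hYB t (hsub ht)
        _ = _ := by push_cast; ring
    · exact (Φ z).continuous.comp_continuousOn (hY.mono hsub)
    · refine (ContinuousLinearMap.le_opNorm _ _).trans ?_
      push_cast
      exact mul_le_mul (hΦD z hz) (hYB t (hsub ht)) (norm_nonneg _) (by positivity)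
    · have h2 : max (y - x) (x - x) = y - x := by
        rw [sub_self]
        exact max_eq_left (by linarith)
      change ((D * B : NNReal) : ℝ) * max (y - x) (x - x) ≤ r - (0 : NNReal)
      rw [h2, NNReal.coe_zero, sub_zero]
      rw [lt_div_iff₀ hDB] at hlen
      nlinarith
  obtain ⟨f, hf0, hfb, hfd⟩ := hPL.exists_mem_closedBall_hasDerivWithinAt
  have hft : ∀ t, f t ∈ ψ.target := fun t => (hball (hfb t)).1.2
  have hfc : ContinuousOn f (Icc x y) := fun t ht => (hfd t ht).continuousWithinAt
  have hC1 : ContDiffOn ℝ 1 f (Icc x y) := by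
    rcases hxy.eq_or_lt with rfl | hlt
    · refine (contDiffOn_const (c := f x)).congr fun t ht => ?_
      rw [Icc_self] at ht
      rw [ht]
    · rw [contDiffOn_one_iff_derivWithin (uniqueDiffOn_Icc hlt)]
      refine ⟨fun t ht => (hfd t ht).differentiableWithinAt, ?_⟩
      refine ContinuousOn.congr ?_ fun t ht => (hfd t ht).derivWithin (uniqueDiffOn_Icc hlt t ht)
      have h2 : ContinuousOn Φ (Metric.closedBall x₀ r) :=
        hlip.continuousOn.mono fun z hz => (hball hz).1.1
      exact (h2.comp hfc fun t _ => hfb t).clm_apply (hY.mono hsub)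
  refine ⟨fun t => ψ.symm (f t), ?_, ?_, fun t ht => ?_⟩
  · have : f x = x₀ := hf0
    simp only [this]
    exact extChartAt_to_inv (I := I) (1 : H)
  · exact (contMDiffOn_extChartAt_symm (1 : H)).comp hC1.contMDiffOn
      fun t _ => hft t
  · rw [← hΦL _ (hft t)]
    exact (hfd t ht).hasVelWithin.comp_map
      ((contMDiffAt_extChartAt_symm (I := I) (1 : H) (hft t)).mdifferentiableAt (by simp))

end LieGroupODE

/-! ### Sections, velocities and uniqueness of horizontal curves -/

section BundleCalculus

theorem act_act_eq {G P : Type*} [Group G] [MulAction Gᵐᵒᵖ P] (p : P) (g h : G) :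
    (p <• g) <• h = p <• (g * h) := by
  rw [op_smul_op_smul]

theorem act_one_eq {G P : Type*} [Group G] [MulAction Gᵐᵒᵖ P] (p : P) : p <• (1 : G) = p := by
  rw [MulOpposite.op_one, one_smul]

variable {EG : Type*} [NormedAddCommGroup EG] [NormedSpace ℝ EG] {KG : Type*} [TopologicalSpace KG]
  {EP : Type*} [NormedAddCommGroup EP] [NormedSpace ℝ EP] {KP : Type*} [TopologicalSpace KP]
  {EM : Type*} [NormedAddCommGroup EM] [NormedSpace ℝ EM] {KM : Type*} [TopologicalSpace KM]
  {IG : ModelWithCorners ℝ EG KG} {IP : ModelWithCorners ℝ EP KP} {IM : ModelWithCorners ℝ EM KM}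
  {G : Type*} [Group G] [TopologicalSpace G] [ChartedSpace KG G]
  {P : Type*} [TopologicalSpace P] [ChartedSpace KP P]
  {M : Type*} [TopologicalSpace M] [ChartedSpace KM M]
  [MulAction Gᵐᵒᵖ P]

/-- A one-form at a point, as a linear map on the model space. -/
def oneFormAt (F : Type*) [NormedAddCommGroup F] [NormedSpace ℝ F]
    (θ : ∀ p : P, TangentSpace IP p →L[ℝ] F) (p : P) : EP →L[ℝ] F := θ p

theorem PrincipalBundle.mdifferentiable_act (B : PrincipalBundle IP IM IG P M G) :
    MDifferentiable (IP.prod IG) IP (fun x : P × G => x.1 <• x.2) :=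
  B.act_smooth.mdifferentiable (by simp)

theorem PrincipalBundle.mdifferentiable_orbit (B : PrincipalBundle IP IM IG P M G) (p : P) :
    MDifferentiable IG IP (fun g : G => p <• g) :=
  (B.act_smooth.comp ((contMDiff_const (c := p)).prodMk contMDiff_id)).mdifferentiable (by simp)

/-- A local trivialization gives a local section `σ` and a division map `δ` with
`p = σ(π(p)) δ(p)`. -/
theorem PrincipalBundle.exists_section (B : PrincipalBundle IP IM IG P M G) (x : M) :
    ∃ (U : Set M) (σ : M → P) (δ : P → G), IsOpen U ∧ x ∈ U ∧ ContMDiffOn IM IP ∞ σ U ∧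
      ContMDiffOn IP IG ∞ δ (B.proj ⁻¹' U) ∧ (∀ u ∈ U, B.proj (σ u) = u) ∧
      ∀ p, B.proj p ∈ U → σ (B.proj p) <• δ p = p := by
  obtain ⟨U, hU, hx, φ, hs, ht, hφ⟩ := B.locally_trivial x
  refine ⟨U, fun u => φ (u, 1), fun p => (φ.invFun p).2, hU, hx, ?_, ?_,
    fun u hu => (hφ u hu 1 1).2, fun p hp => ?_⟩
  · refine φ.contMDiffOn_toFun.comp (contMDiffOn_id.prodMk contMDiffOn_const) fun u hu => ?_
    rw [hs]
    exact ⟨hu, trivial⟩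
  · have h1 := φ.contMDiffOn_invFun
    rw [ht] at h1
    exact contMDiff_snd.comp_contMDiffOn h1
  · have hpt : p ∈ φ.target := by rw [ht]; exact hp
    have h1 : φ.invFun p ∈ φ.source := φ.map_target' hpt
    have h2 : φ (φ.invFun p) = p := φ.right_inv' hpt
    have h3 : (φ.invFun p).1 ∈ U := by
      rw [hs] at h1
      exact h1.1
    have h4 : B.proj p = (φ.invFun p).1 := by
      conv_lhs => rw [← h2]
      exact (hφ _ h3 _ 1).2
    rw [h4, (hφ _ h3 1 _).1, one_mul]
    exact h2

variable [LieGroup IG ∞ G]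

/-- The derivative of the orbit map at an arbitrary group element, in terms of the fundamental
vector fields and the Maurer-Cartan form. -/
theorem PrincipalBundle.tangentAt_orbit (B : PrincipalBundle IP IM IG P M G) (p : P) (g : G)
    (w : EG) : tangentAt IG IP (fun x : G => p <• x) g w =
      (fundamentalVector (IG := IG) (G := G) IP
        (tangentAt IG IG (fun x : G => g⁻¹ * x) g w : EG) (p <• g) : EP) := by
  have h1 := tangentAt_comp (I := IG) (F := fun x : G => g⁻¹ * x)
    (I' := IG) (I'' := IP)
    (G := fun x : G => (p <• g) <• x) (x := g) (B.mdifferentiable_orbit _ _)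
    (mdifferentiable_leftMul _ _) w
  have e : (fun x : G => (p <• g) <• (g⁻¹ * x)) = fun x => p <• x := by
    funext x
    rw [act_act_eq, mul_inv_cancel_left]
  rw [e, inv_mul_cancel] at h1
  exact h1

variable [IsManifold IP ∞ P]

/-- The connection form on the velocity of a product `p(t) g(t)`. -/
theorem ConnectionForm.exists_velocity_act {B : PrincipalBundle IP IM IG P M G}
    (A : ConnectionForm B) {p : ℝ → P} {g : ℝ → G} {s : Set ℝ} {t : ℝ} {v : EP} {w : EG}
    (hp : HasVelWithin IP p s t v) (hg : HasVelWithin IG g s t w) :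
    ∃ u : EP, HasVelWithin IP (fun r => p r <• g r) s t u ∧
      oneFormAt EG A.form (p t <• g t) u =
        tangentAt IG IG (fun x : G => (g t)⁻¹ * x * (g t)⁻¹⁻¹) 1 (oneFormAt EG A.form (p t) v) +
          tangentAt IG IG (fun x : G => (g t)⁻¹ * x) (g t) w := by
  refine ⟨_, hp.comp_map₂ (F := fun x : P × G => x.1 <• x.2) hg (B.mdifferentiable_act _), ?_⟩
  rw [map_add, B.tangentAt_orbit]
  congr 1
  · exact A.equivariant (p t) (g t) v
  · exact A.vertical (p t <• g t) (tangentAt IG IG (fun x : G => (g t)⁻¹ * x) (g t) w : EG)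

/-- Horizontal curves over the same curve in the base that start at the same point agree. It is
enough that they are horizontal off a finite set. -/
theorem ConnectionForm.horizontal_unique [CompleteSpace EG] {B : PrincipalBundle IP IM IG P M G}
    (A : ConnectionForm B) {p q : ℝ → P} {a b : ℝ} (hab : a ≤ b) (hp : ContinuousOn p (Icc a b))
    (hq : ContinuousOn q (Icc a b)) (hpq : ∀ t ∈ Icc a b, B.proj (p t) = B.proj (q t))
    (h0 : p a = q a) {S : Set ℝ} (hS : S.Finite)
    (h : ∀ t ∈ Ioo a b, t ∉ S → (∃ v, HasVelWithin IP p univ t v ∧ oneFormAt EG A.form (p t) v = 0) ∧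
      ∃ v, HasVelWithin IP q univ t v ∧ oneFormAt EG A.form (q t) v = 0) : p b = q b := by
  have : IsTopologicalGroup G := topologicalGroup_of_lieGroup IG ∞
  refine rel_of_locally (R := fun x y => p x = q x → p y = q y) hab
    (fun x y z _ _ _ _ h h' => h' ∘ h) (fun t ht => ?_) h0
  obtain ⟨U, σ, δ, hU, htU, -, hδ, -, hσδ⟩ := B.exists_section (B.proj (p t))
  obtain ⟨ε, hε, hεU⟩ := exists_mapsTo_of_continuousOn (B.proj_smooth.continuous.comp_continuousOn hp)
    ht (hU.mem_nhds htU)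
  refine ⟨ε, hε, fun x y hax hxy hyb h1 h2 _ hx => ?_⟩
  have hsub : Icc x y ⊆ Icc a b := Icc_subset_Icc hax hyb
  have hpU : ∀ r ∈ Icc x y, B.proj (p r) ∈ U := fun r hr =>
    hεU r (hsub hr) (h1.trans_le hr.1) (hr.2.trans_lt h2)
  have hqU : ∀ r ∈ Icc x y, B.proj (q r) ∈ U := fun r hr => hpq r (hsub hr) ▸ hpU r hr
  set g : ℝ → G := fun r => (δ (p r))⁻¹ * δ (q r) with hg
  have hpg : ∀ r ∈ Icc x y, p r <• g r = q r := by
    intro r hr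
    conv_lhs => rw [← hσδ _ (hpU r hr)]
    rw [act_act_eq, hg, mul_inv_cancel_left, hpq r (hsub hr), hσδ _ (hqU r hr)]
  have hgc : ContinuousOn g (Icc x y) :=
    (hδ.continuousOn.comp (hp.mono hsub) hpU).inv.mul (hδ.continuousOn.comp (hq.mono hsub) hqU)
  have hδd : ∀ z, B.proj z ∈ U → MDifferentiableAt IP IG δ z := fun z hz =>
    (hδ.contMDiffAt ((hU.preimage B.proj_smooth.continuous).mem_nhds hz)).mdifferentiableAt (by simp)
  have hinv : MDifferentiable IG IG (fun x : G => x⁻¹) :=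
    (contMDiff_inv IG ∞).mdifferentiable (by simp)
  -- Both `p` and `q = p g` are horizontal, so `g` has velocity zero.
  have hconst : g x = g y := by
    refine eq_of_hasVelWithin_zero (I := IG) hxy hgc hS fun r hr hrS => ?_
    have hr' := Ioo_subset_Icc_self hr
    have hn : univ ∈ nhdsWithin r (Ioo x y) := Filter.univ_mem
    have hn' : Ioo x y ∈ nhdsWithin r univ := by
      rw [nhdsWithin_univ]
      exact isOpen_Ioo.mem_nhds hr
    obtain ⟨⟨v, hv, hAv⟩, ⟨v', hv', hAv'⟩⟩ := h r ⟨hax.trans_lt hr.1, hr.2.trans_le hyb⟩ hrS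
    have hgd := HasVelWithin.comp_map₂ (F := fun x : G × G => x.1 * x.2)
      ((hv.comp_map (hδd _ (hpU r hr'))).comp_map (hinv _))
      (hv'.comp_map (hδd _ (hqU r hr'))) (mdifferentiable_mul _)
    set w : EG := _ with hw
    change HasVelWithin IG g univ r w at hgd
    obtain ⟨u, hu, hAu⟩ := A.exists_velocity_act hv hgd
    have h3 : u = v' := by
      refine ((hu.mono_of_mem hn).congr (g := q) (fun z hz => ?_) hr).unique (hv'.mono_of_mem hn)
        (isOpen_Ioo.uniqueDiffWithinAt hr)
      exact (hpg z (Ioo_subset_Icc_self hz)).symm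
    rw [h3, hpg r hr', hAv', hAv, map_zero, zero_add] at hAu
    rwa [tangentAt_mul_left_injective hAu.symm] at hgd
  rw [← hpg y ⟨hxy, le_rfl⟩, ← hconst]
  have h3 : g x = 1 := by simp only [hg, hx, inv_mul_cancel]
  rw [h3, act_one_eq]

end BundleCalculus

/-! ### Existence of horizontal lifts and decorations -/

section Existence

variable {EG : Type*} [NormedAddCommGroup EG] [NormedSpace ℝ EG] {KG : Type*} [TopologicalSpace KG]
  {EH : Type*} [NormedAddCommGroup EH] [NormedSpace ℝ EH] {KH : Type*} [TopologicalSpace KH]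
  {EP : Type*} [NormedAddCommGroup EP] [NormedSpace ℝ EP] {KP : Type*} [TopologicalSpace KP]
  {EM : Type*} [NormedAddCommGroup EM] [NormedSpace ℝ EM] {KM : Type*} [TopologicalSpace KM]
  {IG : ModelWithCorners ℝ EG KG} {IH : ModelWithCorners ℝ EH KH}
  {IP : ModelWithCorners ℝ EP KP} {IM : ModelWithCorners ℝ EM KM}
  {G : Type*} [Group G] [TopologicalSpace G] [ChartedSpace KG G]
  {H : Type*} [Group H] [TopologicalSpace H] [ChartedSpace KH H]
  {P : Type*} [TopologicalSpace P] [ChartedSpace KP P]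
  {M : Type*} [TopologicalSpace M] [ChartedSpace KM M]
  [MulAction Gᵐᵒᵖ P]

variable (IH H) in
/-- The equation `h' = -h C(c')` of a decoration is solvable on `[x, y]` with arbitrary initial
value. Velocities are taken within `[x, y]`, hence one-sided at the end points; at an interior point
where `c` has no velocity nothing is required. -/
def HasDecorationsOn (C : ∀ p : P, TangentSpace IP p →L[ℝ] GroupLieAlgebra IH H) (c : ℝ → P)
    (x y : ℝ) : Prop :=
  ∀ h₀ : H, ∃ h : ℝ → H, h x = h₀ ∧ ContinuousOn h (Icc x y) ∧ ∀ t ∈ Icc x y, ∀ v : EP,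
    HasVelWithin IP c (Icc x y) t v →
      HasVelWithin IH h (Icc x y) t (leftInv IH (h t) (-oneFormAt EH C (c t) v))

theorem HasDecorationsOn.trans {C : ∀ p : P, TangentSpace IP p →L[ℝ] GroupLieAlgebra IH H}
    {c : ℝ → P} {x y z : ℝ} (hxy : x ≤ y) (hyz : y ≤ z) (h : HasDecorationsOn IH H C c x y)
    (h' : HasDecorationsOn IH H C c y z) : HasDecorationsOn IH H C c x z := by
  intro h₀
  obtain ⟨f, hf0, hfc, hf⟩ := h h₀
  obtain ⟨g, hg0, hgc, hg⟩ := h' (f y)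
  have e1 : EqOn (fun t => if t ≤ y then f t else g t) f (Icc x y) := fun t ht => if_pos ht.2
  have e2 : EqOn (fun t => if t ≤ y then f t else g t) g (Icc y z) := by
    intro t ht
    rcases ht.1.eq_or_lt with rfl | hlt
    · simp [hg0]
    · exact if_neg (not_le.2 hlt)
  have hu : Icc x y ∪ Icc y z = Icc x z := Icc_union_Icc_eq_Icc hxy hyz
  have hs1 : Icc x y ⊆ Icc x z := Icc_subset_Icc le_rfl hyz
  have hs2 : Icc y z ⊆ Icc x z := Icc_subset_Icc hxy le_rfl
  refine ⟨fun t => if t ≤ y then f t else g t, (if_pos hxy).trans hf0, ?_, fun t ht v hv => ?_⟩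
  · rw [← hu]
    exact (hfc.congr e1).union_of_isClosed (hgc.congr e2) isClosed_Icc isClosed_Icc
  · have k1 : ∀ ht : t ∈ Icc x y, HasVelWithin IH (fun t => if t ≤ y then f t else g t) (Icc x y) t
        (leftInv IH ((fun t => if t ≤ y then f t else g t) t) (-oneFormAt EH C (c t) v)) := by
      intro ht
      rw [e1 ht]
      exact (hf t ht v (hv.mono hs1)).congr e1 ht
    have k2 : ∀ ht : t ∈ Icc y z, HasVelWithin IH (fun t => if t ≤ y then f t else g t) (Icc y z) t
        (leftInv IH ((fun t => if t ≤ y then f t else g t) t) (-oneFormAt EH C (c t) v)) := by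
      intro ht
      rw [e2 ht]
      exact (hg t ht v (hv.mono hs2)).congr e2 ht
    rcases lt_trichotomy t y with hlt | rfl | hlt
    · refine (k1 ⟨ht.1, hlt.le⟩).mono_of_mem ?_
      filter_upwards [self_mem_nhdsWithin, mem_nhdsWithin_of_mem_nhds (Iio_mem_nhds hlt)] with r h1 h2
      exact ⟨h1.1, le_of_lt h2⟩
    · rw [← hu]
      exact (k1 ⟨hxy, le_rfl⟩).union (k2 ⟨le_rfl, hyz⟩)
    · refine (k2 ⟨hlt.le, ht.2⟩).mono_of_mem ?_
      filter_upwards [self_mem_nhdsWithin, mem_nhdsWithin_of_mem_nhds (Ioi_mem_nhds hlt)] with r h1 h2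
      exact ⟨le_of_lt h2, h1.2⟩

/-- On a one-point interval there is no condition: there every curve has every vector as a
velocity. -/
theorem hasDecorationsOn_self (C : ∀ p : P, TangentSpace IP p →L[ℝ] GroupLieAlgebra IH H)
    (c : ℝ → P) (x : ℝ) : HasDecorationsOn IH H C c x x := by
  intro h₀
  refine ⟨fun _ => h₀, rfl, continuousOn_const, fun t ht v _ => ?_⟩
  rw [Icc_self] at ht ⊢
  obtain rfl : t = x := ht
  have hfin : (((extChartAt 𝓘(ℝ, ℝ) t).symm ⁻¹' {t} ∩ range 𝓘(ℝ, ℝ) : Set ℝ)).Finite :=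
    (finite_singleton t).subset fun r hr => hr.1
  exact ⟨continuousWithinAt_const, HasFDerivWithinAt.of_finite (𝕜 := ℝ) (E := ℝ) (F := EH) hfin⟩

variable [IsManifold IP ∞ P]

/-- A smooth one-form is continuous along the velocity of a `C¹` curve. -/
theorem exists_velocity_continuousOn_form {F : Type*} [NormedAddCommGroup F] [NormedSpace ℝ F]
    {θ : ∀ p : P, TangentSpace IP p →L[ℝ] F} (hθ : IsSmoothOneForm IP θ) {f : ℝ → P} {a b : ℝ}
    (hab : a < b) (hf : ContMDiffOn 𝓘(ℝ, ℝ) IP 1 f (Icc a b)) :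
    ∃ v : ℝ → EP, (∀ t ∈ Icc a b, HasVelWithin IP f (Icc a b) t (v t)) ∧
      ContinuousOn (fun t => oneFormAt F θ (f t) (v t)) (Icc a b) := by
  obtain ⟨v, hv, hc⟩ := exists_velocity_of_contMDiffOn hab hf
  exact ⟨v, hv, hθ.continuous.comp_continuousOn hc⟩

/-- Horizontal lifts of `γ` on `[x, y]` exist through all points over `γ x`. -/
def HasLiftsOn {B : PrincipalBundle IP IM IG P M G} (A : ConnectionForm B) (γ : ℝ → M)
    (x y : ℝ) : Prop :=
  ∀ u : P, B.proj u = γ x → ∃ δ : ParamPath IP P, δ.a = x ∧ δ.b = y ∧ δ.source = u ∧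
    (∀ t ∈ Icc x y, B.proj (δ.toFun t) = γ t) ∧ A.IsHorizontal δ

theorem HasLiftsOn.trans {B : PrincipalBundle IP IM IG P M G} {A : ConnectionForm B} {γ : ℝ → M}
    {x y z : ℝ} (hxy : x ≤ y) (hyz : y ≤ z) (h : HasLiftsOn A γ x y) (h' : HasLiftsOn A γ y z) :
    HasLiftsOn A γ x z := by
  intro u hu
  obtain ⟨δ, rfl, rfl, hs, hp, hh⟩ := h u hu
  obtain ⟨η, hηa, rfl, hs', hp', hh'⟩ := h' δ.target (hp _ ⟨hxy, le_rfl⟩)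
  have hb : (δ.trans η hs'.symm).b = η.b := by simp [ParamPath.trans, hηa]
  refine ⟨δ.trans η hs'.symm, rfl, hb, by simp [hs], fun t ht => ?_, hh.trans hh' _⟩
  rcases le_total t δ.b with h1 | h1
  · rw [ParamPath.trans_of_le _ _ _ h1]
    exact hp t ⟨ht.1, h1⟩
  · rw [ParamPath.trans_of_ge _ _ _ h1, hηa, sub_add_cancel]
    exact hp' t ⟨h1, ht.2⟩

theorem hasLiftsOn_self {B : PrincipalBundle IP IM IG P M G} (A : ConnectionForm B) (γ : ℝ → M)
    (x : ℝ) : HasLiftsOn A γ x x := by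
  intro u hu
  refine ⟨⟨x, x, le_rfl, fun _ => u, .of_contMDiff contMDiff_const _ _⟩, rfl, rfl, rfl,
    fun t ht => ?_, fun t v h => absurd h.1 (lt_irrefl x)⟩
  rw [Icc_self] at ht
  rw [ht]
  exact hu

variable [LieGroup IG ∞ G]

/-- A `C¹` curve over the domain of a local section has horizontal lifts: one corrects the section
by a solution of a differential equation on the structure group. -/
theorem hasLiftsOn_of_section [CompleteSpace EG] [IG.Boundaryless]
    {B : PrincipalBundle IP IM IG P M G} (A : ConnectionForm B) {γ : ℝ → M} {a b : ℝ} (hab : a < b)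
    (hγ : ContMDiffOn 𝓘(ℝ, ℝ) IM 1 γ (Icc a b)) {U : Set M} {σ : M → P} {δ : P → G}
    (hσ : ContMDiffOn IM IP ∞ σ U) (hσp : ∀ u ∈ U, B.proj (σ u) = u)
    (hσδ : ∀ p, B.proj p ∈ U → σ (B.proj p) <• δ p = p) (hU : MapsTo γ (Icc a b) U) :
    HasLiftsOn A γ a b := by
  have hs : ContMDiffOn 𝓘(ℝ, ℝ) IP 1 (fun t => σ (γ t)) (Icc a b) :=
    (hσ.of_le (by simp)).comp hγ hU
  obtain ⟨v, hv, hY⟩ := exists_velocity_continuousOn_form A.smooth hab hs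
  obtain ⟨ε, hε, hsol⟩ := exists_local_leftInv_solution (I := IG) (H := G) hY
  refine rel_of_locally hab.le (fun x y z _ hxy hyz _ => HasLiftsOn.trans hxy hyz) fun t _ =>
    ⟨ε / 2, by linarith, fun x y hax hxy hyb h1 h2 _ => ?_⟩
  rcases hxy.eq_or_lt with rfl | hlt
  · exact hasLiftsOn_self A γ x
  have hsub : Icc x y ⊆ Icc a b := Icc_subset_Icc hax hyb
  obtain ⟨k, hk1, hkC, hk⟩ := hsol x y hax hxy hyb (by linarith)
  intro u hu
  have hC : ContMDiffOn 𝓘(ℝ, ℝ) IP 1 (fun r => σ (γ r) <• (k r)⁻¹) (Icc x y) :=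
    (B.act_smooth.of_le (by simp)).comp_contMDiffOn ((hs.mono hsub).prodMk hkC.inv)
  set c : ParamPath IP P := ⟨x, y, hxy, fun r => σ (γ r) <• (k r)⁻¹, hC.continuousOn, ∅,
    finite_empty, fun x' y' h1 _ h2 _ => hC.mono (Icc_subset_Icc h1 h2)⟩ with hc
  have hch : A.IsHorizontal c := by
    rintro r w ⟨-, hr, hw⟩
    obtain ⟨w', hw', hinv⟩ := (hk r hr).exists_inv hr (uniqueDiffOn_Icc hlt r hr)
    obtain ⟨z, hz, hAz⟩ := A.exists_velocity_act ((hv r (hsub hr)).mono hsub) hw'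
    have h3 : z = w := hz.unique hw (uniqueDiffOn_Icc hlt r hr)
    -- The two terms of the formula for `A` on the velocity of `σ(γ) k⁻¹` cancel.
    rw [inv_inv, hinv, h3] at hAz
    exact hAz.trans (add_neg_cancel _)
  have hux : B.proj u ∈ U := by
    rw [hu]
    exact hU ⟨hax, hxy.trans hyb⟩
  refine ⟨c.map _ (B.translate_contMDiff (δ u)), rfl, rfl, ?_, fun r hr => ?_, hch.translate _⟩
  · rw [ParamPath.source_map]
    change (σ (γ x) <• (k x)⁻¹) <• δ u = u
    rw [hk1, inv_one, act_one_eq, ← hu, hσδ u hux]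
  · change B.proj ((σ (γ r) <• (k r)⁻¹) <• δ u) = γ r
    rw [B.proj_act, B.proj_act, hσp _ (hU (hsub hr))]

/-- Horizontal lifts of piecewise `C¹` paths exist. -/
theorem ConnectionForm.exists_isHorizontalLift [CompleteSpace EG] [IG.Boundaryless]
    {B : PrincipalBundle IP IM IG P M G} (A : ConnectionForm B) (γ : ParamPath IM M) {u : P}
    (hu : γ.source = B.proj u) : ∃ γ' : ParamPath IP P, IsHorizontalLift A γ u γ' := by
  obtain ⟨hc, S, hS, hγ⟩ := γ.piecewiseC1
  have key : HasLiftsOn A γ.toFun γ.a γ.b := by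
    refine rel_of_locally γ.le (fun x y z _ hxy hyz _ => HasLiftsOn.trans hxy hyz) fun t ht => ?_
    obtain ⟨U, σ, δ, hU, htU, hσ, -, hσp, hσδ⟩ := B.exists_section (γ.toFun t)
    obtain ⟨ε₁, hε₁, h1⟩ := exists_mapsTo_of_continuousOn hc ht (hU.mem_nhds htU)
    obtain ⟨ε₂, hε₂, h2⟩ := exists_gap hS t
    refine ⟨min ε₁ ε₂, lt_min hε₁ hε₂, fun x y hax hxy hyb hx hy hside => ?_⟩
    rcases hxy.eq_or_lt with rfl | hlt
    · exact hasLiftsOn_self A _ x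
    have e1 := min_le_left ε₁ ε₂
    have e2 := min_le_right ε₁ ε₂
    refine hasLiftsOn_of_section A hlt (hγ x y hax hlt hyb
      (h2 x y (by linarith) (by linarith) hside)) hσ hσp hσδ fun r hr => ?_
    exact h1 r ⟨hax.trans hr.1, hr.2.trans hyb⟩ (by linarith [hr.1]) (by linarith [hr.2])
  obtain ⟨δ, h1, h2, h3, h4, h5⟩ := key u hu.symm
  exact ⟨δ, h1, h2, h3, h4, h5⟩

variable [LieGroup IH ∞ H]

theorem hasDecorationsOn_of_contMDiffOn [CompleteSpace EH] [IH.Boundaryless]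
    {C : ∀ p : P, TangentSpace IP p →L[ℝ] GroupLieAlgebra IH H}
    (hC : IsSmoothOneForm IP (F := EH) C) {c : ℝ → P} {a b : ℝ} (hab : a < b)
    (hc : ContMDiffOn 𝓘(ℝ, ℝ) IP 1 c (Icc a b)) : HasDecorationsOn IH H C c a b := by
  obtain ⟨v, hv, hY⟩ := exists_velocity_continuousOn_form hC hab hc
  obtain ⟨ε, hε, hsol⟩ := exists_local_leftInv_solution (I := IH) (H := H) hY.neg
  refine rel_of_locally hab.le (fun x y z _ hxy hyz _ => HasDecorationsOn.trans hxy hyz) fun t _ =>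
    ⟨ε / 2, by linarith, fun x y hax hxy hyb h1 h2 _ => ?_⟩
  rcases hxy.eq_or_lt with rfl | hlt
  · exact hasDecorationsOn_self C c x
  have hsub : Icc x y ⊆ Icc a b := Icc_subset_Icc hax hyb
  obtain ⟨k, hk1, hkC, hk⟩ := hsol x y hax hxy hyb (by linarith)
  refine fun h₀ => ⟨fun r => h₀ * k r, by simp [hk1], ?_, fun r hr w hw => ?_⟩
  · exact (contMDiff_mul_left (I := IH) (n := ∞) (a := h₀)).continuous.comp_continuousOn
      hkC.continuousOn
  · rw [← ((hv r (hsub hr)).mono hsub).unique hw (uniqueDiffOn_Icc hlt r hr)]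
    exact (hk r hr).mul_left h₀

/-- Every piecewise `C¹` path has a decoration. -/
theorem exists_isDecorationSolution [CompleteSpace EH] [IH.Boundaryless]
    {C : ∀ p : P, TangentSpace IP p →L[ℝ] GroupLieAlgebra IH H}
    (hC : IsSmoothOneForm IP (F := EH) C) (γ : ParamPath IP P) :
    ∃ h : ℝ → H, IsDecorationSolution C γ h := by
  obtain ⟨-, S, hS, hγ⟩ := γ.piecewiseC1
  have key : HasDecorationsOn IH H C γ.toFun γ.a γ.b := by
    refine rel_of_locally γ.le (fun x y z _ hxy hyz _ => HasDecorationsOn.trans hxy hyz) fun t _ => ?_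
    obtain ⟨ε, hε, h2⟩ := exists_gap hS t
    refine ⟨ε, hε, fun x y hax hxy hyb hx hy hside => ?_⟩
    rcases hxy.eq_or_lt with rfl | hlt
    · exact hasDecorationsOn_self C _ x
    · exact hasDecorationsOn_of_contMDiffOn hC hlt (hγ x y hax hlt hyb
        (h2 x y (by linarith) (by linarith) hside))
  obtain ⟨h, h0, hc, hh⟩ := key 1
  exact ⟨h, hc, h0, fun t v hv => hh t hv.2.1 v hv.2.2⟩

end Existence

/-! ### Velocities of piecewise `C¹` paths -/

section PiecewiseVelocity

variable {E : Type*} [NormedAddCommGroup E] [NormedSpace ℝ E] {K : Type*} [TopologicalSpace K]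
  {I : ModelWithCorners ℝ E K} {X : Type*} [TopologicalSpace X] [ChartedSpace K X]

theorem HasVelWithin.congr_Ioo {f g : ℝ → X} {x y t : ℝ} {v : E} (h : HasVelWithin I f univ t v)
    (hg : EqOn g f (Ioo x y)) (ht : t ∈ Ioo x y) : HasVelWithin I g univ t v := by
  refine ((h.mono (subset_univ (Ioo x y))).congr hg ht).mono_of_mem ?_
  rw [nhdsWithin_univ]
  exact isOpen_Ioo.mem_nhds ht

/-- A piecewise `C¹` path has a velocity off a finite set. -/
theorem PiecewiseC1On.exists_velocity {γ : ℝ → X} {a b : ℝ} (h : PiecewiseC1On I γ a b) :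
    ∃ S : Set ℝ, S.Finite ∧ ∀ t ∈ Ioo a b, t ∉ S → ∃ v : E, HasVelWithin I γ univ t v := by
  obtain ⟨-, S, hS, h⟩ := h
  refine ⟨S, hS, fun t ht htS => ?_⟩
  have h1 : Sᶜ ∩ Ioo a b ∈ nhds t :=
    (hS.isClosed.isOpen_compl.inter isOpen_Ioo).mem_nhds ⟨htS, ht⟩
  obtain ⟨ε, hε, hball⟩ := Metric.nhds_basis_closedBall.mem_iff.1 h1
  rw [Real.closedBall_eq_Icc] at hball
  have hlt : t - ε < t + ε := by linarith
  have h2 := h (t - ε) (t + ε) (hball ⟨le_rfl, hlt.le⟩).2.1.le hlt (hball ⟨hlt.le, le_rfl⟩).2.2.le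
    (Set.disjoint_left.2 fun r hr hr' => (hball (Ioo_subset_Icc_self hr')).1 hr)
  obtain ⟨v, hv⟩ := (h2.mdifferentiableOn one_ne_zero t ⟨by linarith, by linarith⟩).exists_hasVelWithin
  refine ⟨v, hv.mono_of_mem ?_⟩
  rw [nhdsWithin_univ]
  exact Icc_mem_nhds (by linarith) (by linarith)

/-- Piecewise `C¹` paths are stable under strictly increasing piecewise `C¹` reparametrizations. -/
theorem PiecewiseC1On.comp_strictMonoOn {γ : ℝ → X} {φ : ℝ → ℝ} {a b : ℝ}
    (hγ : PiecewiseC1On I γ (φ a) (φ b)) (hφ : PiecewiseC1On 𝓘(ℝ, ℝ) φ a b)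
    (hmono : StrictMonoOn φ (Icc a b)) (hab : a ≤ b) :
    PiecewiseC1On I (fun t => γ (φ t)) a b := by
  obtain ⟨hγc, S, hS, hγ⟩ := hγ
  obtain ⟨hφc, T, hT, hφ⟩ := hφ
  have ha : a ∈ Icc a b := left_mem_Icc.2 hab
  have hb : b ∈ Icc a b := right_mem_Icc.2 hab
  refine ⟨hγc.comp hφc fun t ht => ⟨hmono.monotoneOn ha ht ht.1, hmono.monotoneOn ht hb ht.2⟩,
    T ∪ (φ ⁻¹' S ∩ Icc a b), hT.union ?_, fun x y hax hxy hyb hd => ?_⟩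
  · refine Finite.of_finite_image (hS.subset ?_) (hmono.injOn.mono inter_subset_right)
    rintro _ ⟨t, ht, rfl⟩
    exact ht.1
  · have hx : x ∈ Icc a b := ⟨hax, hxy.le.trans hyb⟩
    have hy : y ∈ Icc a b := ⟨hax.trans hxy.le, hyb⟩
    rw [disjoint_union_left] at hd
    have hsub : Icc x y ⊆ Icc a b := Icc_subset_Icc hax hyb
    have hcont : ContinuousOn φ (Icc x y) := hφc.mono hsub
    refine (hγ (φ x) (φ y) (hmono.monotoneOn ha hx hax) (hmono hx hy hxy)
      (hmono.monotoneOn hy hb hyb) ?_).comp (hφ x y hax hxy hyb hd.1) fun t ht =>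
        ⟨hmono.monotoneOn hx (hsub ht) ht.1, hmono.monotoneOn (hsub ht) hy ht.2⟩
    rw [Set.disjoint_left]
    intro s hs hs'
    obtain ⟨t, ht, rfl⟩ := intermediate_value_Ioo hxy.le hcont hs'
    exact Set.disjoint_left.1 hd.2 ⟨hs, hsub (Ioo_subset_Icc_self ht)⟩ ht

end PiecewiseVelocity

/-! ### Decorations of horizontal paths -/

section Decorations

variable {EG : Type*} [NormedAddCommGroup EG] [NormedSpace ℝ EG] {KG : Type*} [TopologicalSpace KG]
  {EH : Type*} [NormedAddCommGroup EH] [NormedSpace ℝ EH] {KH : Type*} [TopologicalSpace KH]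
  {EP : Type*} [NormedAddCommGroup EP] [NormedSpace ℝ EP] {KP : Type*} [TopologicalSpace KP]
  {EM : Type*} [NormedAddCommGroup EM] [NormedSpace ℝ EM] {KM : Type*} [TopologicalSpace KM]
  {IG : ModelWithCorners ℝ EG KG} {IH : ModelWithCorners ℝ EH KH}
  {IP : ModelWithCorners ℝ EP KP} {IM : ModelWithCorners ℝ EM KM}
  {G : Type*} [Group G] [TopologicalSpace G] [ChartedSpace KG G]
  {H : Type*} [Group H] [TopologicalSpace H] [ChartedSpace KH H]
  {P : Type*} [TopologicalSpace P] [ChartedSpace KP P] [IsManifold IP ∞ P]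
  {M : Type*} [TopologicalSpace M] [ChartedSpace KM M]
  [MulAction Gᵐᵒᵖ P] {B : PrincipalBundle IP IM IG P M G}

/-- At the time `t` the curve `p` has a horizontal velocity, and the curve `h` in `H` satisfies the
equation `h' = -h C(p')`. -/
def DecoratesAt (A : ConnectionForm B) (C : ∀ p : P, TangentSpace IP p →L[ℝ] GroupLieAlgebra IH H)
    (p : ℝ → P) (h : ℝ → H) (t : ℝ) : Prop :=
  ∃ v : EP, HasVelWithin IP p univ t v ∧ oneFormAt EG A.form (p t) v = 0 ∧
    HasVelWithin IH h univ t (leftInv IH (h t) (-oneFormAt EH C (p t) v))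

/-- The path `γ` is horizontal and its decoration ends in `k`. The two conditions are imposed only
off a finite set of times, which makes them stable under cutting and pasting of paths. -/
def HasDecoration (A : ConnectionForm B) (C : ∀ p : P, TangentSpace IP p →L[ℝ] GroupLieAlgebra IH H)
    (γ : ParamPath IP P) (k : H) : Prop :=
  ∃ h : ℝ → H, ContinuousOn h (Icc γ.a γ.b) ∧ h γ.a = 1 ∧ h γ.b = k ∧
    ∃ S : Set ℝ, S.Finite ∧ ∀ t ∈ Ioo γ.a γ.b, t ∉ S → DecoratesAt A C γ.toFun h t

variable {A : ConnectionForm B} {C : ∀ p : P, TangentSpace IP p →L[ℝ] GroupLieAlgebra IH H}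

namespace DecoratesAt

variable {p q : ℝ → P} {h k : ℝ → H} {t : ℝ}

theorem congr {x y : ℝ} (hd : DecoratesAt A C p h t) (ht : t ∈ Ioo x y) (hq : EqOn q p (Ioo x y))
    (hk : EqOn k h (Ioo x y)) : DecoratesAt A C q k t := by
  obtain ⟨v, h1, h2, h3⟩ := hd
  refine ⟨v, h1.congr_Ioo hq ht, by rw [hq ht, h2], ?_⟩
  rw [hk ht, hq ht]
  exact h3.congr_Ioo hk ht

theorem comp_param {φ : ℝ → ℝ} {r : ℝ} (hd : DecoratesAt A C p h (φ t))
    (hφ : HasDerivWithinAt φ r univ t) :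
    DecoratesAt A C (fun s => p (φ s)) (fun s => h (φ s)) t := by
  obtain ⟨v, h1, h2, h3⟩ := hd
  refine ⟨r • v, h1.comp_param hφ (mapsTo_univ _ _), by rw [map_smul, h2, smul_zero], ?_⟩
  have := h3.comp_param hφ (mapsTo_univ _ _)
  rwa [← map_smul, smul_neg, ← map_smul] at this

theorem mul_left [LieGroup IH ∞ H] (hd : DecoratesAt A C p h t) (h₀ : H) :
    DecoratesAt A C p (fun s => h₀ * h s) t := by
  obtain ⟨v, h1, h2, h3⟩ := hd
  exact ⟨v, h1, h2, h3.mul_left h₀⟩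

/-- Right translation of the path by `g` corresponds to the automorphism `α(g⁻¹)` of the
decorations. -/
theorem translate [LieGroup IH ∞ H] {𝔛 : LieCrossedModule IG IH G H}
    (hCα : ∀ (p : P) (g : G) (v : TangentSpace IP p),
      C (p <• g) (rightTranslate IP g v) = 𝔛.lieα g⁻¹ (C p v))
    (hd : DecoratesAt A C p h t) (g : G) :
    DecoratesAt A C (fun s => p s <• g) (fun s => 𝔛.α g⁻¹ (h s)) t := by
  obtain ⟨v, h1, h2, h3⟩ := hd
  have hα : ContMDiff IH IH ∞ (fun x : H => 𝔛.α g⁻¹ x) :=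
    𝔛.smooth_α.comp ((contMDiff_const (c := g⁻¹)).prodMk contMDiff_id)
  have hαd : MDifferentiable IH IH (fun x : H => 𝔛.α g⁻¹ x) := hα.mdifferentiable (by simp)
  refine ⟨tangentAt IP IP (fun q : P => q <• g) (p t) v, h1.comp_map
    ((B.translate_contMDiff g).mdifferentiable one_ne_zero _), ?_, ?_⟩
  · refine (A.equivariant (p t) g v).trans ?_
    have h4 : A.form (p t) v = 0 := h2
    rw [h4]
    exact map_zero (mfderiv IG IG (fun x : G => g⁻¹ * x * g⁻¹⁻¹) (1 : G))
  · have h4 := h3.comp_map (hαd (h t))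
    have h5 : oneFormAt EH C (p t <• g) (tangentAt IP IP (fun q : P => q <• g) (p t) v) =
        tangentAt IH IH (fun x : H => 𝔛.α g⁻¹ x) 1 (oneFormAt EH C (p t) v) := hCα (p t) g v
    have h6 : ∀ Y : EH, tangentAt IH IH (fun x : H => 𝔛.α g⁻¹ x) (h t) (leftInv IH (h t) Y) =
        leftInv IH (𝔛.α g⁻¹ (h t)) (tangentAt IH IH (fun x : H => 𝔛.α g⁻¹ x) 1 Y) := by
      intro Y
      have e1 := tangentAt_comp (I := IH) (F := fun x : H => h t * x) (x := 1) (hαd _)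
        (mdifferentiable_leftMul (h t) _) Y
      have e2 := tangentAt_comp (I := IH) (I'' := IH) (F := fun x : H => 𝔛.α g⁻¹ x)
        (G := fun x : H => 𝔛.α g⁻¹ (h t) * x) (x := 1) (mdifferentiable_leftMul _ _) (hαd _) Y
      simp only [map_mul] at e1
      simp only [mul_one, map_one] at e1 e2
      rw [leftInv, leftInv, ← e1, e2]
    rw [h6, map_neg, ← h5] at h4
    exact h4

end DecoratesAt

theorem IsDecorationSolution.exists_decoratesAt {γ : ParamPath IP P} {h : ℝ → H}
    (hh : IsDecorationSolution C γ h) (hγ : A.IsHorizontal γ) :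
    ∃ S : Set ℝ, S.Finite ∧ ∀ t ∈ Ioo γ.a γ.b, t ∉ S → DecoratesAt A C γ.toFun h t := by
  obtain ⟨S, hS, hv⟩ := γ.piecewiseC1.exists_velocity
  refine ⟨S, hS, fun t ht htS => ?_⟩
  obtain ⟨v, hv⟩ := hv t ht htS
  have hvel : γ.HasVelocity t v :=
    ⟨ht.1.trans ht.2, Ioo_subset_Icc_self ht, hv.mono (subset_univ _)⟩
  have h1 : HasVelWithin IH h (Icc γ.a γ.b) t (leftInv IH (h t) (-oneFormAt EH C (γ.toFun t) v)) :=
    hh.equation t v hvel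
  refine ⟨v, hv, hγ t v hvel, h1.mono_of_mem ?_⟩
  rw [nhdsWithin_univ]
  exact Icc_mem_nhds ht.1 ht.2

/-- A decorated horizontal curve is determined by its projection and by its initial values. -/
theorem eqOn_of_decoratesAt [CompleteSpace EG] [CompleteSpace EH] [LieGroup IG ∞ G]
    [LieGroup IH ∞ H] {p q : ℝ → P} {h k : ℝ → H} {a b : ℝ} (hp : ContinuousOn p (Icc a b))
    (hq : ContinuousOn q (Icc a b)) (hpq : ∀ t ∈ Icc a b, B.proj (p t) = B.proj (q t))
    (hpq0 : p a = q a) (hh : ContinuousOn h (Icc a b)) (hk : ContinuousOn k (Icc a b))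
    (hhk0 : h a = k a) {S : Set ℝ} (hS : S.Finite)
    (hd : ∀ t ∈ Ioo a b, t ∉ S → DecoratesAt A C p h t ∧ DecoratesAt A C q k t) :
    EqOn p q (Icc a b) ∧ EqOn h k (Icc a b) := by
  have heq : EqOn p q (Icc a b) := by
    intro t ht
    have hsub : Icc a t ⊆ Icc a b := Icc_subset_Icc le_rfl ht.2
    refine A.horizontal_unique ht.1 (hp.mono hsub) (hq.mono hsub) (fun r hr => hpq r (hsub hr)) hpq0
      hS fun r hr hrS => ?_
    obtain ⟨⟨v, h1, h2, -⟩, ⟨v', h1', h2', -⟩⟩ := hd r ⟨hr.1, hr.2.trans_le ht.2⟩ hrS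
    exact ⟨⟨v, h1, h2⟩, ⟨v', h1', h2'⟩⟩
  refine ⟨heq, fun t ht => ?_⟩
  have hsub : Icc a t ⊆ Icc a b := Icc_subset_Icc le_rfl ht.2
  refine leftInv_solution_unique (I := IH) ht.1 (hh.mono hsub) (hk.mono hsub) hhk0 hS
    fun r hr hrS => ?_
  have hr' : r ∈ Ioo a b := ⟨hr.1, hr.2.trans_le ht.2⟩
  obtain ⟨⟨v, h1, -, h3⟩, ⟨v', h1', -, h3'⟩⟩ := hd r hr' hrS
  have hvv : v = v' := h1.unique (h1'.congr_Ioo (fun t ht => heq (Ioo_subset_Icc_self ht)) hr')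
    uniqueDiffWithinAt_univ
  rw [← hvv, ← heq (Ioo_subset_Icc_self hr')] at h3'
  exact ⟨_, h3, h3'⟩

namespace HasDecoration

variable {γ δ : ParamPath IP P} {k l : H}

theorem of_isDecorationSolution (hγ : A.IsHorizontal γ) {h : ℝ → H}
    (hh : IsDecorationSolution C γ h) : HasDecoration A C γ (h γ.b) := by
  obtain ⟨S, hS, hd⟩ := hh.exists_decoratesAt hγ
  exact ⟨h, hh.continuousOn, hh.initial, rfl, S, hS, hd⟩

theorem unique [CompleteSpace EG] [CompleteSpace EH] [LieGroup IG ∞ G] [LieGroup IH ∞ H]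
    (hγ : HasDecoration A C γ k) (hδ : HasDecoration A C δ l)
    (ha : γ.a = δ.a) (hb : γ.b = δ.b) (hs : γ.source = δ.source)
    (hp : ∀ t ∈ Icc γ.a γ.b, B.proj (γ.toFun t) = B.proj (δ.toFun t)) :
    ParamPath.SameOn γ δ ∧ k = l := by
  obtain ⟨h, hc, h0, rfl, S, hS, hd⟩ := hγ
  obtain ⟨h', hc', h0', rfl, S', hS', hd'⟩ := hδ
  have hγc := γ.piecewiseC1.1
  have hδc := δ.piecewiseC1.1
  rw [ParamPath.source, ParamPath.source] at hs
  rw [← ha] at h0' hδc hc' hs hd'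
  rw [← hb] at hc' hd' hδc ⊢
  obtain ⟨h1, h2⟩ := eqOn_of_decoratesAt hγc hδc hp hs hc hc' (h0.trans h0'.symm) (hS.union hS')
    fun t ht htS => ⟨hd t ht fun h => htS (Or.inl h), hd' t ht fun h => htS (Or.inr h)⟩
  exact ⟨⟨ha, hb, h1⟩, h2 (right_mem_Icc.2 γ.le)⟩

/-- The decoration of the second path is continued by a left translation. The time at which the
paths are joined is added to the exceptional set. -/
theorem trans [LieGroup IH ∞ H] (hγ : HasDecoration A C γ k) (hδ : HasDecoration A C δ l)
    (hγδ : γ.target = δ.source) : HasDecoration A C (γ.trans δ hγδ) (k * l) := by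
  obtain ⟨h, hc, h0, rfl, S, hS, hd⟩ := hγ
  obtain ⟨h', hc', h0', rfl, S', hS', hd'⟩ := hδ
  have hb : (γ.trans δ hγδ).b = γ.b + (δ.b - δ.a) := rfl
  have ha : (γ.trans δ hγδ).a = γ.a := rfl
  set f : ℝ → H := fun t => if t ≤ γ.b then h t else h γ.b * h' (t - γ.b + δ.a) with hf
  have e1 : ∀ t, t ≤ γ.b → f t = h t := fun t ht => if_pos ht
  have e2 : ∀ t, γ.b ≤ t → f t = h γ.b * h' (t - γ.b + δ.a) := by
    intro t ht
    rcases ht.eq_or_lt with rfl | ht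
    · simp [hf, h0']
    · exact if_neg (not_le.2 ht)
  have hδle := δ.le
  have hu : Icc γ.a (γ.b + (δ.b - δ.a)) = Icc γ.a γ.b ∪ Icc γ.b (γ.b + (δ.b - δ.a)) :=
    (Icc_union_Icc_eq_Icc γ.le (by linarith)).symm
  refine ⟨f, ?_, (e1 _ γ.le).trans h0, ?_, S ∪ {γ.b} ∪ (fun t => t - δ.a + γ.b) '' S',
    (hS.union (finite_singleton _)).union (hS'.image _), fun t ht htS => ?_⟩
  · rw [ha, hb, hu]
    refine ContinuousOn.union_of_isClosed (hc.congr fun t ht => e1 t ht.2) ?_ isClosed_Icc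
      isClosed_Icc
    refine ContinuousOn.congr (f := fun t => h γ.b * h' (t - γ.b + δ.a)) ?_ fun t ht => e2 t ht.1
    refine (contMDiff_mul_left (I := IH) (n := ∞) (a := h γ.b)).continuous.comp_continuousOn
      (hc'.comp (by fun_prop) fun t ht => ⟨by linarith [ht.1], by linarith [ht.2]⟩)
  · rw [hb, e2 _ (by linarith)]
    congr 2
    ring
  · rw [ha, hb] at ht
    rcases lt_trichotomy t γ.b with hlt | rfl | hlt
    · exact (hd t ⟨ht.1, hlt⟩ fun h => htS (Or.inl (Or.inl h))).congr (x := γ.a) (y := γ.b)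
        ⟨ht.1, hlt⟩ (fun s hs => ParamPath.trans_of_le _ _ _ hs.2.le) fun s hs => e1 s hs.2.le
    · exact absurd (Or.inl (Or.inr rfl)) htS
    · have hr : t - γ.b + δ.a ∈ Ioo δ.a δ.b := ⟨by linarith, by linarith [ht.2]⟩
      have h1 := hd' _ hr fun h => htS (Or.inr ⟨_, h, by ring⟩)
      have hφ : HasDerivWithinAt (fun s : ℝ => s - γ.b + δ.a) 1 univ t :=
        ((hasDerivWithinAt_id t univ).sub_const γ.b).add_const δ.a
      exact ((h1.comp_param (φ := fun s => s - γ.b + δ.a) hφ).mul_left (h γ.b)).congr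
        (x := γ.b) (y := γ.b + (δ.b - δ.a)) ⟨hlt, ht.2⟩
        (fun s hs => ParamPath.trans_of_ge _ _ _ hs.1.le) fun s hs => e2 s hs.1.le

theorem reverse [LieGroup IH ∞ H] (hγ : HasDecoration A C γ k) :
    HasDecoration A C γ.reverse k⁻¹ := by
  obtain ⟨h, hc, h0, rfl, S, hS, hd⟩ := hγ
  refine ⟨fun t => (h γ.b)⁻¹ * h (γ.a + γ.b - t), ?_, ?_, ?_, (fun t => γ.a + γ.b - t) '' S,
    hS.image _, fun t ht htS => ?_⟩
  · refine (contMDiff_mul_left (I := IH) (n := ∞) (a := (h γ.b)⁻¹)).continuous.comp_continuousOn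
      (hc.comp (by fun_prop) fun t ht => ⟨?_, ?_⟩)
    · linarith [show t ≤ γ.b from ht.2]
    · linarith [show γ.a ≤ t from ht.1]
  · change (h γ.b)⁻¹ * h (γ.a + γ.b - γ.a) = 1
    rw [add_sub_cancel_left, inv_mul_cancel]
  · change (h γ.b)⁻¹ * h (γ.a + γ.b - γ.b) = (h γ.b)⁻¹
    rw [add_sub_cancel_right, h0, mul_one]
  · have ht1 : γ.a < t := ht.1
    have ht2 : t < γ.b := ht.2
    have h1 := hd (γ.a + γ.b - t) ⟨by linarith, by linarith⟩ fun h => htS ⟨_, h, by ring⟩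
    have hφ : HasDerivWithinAt (fun s : ℝ => γ.a + γ.b - s) (-1) univ t :=
      (hasDerivWithinAt_id t univ).const_sub (γ.a + γ.b)
    exact (h1.comp_param hφ).mul_left _

theorem translate [LieGroup IH ∞ H] {𝔛 : LieCrossedModule IG IH G H}
    (hCα : ∀ (p : P) (g : G) (v : TangentSpace IP p),
      C (p <• g) (rightTranslate IP g v) = 𝔛.lieα g⁻¹ (C p v))
    (hγ : HasDecoration A C γ k) (g : G) :
    HasDecoration A C (γ.map _ (B.translate_contMDiff g)) (𝔛.α g⁻¹ k) := by
  obtain ⟨h, hc, h0, rfl, S, hS, hd⟩ := hγ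
  have hα : ContMDiff IH IH ∞ (fun x : H => 𝔛.α g⁻¹ x) :=
    𝔛.smooth_α.comp ((contMDiff_const (c := g⁻¹)).prodMk contMDiff_id)
  exact ⟨fun t => 𝔛.α g⁻¹ (h t), hα.continuous.comp_continuousOn hc,
    (congrArg (𝔛.α g⁻¹) h0).trans (map_one _), rfl, S, hS,
    fun t ht htS => (hd t ht htS).translate hCα g⟩

theorem reparam {γ' : ParamPath IP P} (hγ : HasDecoration A C γ k)
    (hr : ParamPath.IsReparam γ' γ) : HasDecoration A C γ' k := by
  obtain ⟨h, hc, h0, rfl, S, hS, hd⟩ := hγ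
  obtain ⟨φ, hφ, hmono, ha, hb, he⟩ := hr
  obtain ⟨T, hT, hφv⟩ := hφ.exists_velocity
  have hmaps : MapsTo φ (Icc γ'.a γ'.b) (Icc γ.a γ.b) := by
    intro t ht
    rw [← ha, ← hb]
    exact ⟨hmono.monotoneOn (left_mem_Icc.2 γ'.le) ht ht.1,
      hmono.monotoneOn ht (right_mem_Icc.2 γ'.le) ht.2⟩
  refine ⟨fun t => h (φ t), hc.comp hφ.1 hmaps, by simp [ha, h0], by simp [hb],
    T ∪ (φ ⁻¹' S ∩ Icc γ'.a γ'.b), hT.union ?_, fun t ht htS => ?_⟩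
  · refine Finite.of_finite_image (hS.subset ?_) (hmono.injOn.mono inter_subset_right)
    rintro _ ⟨t, ht, rfl⟩
    exact ht.1
  · have ht' := Ioo_subset_Icc_self ht
    obtain ⟨r, hr⟩ := hφv t ht fun h => htS (Or.inl h)
    have hφt : φ t ∈ Ioo γ.a γ.b := by
      rw [← ha, ← hb]
      exact ⟨hmono (left_mem_Icc.2 γ'.le) ht' ht.1, hmono ht' (right_mem_Icc.2 γ'.le) ht.2⟩
    have h1 := hd (φ t) hφt fun h => htS (Or.inr ⟨h, ht'⟩)
    exact (h1.comp_param hr.hasDerivWithinAt).congr ht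
      (fun s hs => he s (Ioo_subset_Icc_self hs)) fun s _ => rfl

end HasDecoration

end Decorations

/-! ### Decorated horizontal lifts and backtrack equivalence -/

section Lifts

variable {EG : Type*} [NormedAddCommGroup EG] [NormedSpace ℝ EG] {KG : Type*} [TopologicalSpace KG]
  {EH : Type*} [NormedAddCommGroup EH] [NormedSpace ℝ EH] {KH : Type*} [TopologicalSpace KH]
  {EP : Type*} [NormedAddCommGroup EP] [NormedSpace ℝ EP] {KP : Type*} [TopologicalSpace KP]
  {EM : Type*} [NormedAddCommGroup EM] [NormedSpace ℝ EM] {KM : Type*} [TopologicalSpace KM]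
  {IG : ModelWithCorners ℝ EG KG} {IH : ModelWithCorners ℝ EH KH}
  {IP : ModelWithCorners ℝ EP KP} {IM : ModelWithCorners ℝ EM KM}
  {G : Type*} [Group G] [TopologicalSpace G] [ChartedSpace KG G]
  {H : Type*} [Group H] [TopologicalSpace H] [ChartedSpace KH H]
  {P : Type*} [TopologicalSpace P] [ChartedSpace KP P] [IsManifold IP ∞ P]
  {M : Type*} [TopologicalSpace M] [ChartedSpace KM M]
  [MulAction Gᵐᵒᵖ P] {B : PrincipalBundle IP IM IG P M G}
  {A : ConnectionForm B} {C : ∀ p : P, TangentSpace IP p →L[ℝ] GroupLieAlgebra IH H}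

/-- `γ'` is a horizontal path over `γ`, and `k` is the final value of its decoration. -/
structure IsDecoratedLift (A : ConnectionForm B)
    (C : ∀ p : P, TangentSpace IP p →L[ℝ] GroupLieAlgebra IH H) (γ : ParamPath IM M)
    (γ' : ParamPath IP P) (k : H) : Prop where
  left_eq : γ'.a = γ.a
  right_eq : γ'.b = γ.b
  proj_eq : ∀ t ∈ Icc γ.a γ.b, B.proj (γ'.toFun t) = γ.toFun t
  hasDecoration : HasDecoration A C γ' k

namespace IsDecoratedLift

variable {γ δ : ParamPath IM M} {γ' δ' γ'' : ParamPath IP P} {k l : H}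

theorem of_isHorizontalLift {u : P} (h : IsHorizontalLift A γ u γ') {f : ℝ → H}
    (hf : IsDecorationSolution C γ' f) : IsDecoratedLift A C γ γ' (f γ.b) :=
  ⟨h.left_eq, h.right_eq, h.proj_eq,
    h.right_eq ▸ HasDecoration.of_isDecorationSolution h.horizontal hf⟩

theorem sameOn_map (h : IsDecoratedLift A C γ γ' k) :
    ParamPath.SameOn (γ'.map _ B.proj_contMDiff) γ :=
  ⟨h.left_eq, h.right_eq, fun t ht => h.proj_eq t (h.left_eq ▸ h.right_eq ▸ ht)⟩

theorem proj_source (h : IsDecoratedLift A C γ γ' k) : B.proj γ'.source = γ.source :=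
  h.sameOn_map.isReparam.source_eq

theorem proj_target (h : IsDecoratedLift A C γ γ' k) : B.proj γ'.target = γ.target :=
  h.sameOn_map.isReparam.target_eq

theorem of_hasDecoration (h : HasDecoration A C γ' k) :
    IsDecoratedLift A C (γ'.map _ B.proj_contMDiff) γ' k :=
  ⟨rfl, rfl, fun _ _ => rfl, h⟩

theorem congr (h : IsDecoratedLift A C γ γ' k) (hγ : ParamPath.SameOn γ δ) :
    IsDecoratedLift A C δ γ' k :=
  ⟨h.left_eq.trans hγ.1, h.right_eq.trans hγ.2.1, fun t ht => by
    rw [← hγ.1, ← hγ.2.1] at ht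
    rw [h.proj_eq t ht, hγ.2.2 t ht], h.hasDecoration⟩

theorem exists_reparam (h : IsDecoratedLift A C γ γ' k) (hr : ParamPath.IsReparam δ γ) :
    ∃ δ' : ParamPath IP P, IsDecoratedLift A C δ δ' k ∧ ParamPath.IsReparam δ' γ' := by
  obtain ⟨φ, hφ, hmono, ha, hb, he⟩ := hr
  have hpc : PiecewiseC1On IP γ'.toFun (φ δ.a) (φ δ.b) := by
    rw [ha, hb, ← h.left_eq, ← h.right_eq]
    exact γ'.piecewiseC1
  set δ' : ParamPath IP P :=
    ⟨δ.a, δ.b, δ.le, fun t => γ'.toFun (φ t), hpc.comp_strictMonoOn hφ hmono δ.le⟩ with hδ'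
  have hr' : ParamPath.IsReparam δ' γ' :=
    ⟨φ, hφ, hmono, ha.trans h.left_eq.symm, hb.trans h.right_eq.symm, fun t _ => rfl⟩
  refine ⟨δ', ⟨rfl, rfl, fun t ht => ?_, h.hasDecoration.reparam hr'⟩, hr'⟩
  rw [he t ht]
  refine h.proj_eq _ ?_
  rw [← ha, ← hb]
  exact ⟨hmono.monotoneOn (left_mem_Icc.2 δ.le) ht ht.1,
    hmono.monotoneOn ht (right_mem_Icc.2 δ.le) ht.2⟩

variable [LieGroup IH ∞ H]

theorem trans (h : IsDecoratedLift A C γ γ' k) (h' : IsDecoratedLift A C δ δ' l)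
    (hγδ : γ.target = δ.source) (hγδ' : γ'.target = δ'.source) :
    IsDecoratedLift A C (γ.trans δ hγδ) (γ'.trans δ' hγδ') (k * l) := by
  refine (of_hasDecoration (h.hasDecoration.trans h'.hasDecoration hγδ')).congr ?_
  rw [ParamPath.map_trans]
  exact h.sameOn_map.congr h'.sameOn_map _ _

theorem reverse (h : IsDecoratedLift A C γ γ' k) :
    IsDecoratedLift A C γ.reverse γ'.reverse k⁻¹ := by
  refine (of_hasDecoration h.hasDecoration.reverse).congr
    ⟨h.left_eq, h.right_eq, fun t ht => ?_⟩
  have h1 : t ∈ Icc γ'.a γ'.b := ht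
  have h2 := h.proj_eq (γ'.a + γ'.b - t) ⟨by linarith [h1.2, h.left_eq], by
    linarith [h1.1, h.right_eq]⟩
  exact h2.trans (by rw [h.left_eq, h.right_eq]; rfl)

theorem translate {𝔛 : LieCrossedModule IG IH G H}
    (hCα : ∀ (p : P) (g : G) (v : TangentSpace IP p),
      C (p <• g) (rightTranslate IP g v) = 𝔛.lieα g⁻¹ (C p v))
    (h : IsDecoratedLift A C γ γ' k) (g : G) :
    IsDecoratedLift A C γ (γ'.map _ (B.translate_contMDiff g)) (𝔛.α g⁻¹ k) :=
  ⟨h.left_eq, h.right_eq, fun t ht => (B.proj_act _ _).trans (h.proj_eq t ht),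
    h.hasDecoration.translate hCα g⟩

variable [LieGroup IG ∞ G] [CompleteSpace EG] [CompleteSpace EH]

theorem unique (h : IsDecoratedLift A C γ γ' k) (h' : IsDecoratedLift A C γ γ'' l)
    (hs : γ'.source = γ''.source) : ParamPath.SameOn γ' γ'' ∧ k = l := by
  refine h.hasDecoration.unique h'.hasDecoration (h.left_eq.trans h'.left_eq.symm)
    (h.right_eq.trans h'.right_eq.symm) hs fun t ht => ?_
  rw [h.left_eq, h.right_eq] at ht
  rw [h.proj_eq t ht, h'.proj_eq t ht]

variable [IG.Boundaryless] [IH.Boundaryless]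

theorem exists_lift (A : ConnectionForm B)
    (hC : IsSmoothOneForm IP (F := EH) C) (γ : ParamPath IM M)
    {u : P} (hu : γ.source = B.proj u) :
    ∃ (γ' : ParamPath IP P) (k : H), IsDecoratedLift A C γ γ' k ∧ γ'.source = u ∧
      A.IsHorizontal γ' := by
  obtain ⟨γ', hγ'⟩ := A.exists_isHorizontalLift γ hu
  obtain ⟨h, hh⟩ := exists_isDecorationSolution hC γ'
  exact ⟨γ', _, of_isHorizontalLift hγ' hh, hγ'.source_eq, hγ'.horizontal⟩

/-- The lift of `a d d⁻¹ b` runs along the lift of `d` and back, and the factors that `d` and `d⁻¹`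
contribute to the decoration cancel. -/
theorem backtrackEquiv_of_spur (hC : IsSmoothOneForm IP (F := EH) C) {a d b c₁ c₂ : ParamPath IM M}
    {hd : a.target = d.source} {hb : a.target = b.source}
    (h₁ : ParamPath.IsReparam (ParamPath.withSpur a d b hd hb) c₁)
    (h₂ : ParamPath.IsReparam (a.trans b hb) c₂) (hl₁ : IsDecoratedLift A C c₁ γ' k)
    (hl₂ : IsDecoratedLift A C c₂ γ'' l) (hs : γ'.source = γ''.source) :
    ParamPath.BacktrackEquiv γ' γ'' ∧ k = l := by
  obtain ⟨σ₁, hσ₁, hr₁⟩ := hl₁.exists_reparam h₁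
  obtain ⟨σ₂, hσ₂, hr₂⟩ := hl₂.exists_reparam h₂
  have hsa : a.source = B.proj γ''.source := by
    rw [hl₂.proj_source, ← h₂.source_eq, ParamPath.source_trans]
  obtain ⟨a', ka, ha', hsa', -⟩ := exists_lift A hC a hsa
  obtain ⟨d', kd, hd', hsd', -⟩ := exists_lift A hC d (u := a'.target) (by rw [ha'.proj_target, hd])
  obtain ⟨b', kb, hb', hsb', -⟩ := exists_lift A hC b (u := a'.target) (by rw [ha'.proj_target, hb])
  have k1 := ((ha'.trans hd' hd hsd'.symm).trans hd'.reverse (by simp) (by simp)).trans hb'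
    (by simp [← hd, hb]) (by simp [hsd', hsb'])
  have k2 := ha'.trans hb' hb hsb'.symm
  have u1 := hσ₁.unique k1 (by simp [hr₁.source_eq, hs, hsa'])
  have u2 := hσ₂.unique k2 (by simp [hr₂.source_eq, hsa'])
  refine ⟨?_, ?_⟩
  · refine hr₁.equiv.symm.trans (u1.1.equiv.trans ?_)
    refine ParamPath.BacktrackEquiv.trans ?_ (u2.1.symm.equiv.trans hr₂.equiv)
    exact ParamPath.BacktrackEquiv.erase a' d' b' hsd'.symm hsb'.symm
  · rw [u1.2, u2.2, mul_inv_cancel_right]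

/-- Decorated lifts of backtrack equivalent paths are backtrack equivalent, with the same
decoration. -/
theorem backtrackEquiv (hC : IsSmoothOneForm IP (F := EH) C)
    (hγδ : ParamPath.BacktrackEquiv γ δ) (h : IsDecoratedLift A C γ γ' k)
    (h' : IsDecoratedLift A C δ δ' l) (hs : γ'.source = δ'.source) :
    ParamPath.BacktrackEquiv γ' δ' ∧ k = l := by
  induction hγδ generalizing δ' l with
  | refl =>
    have hu := h.unique h' hs
    exact ⟨hu.1.equiv, hu.2⟩
  | @tail c₁ c₂ h₁ h₂ ih =>
    obtain ⟨c', m, hc', hsc', -⟩ := exists_lift A hC c₁ (u := δ'.source) (by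
      rw [h'.proj_source, h₂.source_eq])
    obtain ⟨e1, e2⟩ := ih hc' (hs.trans hsc'.symm)
    have key : ParamPath.BacktrackEquiv c' δ' ∧ m = l := by
      obtain ⟨a, d, b, hd, hb, ⟨r1, r2⟩ | ⟨r1, r2⟩⟩ := h₂
      · exact backtrackEquiv_of_spur hC r1 r2 hc' h' hsc'
      · have := backtrackEquiv_of_spur hC r2 r1 h' hc' hsc'.symm
        exact ⟨this.1.symm, this.2.symm⟩
    exact ⟨e1.trans key.1, e2.trans key.2⟩

end IsDecoratedLift

end Lifts

/-! ### The categorical connection -/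

section CategoricalConnection

variable {EG : Type*} [NormedAddCommGroup EG] [NormedSpace ℝ EG] {KG : Type*} [TopologicalSpace KG]
  {EH : Type*} [NormedAddCommGroup EH] [NormedSpace ℝ EH] {KH : Type*} [TopologicalSpace KH]
  {EP : Type*} [NormedAddCommGroup EP] [NormedSpace ℝ EP] {KP : Type*} [TopologicalSpace KP]
  {EM : Type*} [NormedAddCommGroup EM] [NormedSpace ℝ EM] {KM : Type*} [TopologicalSpace KM]
  {IG : ModelWithCorners ℝ EG KG} {IH : ModelWithCorners ℝ EH KH}
  {IP : ModelWithCorners ℝ EP KP} {IM : ModelWithCorners ℝ EM KM}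
  {G : Type*} [Group G] [TopologicalSpace G] [ChartedSpace KG G]
  {H : Type*} [Group H] [TopologicalSpace H] [ChartedSpace KH H]
  {P : Type*} [TopologicalSpace P] [ChartedSpace KP P]
  {M : Type*} [TopologicalSpace M] [ChartedSpace KM M]
  [MulAction Gᵐᵒᵖ P] {B : PrincipalBundle IP IM IG P M G}
  {𝔛 : LieCrossedModule IG IH G H} {C : ∀ p : P, TangentSpace IP p →L[ℝ] GroupLieAlgebra IH H}

theorem PathCat.arrow_ext {E : Type*} [NormedAddCommGroup E] [NormedSpace ℝ E] {K : Type*}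
    [TopologicalSpace K] {I : ModelWithCorners ℝ E K} {X : Type*} [TopologicalSpace X]
    [ChartedSpace K X] {f g : Arrow (PathCat I X)} (h : f.hom.1 = g.hom.1) : f = g := by
  obtain ⟨a, b, ⟨p, rfl, rfl⟩, rfl⟩ := f.mk_surjective
  obtain ⟨c, d, ⟨q, rfl, rfl⟩, rfl⟩ := g.mk_surjective
  obtain rfl : p = q := h
  rfl

theorem PathCat.exists_eq_arrow {E : Type*} [NormedAddCommGroup E] [NormedSpace ℝ E] {K : Type*}
    [TopologicalSpace K] {I : ModelWithCorners ℝ E K} {X : Type*} [TopologicalSpace X]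
    [ChartedSpace K X] (f : Arrow (PathCat I X)) : ∃ γ : ParamPath I X, f = γ.arrow := by
  obtain ⟨γ, hγ⟩ := Quotient.exists_rep f.hom.1
  exact ⟨γ, PathCat.arrow_ext hγ.symm⟩

theorem PathCat.arrowComp_hom {E : Type*} [NormedAddCommGroup E] [NormedSpace ℝ E] {K : Type*}
    [TopologicalSpace K] {I : ModelWithCorners ℝ E K} {X : Type*} [TopologicalSpace X]
    [ChartedSpace K X] (f g : Arrow (PathCat I X)) (h : f.right = g.left) :
    (arrowComp f g h).hom.1 = f.hom.1.trans g.hom.1 := by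
  obtain ⟨a, b, p, rfl⟩ := f.mk_surjective
  obtain ⟨c, d, q, rfl⟩ := g.mk_surjective
  obtain rfl : b = c := h
  simp only [arrowComp, Arrow.mk_hom, eqToHom_refl]
  erw [Category.id_comp]
  rfl

theorem PrincipalBundle.exists_act_eq (B : PrincipalBundle IP IM IG P M G) {p q : P}
    (h : B.proj p = B.proj q) : ∃ g : G, p <• g = q := by
  obtain ⟨U, σ, δ, -, hU, -, -, -, hσδ⟩ := B.exists_section (B.proj p)
  refine ⟨(δ p)⁻¹ * δ q, ?_⟩
  have h1 := hσδ p hU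
  have h2 := hσδ q (h ▸ hU)
  calc p <• ((δ p)⁻¹ * δ q) = (σ (B.proj p) <• δ p) <• ((δ p)⁻¹ * δ q) := by rw [h1]
    _ = q := by rw [act_act_eq, mul_inv_cancel_left, h, h2]

namespace DecoratedCat

theorem decAct_one_right (m : BtPath IP P × H) : decAct B 𝔛 m 1 = m := by
  refine Prod.ext (BtPath.map_id _ _ (fun x => act_one_eq x) _) ?_
  simp [decAct]

theorem decAct_mul (m : BtPath IP P × H) (φ ψ : H ⋊[𝔛.α] G) :
    decAct B 𝔛 m (φ * ψ) = decAct B 𝔛 (decAct B 𝔛 m φ) ψ := by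
  refine Prod.ext (BtPath.map_map _ _ _ _ _ _ (fun x => act_act_eq x _ _) _).symm ?_
  have e : 𝔛.α φ.right⁻¹ (𝔛.α φ.right ψ.left) = ψ.left := by
    rw [← MulAut.mul_apply, ← map_mul, inv_mul_cancel, map_one, MulAut.one_apply]
  simp only [decAct]
  rw [SemidirectProduct.mul_left, SemidirectProduct.mul_right, mul_inv_rev, mul_inv_rev,
    map_mul 𝔛.α, MulAut.mul_apply, mul_assoc, map_mul (𝔛.α φ.right⁻¹), map_inv (𝔛.α φ.right⁻¹), e]

variable [IsManifold IP ∞ P] {A : ConnectionForm B}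

theorem arrow_ext {F F' : Arrow (DecoratedCat A 𝔛)} (h : F.hom.1 = F'.hom.1) : F = F' := by
  obtain ⟨a, b, ⟨m, hm, rfl, rfl⟩, rfl⟩ := F.mk_surjective
  obtain ⟨c, d, ⟨n, hn, rfl, rfl⟩, rfl⟩ := F'.mk_surjective
  obtain rfl : m = n := h
  rfl

theorem arrowComp_hom (F F' : Arrow (DecoratedCat A 𝔛)) (h : F.right = F'.left) :
    (arrowComp F F' h).hom.1 = decTrans B 𝔛 F.hom.1 F'.hom.1 := by
  obtain ⟨a, b, p, rfl⟩ := F.mk_surjective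
  obtain ⟨c, d, q, rfl⟩ := F'.mk_surjective
  obtain rfl : b = c := h
  simp only [arrowComp, Arrow.mk_hom, eqToHom_refl]
  erw [Category.id_comp]
  rfl

/-- The morphism with underlying horizontal path and decoration `m`. -/
noncomputable def mkArrow (A : ConnectionForm B) (𝔛 : LieCrossedModule IG IH G H)
    (m : BtPath IP P × H) (hm : A.IsHorizontalBt m.1) : Arrow (DecoratedCat A 𝔛) :=
  Arrow.mk (X := (m.1.source : DecoratedCat A 𝔛)) (Y := (m.1.target <• 𝔛.τ m.2⁻¹ : P))
    ⟨m, hm, rfl, rfl⟩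

theorem isRightAction_act (A : ConnectionForm B) (𝔛 : LieCrossedModule IG IH G H) :
    IsRightAction (act A 𝔛) where
  obj_one p := act_one_eq (G := G) (P := P) p
  obj_mul p a b := (act_act_eq (G := G) (P := P) p a b).symm
  mor_one F := DecoratedCat.arrow_ext (decAct_one_right (B := B) (𝔛 := 𝔛) F.hom.1)
  mor_mul F φ ψ := DecoratedCat.arrow_ext (decAct_mul (B := B) (𝔛 := 𝔛) F.hom.1 φ.hom.1 ψ.hom.1)

end DecoratedCat

open DecoratedCat

variable [IsManifold IP ∞ P] {A : ConnectionForm B} [LieGroup IG ∞ G] [LieGroup IH ∞ H]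
  [CompleteSpace EG] [CompleteSpace EH] [IG.Boundaryless] [IH.Boundaryless]

/-- The decorated lift through `u` exists, and it does not depend on the chosen representative. -/
theorem exists_backtrackErasedLift (A : ConnectionForm B) (hC : IsSmoothOneForm IP (F := EH) C)
    (u : P) (q : BtPath IM M) (hq : q.source = B.proj u) :
    ∃ m : BtPath IP P × H, (A.IsHorizontalBt m.1 ∧ ∃ γ γ' k, BtPath.mk γ = q ∧
      IsDecoratedLift A C γ γ' k ∧ γ'.source = u ∧ m = (BtPath.mk γ', k)) ∧
      ∀ γ γ' k, BtPath.mk γ = q → IsDecoratedLift A C γ γ' k → γ'.source = u →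
        m = (BtPath.mk γ', k) := by
  obtain ⟨γ, rfl⟩ := Quotient.exists_rep q
  obtain ⟨γ', k, h, hs, hh⟩ := IsDecoratedLift.exists_lift A hC γ hq
  refine ⟨(BtPath.mk γ', k), ⟨⟨γ', hh, rfl⟩, γ, γ', k, rfl, h, hs, rfl⟩,
    fun δ δ' l hδ h' hs' => ?_⟩
  obtain ⟨e1, e2⟩ := h.backtrackEquiv hC (Quotient.exact hδ.symm) h' (hs.trans hs'.symm)
  exact Prod.ext (BtPath.sound e1) e2

/-- The decorated horizontal lift of a backtrack-erased path through the point `u`: the class of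
the lift of a representative, together with the final value of the decoration. -/
noncomputable def backtrackErasedLift (A : ConnectionForm B) (hC : IsSmoothOneForm IP (F := EH) C)
    (u : P) (q : BtPath IM M) (hq : q.source = B.proj u) : BtPath IP P × H :=
  (exists_backtrackErasedLift A hC u q hq).choose

theorem backtrackErasedLift_isHorizontalBt (hC : IsSmoothOneForm IP (F := EH) C) (u : P)
    (q : BtPath IM M) (hq : q.source = B.proj u) :
    A.IsHorizontalBt (backtrackErasedLift A hC u q hq).1 :=
  (exists_backtrackErasedLift A hC u q hq).choose_spec.1.1

theorem exists_backtrackErasedLift_eq (hC : IsSmoothOneForm IP (F := EH) C) (u : P)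
    (q : BtPath IM M) (hq : q.source = B.proj u) :
    ∃ γ γ' k, BtPath.mk γ = q ∧ IsDecoratedLift A C γ γ' k ∧ γ'.source = u ∧
      backtrackErasedLift A hC u q hq = (BtPath.mk γ', k) :=
  (exists_backtrackErasedLift A hC u q hq).choose_spec.1.2

theorem backtrackErasedLift_eq (hC : IsSmoothOneForm IP (F := EH) C) {u : P} {q : BtPath IM M}
    (hq : q.source = B.proj u) {γ : ParamPath IM M} {γ' : ParamPath IP P} {k : H}
    (hγ : BtPath.mk γ = q) (h : IsDecoratedLift A C γ γ' k) (hs : γ'.source = u) :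
    backtrackErasedLift A hC u q hq = (BtPath.mk γ', k) :=
  (exists_backtrackErasedLift A hC u q hq).choose_spec.2 γ γ' k hγ h hs

theorem source_backtrackErasedLift (hC : IsSmoothOneForm IP (F := EH) C) (u : P)
    (q : BtPath IM M) (hq : q.source = B.proj u) :
    (backtrackErasedLift A hC u q hq).1.source = u := by
  obtain ⟨γ, γ', k, -, -, hs, e⟩ := exists_backtrackErasedLift_eq (A := A) hC u q hq
  rw [e]
  exact hs

theorem map_proj_backtrackErasedLift (hC : IsSmoothOneForm IP (F := EH) C) (u : P)
    (q : BtPath IM M) (hq : q.source = B.proj u) :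
    (backtrackErasedLift A hC u q hq).1.map _ B.proj_contMDiff = q := by
  obtain ⟨γ, γ', k, rfl, h, -, e⟩ := exists_backtrackErasedLift_eq (A := A) hC u q hq
  rw [e]
  exact BtPath.sound h.sameOn_map.equiv

theorem backtrackErasedLift_congr (hC : IsSmoothOneForm IP (F := EH) C) (u : P)
    {q r : BtPath IM M} (h : q = r) (hq : q.source = B.proj u) (hr : r.source = B.proj u) :
    backtrackErasedLift A hC u q hq = backtrackErasedLift A hC u r hr := by
  subst h
  rfl

theorem backtrackErasedLift_act
    (hCα : ∀ (p : P) (g : G) (v : TangentSpace IP p),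
      C (p <• g) (rightTranslate IP g v) = 𝔛.lieα g⁻¹ (C p v))
    (hC : IsSmoothOneForm IP (F := EH) C) (u : P) (g : G)
    (q : BtPath IM M) (hq : q.source = B.proj u) (hq' : q.source = B.proj (u <• g)) :
    backtrackErasedLift A hC (u <• g) q hq' =
      decAct B 𝔛 (backtrackErasedLift A hC u q hq) ⟨1, g⟩ := by
  obtain ⟨γ, γ', k, rfl, h, rfl, e⟩ := exists_backtrackErasedLift_eq (A := A) hC u q hq
  rw [e, backtrackErasedLift_eq hC hq' rfl (h.translate hCα g) rfl]
  simp [decAct]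

/-- Lifting is functorial: by equivariance, translating the second lift by `τ(k)`, where `k` is the
decoration of the first one, conjugates its decoration by `k`. -/
theorem backtrackErasedLift_trans
    (hCα : ∀ (p : P) (g : G) (v : TangentSpace IP p),
      C (p <• g) (rightTranslate IP g v) = 𝔛.lieα g⁻¹ (C p v))
    (hC : IsSmoothOneForm IP (F := EH) C) {u v : P}
    {q r : BtPath IM M} (hq : q.source = B.proj u) (hqr : q.target = r.source)
    (hv : (backtrackErasedLift A hC u q hq).1.target <•
      𝔛.τ (backtrackErasedLift A hC u q hq).2⁻¹ = v) (hr : r.source = B.proj v)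
    (hqr' : (q.trans r).source = B.proj u) :
    backtrackErasedLift A hC u (q.trans r) hqr' =
      decTrans B 𝔛 (backtrackErasedLift A hC u q hq) (backtrackErasedLift A hC v r hr) := by
  obtain ⟨γ, γ', k, rfl, h, rfl, e⟩ := exists_backtrackErasedLift_eq (A := A) hC u q hq
  obtain ⟨δ, δ', l, rfl, h', hs, e'⟩ := exists_backtrackErasedLift_eq (A := A) hC v r hr
  rw [e] at hv
  have h1 := h'.translate hCα (𝔛.τ k)
  have hγδ : γ'.target = (δ'.map _ (B.translate_contMDiff (𝔛.τ k))).source := by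
    rw [ParamPath.source_map, hs]
    exact source_eq_act hv
  rw [e, e', backtrackErasedLift_eq hC hqr' (BtPath.trans_mk γ δ hqr).symm (h.trans h1 hqr hγδ)
    (ParamPath.source_trans _ _ _)]
  refine Prod.ext (BtPath.trans_mk _ _ hγδ).symm ?_
  simp only [decTrans]
  -- By the Peiffer identity `α(τ(k)⁻¹)` is conjugation by `k⁻¹`, so `k (k⁻¹ l k) = l k`.
  rw [← map_inv, 𝔛.α_τ]
  group

/-- The categorical connection given by decorated horizontal lifts. -/
noncomputable def decoratedConnection (A : ConnectionForm B)
    (hC : IsSmoothOneForm IP (F := EH) C)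
    (hCα : ∀ (p : P) (g : G) (v : TangentSpace IP p),
      C (p <• g) (rightTranslate IP g v) = 𝔛.lieα g⁻¹ (C p v)) :
    CategoricalConnection (DecoratedCat.proj A 𝔛) (DecoratedCat.act A 𝔛) where
  lift u f hf := mkArrow A 𝔛 (backtrackErasedLift A hC u f.hom.1 (f.hom.2.1.trans hf))
    (backtrackErasedLift_isHorizontalBt hC _ _ _)
  lift_source u f hf := source_backtrackErasedLift hC u f.hom.1 (f.hom.2.1.trans hf)
  lift_proj u f hf := PathCat.arrow_ext
    (map_proj_backtrackErasedLift hC u f.hom.1 (f.hom.2.1.trans hf))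
  lift_comp u v f g hf hfg hv hg := by
    refine arrow_ext ?_
    rw [arrowComp_hom]
    have h1 := PathCat.arrowComp_hom f g hfg
    have h3 : (arrowComp f g hfg).hom.1.source = B.proj u := (arrowComp f g hfg).hom.2.1.trans hf
    have h2 := backtrackErasedLift_trans (A := A) hCα hC (f.hom.2.1.trans hf)
      (f.hom.2.2.trans (hfg.trans g.hom.2.1.symm)) hv (g.hom.2.1.trans hg)
      (h1 ▸ h3)
    refine Eq.trans ?_ h2
    exact backtrackErasedLift_congr hC u h1 h3 _
  lift_act u g f hf hf' := arrow_ext (backtrackErasedLift_act hCα hC u g f.hom.1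
    (f.hom.2.1.trans hf) (f.hom.2.1.trans hf'))

/-- Decorated horizontal paths form a principal categorical bundle. Transitivity on morphisms holds
since, by uniqueness of lifts, a horizontal path is determined up to backtracking by its projection
and its initial point. -/
theorem isPrincipalCategoricalBundle (A : ConnectionForm B) (𝔛 : LieCrossedModule IG IH G H)
    (hC : IsSmoothOneForm IP (F := EH) C) :
    IsPrincipalCategoricalBundle (DecoratedCat.proj A 𝔛) (DecoratedCat.act A 𝔛) where
  action := isRightAction_act A 𝔛
  obj_surjective := B.proj_surjective
  mor_surjective f := by
    obtain ⟨u, hu⟩ := B.proj_surjective f.left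
    have hf : f.hom.1.source = B.proj u := f.hom.2.1.trans hu.symm
    exact ⟨mkArrow A 𝔛 _ (backtrackErasedLift_isHorizontalBt hC u f.hom.1 hf),
      PathCat.arrow_ext (map_proj_backtrackErasedLift hC u f.hom.1 hf)⟩
  obj_free p a := B.act_free p a
  mor_free F φ h := by
    have h1 : decAct B 𝔛 F.hom.1 φ.hom.1 = F.hom.1 :=
      congrArg (fun F : Arrow (DecoratedCat A 𝔛) => F.hom.1) h
    have h2 : φ.hom.1.right = 1 := by
      refine B.act_free F.hom.1.1.source _ ?_
      rw [← BtPath.source_map _ (B.translate_contMDiff _)]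
      exact congrArg (fun m => m.1.source) h1
    have h3 : φ.hom.1.left = 1 := by
      have := congrArg Prod.snd h1
      simpa [decAct, h2] using this
    exact LieCrossedModule.arrowEquiv.injective (SemidirectProduct.ext h3 h2)
  obj_fibre p a := B.proj_act p a
  mor_fibre F φ := PathCat.arrow_ext (BtPath.map_map _ _ _ _ _ _ (fun x => B.proj_act x _) _)
  obj_transitive p q h := B.exists_act_eq h
  mor_transitive F F' h := by
    obtain ⟨⟨γ, hγ, hγF⟩, -, -⟩ := F.hom.2
    obtain ⟨⟨δ, hδ, hδF⟩, -, -⟩ := F'.hom.2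
    have h1 : F.hom.1.1.map _ B.proj_contMDiff = F'.hom.1.1.map _ B.proj_contMDiff :=
      congrArg (fun f : Arrow (PathCat IM M) => f.hom.1) h
    rw [← hγF, ← hδF] at h1
    have h2 : ParamPath.BacktrackEquiv (γ.map _ B.proj_contMDiff) (δ.map _ B.proj_contMDiff) :=
      Quotient.exact h1
    obtain ⟨g, hg⟩ := B.exists_act_eq (p := γ.source) (q := δ.source) h2.source_eq
    -- The lifts are compared by `backtrackEquiv`, which concerns decorated paths; only its
    -- statement about the underlying paths is used, so any decorations will do.
    obtain ⟨f, hf⟩ := exists_isDecorationSolution hC (γ.map _ (B.translate_contMDiff g))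
    obtain ⟨f', hf'⟩ := exists_isDecorationSolution hC δ
    have h3 : IsDecoratedLift A C (γ.map _ B.proj_contMDiff) (γ.map _ (B.translate_contMDiff g))
        (f γ.b) :=
      ⟨rfl, rfl, fun t _ => B.proj_act _ _, .of_isDecorationSolution (hγ.translate g) hf⟩
    have h4 := IsDecoratedLift.of_hasDecoration (HasDecoration.of_isDecorationSolution hδ hf')
    have h5 := (h3.backtrackEquiv hC h2 h4 hg).1
    refine ⟨LieCrossedModule.arrow ⟨F.hom.1.2 * (𝔛.α g F'.hom.1.2)⁻¹, g⟩, arrow_ext ?_⟩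
    refine Prod.ext ?_ ?_
    · refine Eq.trans ?_ hδF
      change F.hom.1.1.map _ (B.translate_contMDiff g) = _
      rw [← hγF]
      exact BtPath.sound h5
    · change 𝔛.α g⁻¹ ((F.hom.1.2 * (𝔛.α g F'.hom.1.2)⁻¹)⁻¹ * F.hom.1.2) = F'.hom.1.2
      rw [mul_inv_rev, inv_inv, inv_mul_cancel_right, ← MulAut.mul_apply, ← map_mul,
        inv_mul_cancel, map_one, MulAut.one_apply]

end CategoricalConnection

theorem theoremT
    {EG : Type*} [NormedAddCommGroup EG] [NormedSpace ℝ EG] [FiniteDimensional ℝ EG]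
    {KG : Type*} [TopologicalSpace KG] {IG : ModelWithCorners ℝ EG KG} [IG.Boundaryless]
    {EH : Type*} [NormedAddCommGroup EH] [NormedSpace ℝ EH] [FiniteDimensional ℝ EH]
    {KH : Type*} [TopologicalSpace KH] {IH : ModelWithCorners ℝ EH KH} [IH.Boundaryless]
    {EP : Type*} [NormedAddCommGroup EP] [NormedSpace ℝ EP] [FiniteDimensional ℝ EP]
    {KP : Type*} [TopologicalSpace KP] {IP : ModelWithCorners ℝ EP KP} [IP.Boundaryless]
    {EM : Type*} [NormedAddCommGroup EM] [NormedSpace ℝ EM] [FiniteDimensional ℝ EM]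
    {KM : Type*} [TopologicalSpace KM] {IM : ModelWithCorners ℝ EM KM} [IM.Boundaryless]
    {G : Type*} [Group G] [TopologicalSpace G] [ChartedSpace KG G] [LieGroup IG ∞ G] [T2Space G]
    {H : Type*} [Group H] [TopologicalSpace H] [ChartedSpace KH H] [LieGroup IH ∞ H] [T2Space H]
    {P : Type*} [TopologicalSpace P] [ChartedSpace KP P] [IsManifold IP ∞ P] [T2Space P]
    {M : Type*} [TopologicalSpace M] [ChartedSpace KM M] [IsManifold IM ∞ M] [T2Space M]
    [MulAction Gᵐᵒᵖ P]
    (B : PrincipalBundle IP IM IG P M G) (A : ConnectionForm B) (𝔛 : LieCrossedModule IG IH G H)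
    (C : ∀ p : P, TangentSpace IP p →L[ℝ] GroupLieAlgebra IH H)
    (hC : IsSmoothOneForm IP (F := EH) C)
    (hCα : ∀ (p : P) (g : G) (v : TangentSpace IP p),
      C (p <• g) (rightTranslate IP g v) = 𝔛.lieα g⁻¹ (C p v)) :
    (∀ (γ : ParamPath IM M) (u : P), γ.source = B.proj u →
      ∃ (γ' : ParamPath IP P) (h : ℝ → H), IsHorizontalLift A γ u γ' ∧
        IsDecorationSolution C γ' h ∧
        ∀ (γ'' : ParamPath IP P) (h' : ℝ → H), IsHorizontalLift A γ u γ'' →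
          IsDecorationSolution C γ'' h' →
            EqOn γ''.toFun γ'.toFun (Icc γ.a γ.b) ∧ EqOn h' h (Icc γ.a γ.b)) ∧
    IsPrincipalCategoricalBundle (DecoratedCat.proj A 𝔛) (DecoratedCat.act A 𝔛) ∧
    ∃! 𝒜 : CategoricalConnection (DecoratedCat.proj A 𝔛) (DecoratedCat.act A 𝔛),
      ∀ (γ : ParamPath IM M) (u : P) (hu : γ.source = B.proj u) (γ' : ParamPath IP P)
        (hγ' : IsHorizontalLift A γ u γ') (h : ℝ → H), IsDecorationSolution C γ' h →
          𝒜.lift u γ.arrow hu = DecoratedCat.arrow A 𝔛 γ' hγ'.horizontal (h γ.b) := by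
  have : CompleteSpace EG := FiniteDimensional.complete ℝ EG
  have : CompleteSpace EH := FiniteDimensional.complete ℝ EH
  refine ⟨fun γ u hu => ?_, isPrincipalCategoricalBundle A 𝔛 hC, decoratedConnection A hC hCα,
    ?_, ?_⟩
  · obtain ⟨γ', hγ'⟩ := A.exists_isHorizontalLift γ hu
    obtain ⟨h, hh⟩ := exists_isDecorationSolution hC γ'
    refine ⟨γ', h, hγ', hh, fun γ'' h' hγ'' hh' => ?_⟩
    obtain ⟨S, hS, hd⟩ := hh.exists_decoratesAt hγ'.horizontal
    obtain ⟨S', hS', hd'⟩ := hh'.exists_decoratesAt hγ''.horizontal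
    have hc := γ'.piecewiseC1.1
    have hc' := γ''.piecewiseC1.1
    have hhc := hh.continuousOn
    have hhc' := hh'.continuousOn
    have h0 := hh.initial
    have h0' := hh'.initial
    have hs : γ''.toFun γ''.a = γ'.toFun γ'.a := hγ''.source_eq.trans hγ'.source_eq.symm
    rw [hγ'.left_eq, hγ'.right_eq] at hc hhc hd
    rw [hγ''.left_eq, hγ''.right_eq] at hc' hhc' hd'
    rw [hγ'.left_eq] at h0 hs
    rw [hγ''.left_eq] at h0' hs
    exact eqOn_of_decoratesAt (A := A) (C := C) hc' hc
      (fun t ht => (hγ''.proj_eq t ht).trans (hγ'.proj_eq t ht).symm) hs hhc' hhc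
      (h0'.trans h0.symm) (hS'.union hS) fun t ht htS =>
        ⟨hd' t ht fun h => htS (Or.inl h), hd t ht fun h => htS (Or.inr h)⟩
  · intro γ u hu γ' hγ' h hh
    exact DecoratedCat.arrow_ext (backtrackErasedLift_eq hC (q := BtPath.mk γ) hu rfl
      (IsDecoratedLift.of_isHorizontalLift hγ' hh) hγ'.source_eq)
  · intro 𝒜 h𝒜
    have key : 𝒜.lift = (decoratedConnection A hC hCα).lift := by
      funext u f hf
      obtain ⟨γ, rfl⟩ := PathCat.exists_eq_arrow f
      obtain ⟨γ', hγ'⟩ := A.exists_isHorizontalLift γ hf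
      obtain ⟨h, hh⟩ := exists_isDecorationSolution hC γ'
      rw [h𝒜 γ u hf γ' hγ' h hh]
      exact (DecoratedCat.arrow_ext (backtrackErasedLift_eq hC (q := BtPath.mk γ) hf rfl
        (IsDecoratedLift.of_isHorizontalLift hγ' hh) hγ'.source_eq)).symm
    cases 𝒜
    unfold decoratedConnection at key ⊢
    congr
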